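/- **Definitions.** A *finite groupoid* is a groupoid with finitely many isomorphism classes of objects, all of whose automorphism groups are finite. Finite groupoids, functors and natural isomorphisms form a $(2,1)$-category $\mathrm{Gpd}_{\mathrm{fin}}$. A *profinite groupoid* is an object of the $(2,1)$-category $\mathrm{Pro}(\mathrm{Gpd}_{\mathrm{fin}})$: a small cofiltered diagram $\mathscr{G} = (\mathscr{G}_i)_{i\in I}$ of finite groupoids; the groupoid of morphisms $\mathscr{G} \to \mathscr{H} = (\mathscr{H}_j)_{j \in J}$ is $\varprojlim_j \varinjlim_i \mathrm{Fun}(\mathscr{G}_i, \mathscr{H}_j)$ (2-limit and filtered 2-colimit). Let $\mathcal{C}$ be a category with finite limits. A morphism $y \to x$ of $\mathcal{C}$ is an *effective descent morphism* if the adjunction $\mathcal{C}_{/y} \rightleftarrows \mathcal{C}_{/x}$, whose left adjoint is composition with $y \to x$ and whose right adjoint is pullback along it, is monadic. A *Galois category* is a (small) category $\mathcal{C}$ such that: 1. $\mathcal{C}$ has finite limits and finite coproducts, and its initial object $\emptyset$ is empty (every morphism to $\emptyset$ is an isomorphism); 2. coproducts are disjoint (for all $x, y$ the square formed by $\emptyset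 \to x$, $\emptyset \to y$ and the inclusions of $x$ and $y$ in $x \sqcup y$ is cartesian) and distributive (for every $y \to x$ the pullback functor $\mathcal{C}_{/x} \to \mathcal{C}_{/y}$ preserves finite coproducts); 3. for every object $x$ there are an effective descent morphism $x' \to \ast$ to the terminal object and a decomposition $x' = x'_1 \sqcup \dots \sqcup x'_n$ such that each projection $x \times x'_i \to x'_i$ is isomorphic, over $x'_i$, to the fold map $\bigsqcup_{S_i} x'_i \to x'_i$ for a finite set $S_i$. (No fiber functor is assumed.) Let $\mathrm{GalCat}$ be the $(2,1)$-category whose objects are the Galois categories, whose morphisms are the functors preserving finite limits, finite coproducts and effective descent morphisms, and whose 2-morphisms are the natural isomorphisms. **Theorem (the Galois correspondence).** For every profinite groupoid $\mathscr{G} = (\mathscr{G}_i)$ the category $$\mathrm{Fun}(\mathscr{G}, \mathrm{FinSet}) := \varinjlim_i \mathrm{Fun}(\mathscr{G}_i, \mathrm{FinSet})$$ is a Galois category, for every morphism $f\colon \mathscr{G} \to \mathscr{H}$ of profinite groupoids the precomposition functor $f^* \colon \mathrm{Fun}(\mathscr{H}, \mathrm{FinSet}) \to \mathrm{Fun}(\mathscr{G},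 \mathrm{FinSet})$ is a morphism of $\mathrm{GalCat}$, and the resulting functor $$\mathrm{Pro}(\mathrm{Gpd}_{\mathrm{fin}})^{\mathrm{op}} \to \mathrm{GalCat}, \qquad \mathscr{G} \mapsto \mathrm{Fun}(\mathscr{G}, \mathrm{FinSet}),$$ is an equivalence of 2-categories: it induces an equivalence on every category of morphisms, and every Galois category is equivalent in $\mathrm{GalCat}$ to $\mathrm{Fun}(\mathscr{G}, \mathrm{FinSet})$ for some profinite groupoid $\mathscr{G}$. -/

import Mathlib

universe u
open CategoryTheory Bicategory Limits

/-- A finite groupoid: a groupoid with finitely many isomorphism classes of objects, all of whose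
automorphism groups are finite. -/
structure IsFiniteGroupoid (G : Type u) [Category.{u} G] : Prop where
  isGroupoid : IsGroupoid G
  finite_isoClasses : Finite (Quotient (isIsomorphicSetoid G))
  finite_aut : ∀ x : G, Finite (Aut x)

/-- A profinite groupoid, i.e. an object of the pro-category of the `(2,1)`-category of finite
groupoids: a small cofiltered diagram (a pseudofunctor) of finite groupoids. As finite groupoids form
a full sub-2-category of `Cat`, and every natural transformation between functors of groupoids is
invertible, the diagram is given as a pseudofunctor to `Cat`. -/
structure ProfiniteGroupoid : Type (u + 1) where
  Idx : Type u
  [category : SmallCategory Idx]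
  [cofiltered : IsCofiltered Idx]
  diagram : LocallyDiscrete Idx ⥤ᵖ Cat.{u, u}
  finite : ∀ j : LocallyDiscrete Idx, IsFiniteGroupoid (diagram.obj j)

namespace ProfiniteGroupoid

attribute [instance] category cofiltered

variable (X : ProfiniteGroupoid.{u})

/-- The finite groupoid `X_j`. -/
abbrev cat (j : X.Idx) : Cat.{u, u} := X.diagram.obj ⟨j⟩

/-- The transition functor `X_i ⥤ X_j`. -/
def tr {i j : X.Idx} (a : i ⟶ j) : X.cat i ⥤ X.cat j := (X.diagram.map a.toLoc).toFunctor

/-- The unit constraint of the diagram. -/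
def trId (j : X.Idx) : X.tr (𝟙 j) ≅ 𝟭 (X.cat j) := Cat.Hom.toNatIso (X.diagram.mapId ⟨j⟩)

/-- The composition constraint of the diagram. -/
def trComp {i j k : X.Idx} (a : i ⟶ j) (b : j ⟶ k) : X.tr (a ≫ b) ≅ X.tr a ⋙ X.tr b :=
  Cat.Hom.toNatIso (X.diagram.mapComp a.toLoc b.toLoc)

attribute [local simp] PrelaxFunctor.map₂_eqToHom Strict.leftUnitor_eqToIso
  Strict.rightUnitor_eqToIso Strict.associator_eqToIso

lemma trComp_id_left {i j : X.Idx} (a : i ⟶ j) (x : X.cat i) :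
    (X.trComp (𝟙 i) a).hom.app x ≫ (X.tr a).map ((X.trId i).hom.app x) =
      eqToHom (by simp) := by
  have h := X.diagram.mapComp_id_left_hom_app a.toLoc x
  simp [Strict.leftUnitor_eqToIso] at h
  change (X.diagram.mapComp (𝟙 _) a.toLoc).hom.toNatTrans.app x ≫ (X.diagram.map a.toLoc).toFunctor.map ((X.diagram.mapId ⟨i⟩).hom.toNatTrans.app x) = _
  rw [h]
  simp [← Functor.map_comp]
  rfl

lemma trComp_id_right {i j : X.Idx} (a : i ⟶ j) (x : X.cat i) :
    (X.trComp a (𝟙 j)).hom.app x ≫ (X.trId j).hom.app ((X.tr a).obj x) =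
      eqToHom (by simp) := by
  have h := X.diagram.mapComp_id_right_hom_app a.toLoc x
  simp at h
  change (X.diagram.mapComp a.toLoc (𝟙 _)).hom.toNatTrans.app x ≫ (X.diagram.mapId ⟨j⟩).hom.toNatTrans.app ((X.diagram.map a.toLoc).toFunctor.obj x) = _
  rw [h]
  simp
  rfl

lemma trComp_assoc {i j k l : X.Idx} (a : i ⟶ j) (b : j ⟶ k) (c : k ⟶ l) (x : X.cat i) :
    (X.trComp a (b ≫ c)).hom.app x ≫ (X.trComp b c).hom.app ((X.tr a).obj x) =
      eqToHom (by simp) ≫ (X.trComp (a ≫ b) c).hom.app x ≫ (X.tr c).map ((X.trComp a b).hom.app x) := by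
  have h := X.diagram.mapComp_assoc_right_hom_app a.toLoc b.toLoc c.toLoc x
  simp at h
  change (X.diagram.mapComp a.toLoc (b.toLoc ≫ c.toLoc)).hom.toNatTrans.app x ≫ (X.diagram.mapComp b.toLoc c.toLoc).hom.toNatTrans.app _ = _
  rw [h]
  rfl

variable (E : Type u) [Category.{u} E]

/-- The Grothendieck construction of the (filtered) diagram `j ↦ (X_j ⥤ E)`: an object is a functor
`X_j ⥤ E` for some index `j`; a morphism `(j, F) ⟶ (k, G)` is a map `a : k ⟶ j` of indices with a
natural transformation from the restriction of `F` along `X_k ⥤ X_j` to `G`. -/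
structure El where
  idx : X.Idx
  fib : X.cat idx ⥤ E

namespace El
variable {X E}

/-- Morphisms of the Grothendieck construction. -/
structure Hom (p q : El X E) where
  base : q.idx ⟶ p.idx
  fiber : X.tr base ⋙ p.fib ⟶ q.fib

lemma Hom.ext' {p q : El X E} {f g : Hom p q} (h : f.base = g.base)
    (h' : ∀ x, p.fib.map (eqToHom (by rw [h])) ≫ f.fiber.app x = g.fiber.app x) : f = g := by
  obtain ⟨b, φ⟩ := f
  obtain ⟨c, ψ⟩ := g
  obtain rfl : b = c := h
  congr 1
  ext x
  simpa using h' x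

instance : CategoryStruct (El X E) where
  Hom := Hom
  id p := ⟨𝟙 _, Functor.whiskerRight (X.trId p.idx).hom p.fib⟩
  comp {p _ _} f g := ⟨g.base ≫ f.base,
    Functor.whiskerRight (X.trComp g.base f.base).hom p.fib ≫
      Functor.whiskerLeft (X.tr g.base) f.fiber ≫ g.fiber⟩

@[simp] lemma id_base (p : El X E) : Hom.base (𝟙 p) = 𝟙 _ := rfl
@[simp] lemma comp_base {p q r : El X E} (f : p ⟶ q) (g : q ⟶ r) :
  (f ≫ g).base = g.base ≫ f.base := rfl
@[simp] lemma id_fiber (p : El X E) (x) : (Hom.fiber (𝟙 p)).app x =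
  p.fib.map ((X.trId p.idx).hom.app x) := rfl
@[simp] lemma comp_fiber {p q r : El X E} (f : p ⟶ q) (g : q ⟶ r) (x) :
  (f ≫ g).fiber.app x = 
  p.fib.map ((X.trComp g.base f.base).hom.app x) ≫
    f.fiber.app ((X.tr g.base).obj x) ≫ g.fiber.app x := rfl

lemma fiber_nat {p q : El X E} (f : p ⟶ q) {x y : X.cat q.idx} (m : x ⟶ y) : 
   p.fib.map ((X.tr f.base).map m) ≫ f.fiber.app y = f.fiber.app x ≫ q.fib.map m := f.fiber.naturality m

instance : Category (El X E) where
  id_comp {p q} f := by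
    refine Hom.ext' (by simp) fun x => ?_
    simp only [comp_base, id_base, comp_fiber, id_fiber, ← Functor.map_comp_assoc]
    rw [trComp_id_right]
    simp
  comp_id {p q} f := by
    refine Hom.ext' (by simp) fun x => ?_
    simp only [comp_base, id_base, comp_fiber, id_fiber]
    rw [← fiber_nat, ← Functor.map_comp_assoc, ← Functor.map_comp_assoc, Category.assoc,
      trComp_id_left]
    simp
  assoc {p q r s} f g h := by
    refine Hom.ext' (by simp) fun x => ?_
    simp only [comp_base, comp_fiber, Category.assoc]
    rw [← reassoc_of% (fiber_nat f ((X.trComp h.base g.base).hom.app x))]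
    simp only [← Functor.map_comp_assoc]
    rw [trComp_assoc]
    simp

variable (X E) in
/-- The cocartesian morphisms: those whose fibre component is an isomorphism. -/
def cocart : MorphismProperty (El X E) := fun _ _ f => IsIso f.fiber

variable {E' : Type u} [Category.{u} E'] {E'' : Type u} [Category.{u} E'']

/-- Postcomposition with `F : E ⥤ E'`. -/
@[simps] def map (F : E ⥤ E') : El X E ⥤ El X E' where
  obj p := ⟨p.idx, p.fib ⋙ F⟩
  map f := ⟨f.base, Functor.whiskerRight f.fiber F⟩
  map_id p := Hom.ext' rfl fun x => by simp
  map_comp f g := Hom.ext' rfl fun x => by simp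

/-- The morphism in the fibre over `j` given by a natural transformation. -/
def vert {j : X.Idx} {F G : X.cat j ⥤ E} (α : F ⟶ G) : (⟨j, F⟩ : El X E) ⟶ ⟨j, G⟩ where
  base := 𝟙 j
  fiber := Functor.whiskerRight (X.trId j).hom F ≫ α

/-- The cocartesian morphism from `F` to its restriction along `X_j ⥤ X_i`. -/
def trans {i j : X.Idx} (a : j ⟶ i) (F : X.cat i ⥤ E) :
    (⟨i, F⟩ : El X E) ⟶ ⟨j, X.tr a ⋙ F⟩ where
  base := a
  fiber := 𝟙 _

lemma Hom.ext_fiber {i j : X.Idx} {F : X.cat i ⥤ E} {G : X.cat j ⥤ E} {b : j ⟶ i}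
    {φ ψ : X.tr b ⋙ F ⟶ G} (h : ∀ x, φ.app x = ψ.app x) :
    (⟨b, φ⟩ : Hom (⟨i, F⟩ : El X E) ⟨j, G⟩) = ⟨b, ψ⟩ :=
  congrArg _ (NatTrans.ext (funext h))

lemma Hom.ext_mk {i j : X.Idx} {F : X.cat i ⥤ E} {G : X.cat j ⥤ E} {b c : j ⟶ i} (hb : b = c)
    {φ : X.tr b ⋙ F ⟶ G} {ψ : X.tr c ⋙ F ⟶ G}
    (h : ∀ x, φ.app x = F.map (eqToHom (by rw [hb])) ≫ ψ.app x) :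
    (⟨b, φ⟩ : Hom (⟨i, F⟩ : El X E) ⟨j, G⟩) = ⟨c, ψ⟩ := by
  subst hb
  exact Hom.ext_fiber fun x => by simpa using h x

lemma vert_id {j : X.Idx} (F : X.cat j ⥤ E) : vert (𝟙 F) = 𝟙 (⟨j, F⟩ : El X E) :=
  Hom.ext_fiber fun x => by simp

lemma hom_vert {i j : X.Idx} (a : j ⟶ i) {F : X.cat i ⥤ E} {G H : X.cat j ⥤ E}
    (α : X.tr a ⋙ F ⟶ G) (β : G ⟶ H) :
    (show (⟨i, F⟩ : El X E) ⟶ ⟨j, G⟩ from ⟨a, α⟩) ≫ vert β =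
      (show (⟨i, F⟩ : El X E) ⟶ ⟨j, H⟩ from ⟨a, α ≫ β⟩) :=
  Hom.ext_mk (Category.id_comp a) fun x => by
    have h := congrArg F.map (X.trComp_id_left a x)
    have hn := α.naturality ((X.trId j).hom.app x)
    simp only [Functor.map_comp] at h
    dsimp only [Functor.comp_map] at hn
    change F.map ((X.trComp (𝟙 j) a).hom.app x) ≫ α.app ((X.tr (𝟙 j)).obj x) ≫
      G.map ((X.trId j).hom.app x) ≫ β.app x = F.map (eqToHom _) ≫ α.app x ≫ β.app x
    rw [← reassoc_of% hn, reassoc_of% h]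

lemma vert_hom {i j : X.Idx} (a : j ⟶ i) {F G : X.cat i ⥤ E} {H : X.cat j ⥤ E}
    (α : F ⟶ G) (β : X.tr a ⋙ G ⟶ H) :
    vert α ≫ (show (⟨i, G⟩ : El X E) ⟶ ⟨j, H⟩ from ⟨a, β⟩) =
      (show (⟨i, F⟩ : El X E) ⟶ ⟨j, H⟩ from ⟨a, Functor.whiskerLeft (X.tr a) α ≫ β⟩) :=
  Hom.ext_mk (Category.comp_id a) fun x => by
    have h := congrArg F.map (X.trComp_id_right a x)
    simp only [Functor.map_comp] at h
    change F.map ((X.trComp a (𝟙 i)).hom.app x) ≫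
      (F.map ((X.trId i).hom.app ((X.tr a).obj x)) ≫ α.app ((X.tr a).obj x)) ≫ β.app x =
        F.map (eqToHom _) ≫ α.app ((X.tr a).obj x) ≫ β.app x
    rw [Category.assoc, reassoc_of% h]

lemma trans_vert {i j : X.Idx} (a : j ⟶ i) {F : X.cat i ⥤ E} {G : X.cat j ⥤ E}
    (α : X.tr a ⋙ F ⟶ G) :
    trans a F ≫ vert α = (⟨a, α⟩ : Hom ⟨i, F⟩ ⟨j, G⟩) :=
  (hom_vert a (𝟙 _) α).trans (Hom.ext_fiber fun x => by simp)

lemma map_vert {j : X.Idx} {F G : X.cat j ⥤ E} (α : F ⟶ G) (H : E ⥤ E') :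
    (map H).map (vert α) = vert (Functor.whiskerRight α H) :=
  by
  have h : (Functor.whiskerRight (Functor.whiskerRight (X.trId j).hom F ≫ α) H :
      X.tr (𝟙 j) ⋙ F ⋙ H ⟶ G ⋙ H) =
        Functor.whiskerRight (X.trId j).hom (F ⋙ H) ≫ Functor.whiskerRight α H := by
    ext x
    simp
  exact congrArg (Hom.mk (p := ⟨j, F ⋙ H⟩) (q := ⟨j, G ⋙ H⟩) (𝟙 j)) h

lemma map_trans {i j : X.Idx} (a : j ⟶ i) (F : X.cat i ⥤ E) (H : E ⥤ E') :
    (map H).map (trans a F) = trans a (F ⋙ H) :=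
  congrArg (Hom.mk (p := ⟨i, F ⋙ H⟩) (q := ⟨j, X.tr a ⋙ F ⋙ H⟩) a)
    (NatTrans.ext (funext fun x => H.map_id (F.obj ((X.tr a).obj x))))

lemma vert_comp {j : X.Idx} {F G H : X.cat j ⥤ E} (α : F ⟶ G) (β : G ⟶ H) :
    vert (α ≫ β) = vert α ≫ vert β := by
  refine Eq.trans ?_ (hom_vert _ _ _).symm
  exact Hom.ext_fiber fun x => by simp

lemma trans_id {i : X.Idx} (F : X.cat i ⥤ E) :
    trans (𝟙 i) F ≫ vert (Functor.whiskerRight (X.trId i).hom F) = 𝟙 _ := by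
  rw [trans_vert]; rfl

lemma trans_comp {i j k : X.Idx} (a : i ⟶ j) (b : j ⟶ k) (F : X.cat k ⥤ E) :
    trans (a ≫ b) F ≫ vert (Functor.whiskerRight (X.trComp a b).hom F) =
      trans b F ≫ trans a (X.tr b ⋙ F) := by
  rw [trans_vert]
  exact Hom.ext_fiber fun x => by simp [trans]

end El

/-- The category `Fun(X, E) = colim_j Fun(X_j, E)`: the filtered 2-colimit in `Cat`, constructed as
the localization of the Grothendieck construction at the cocartesian morphisms. Its objects are functors
`X_j ⥤ E` for some index `j`. -/
structure Fun where
  idx : X.Idx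
  fib : X.cat idx ⥤ E

namespace Fun
variable {X E} {E' : Type u} [Category.{u} E'] {E'' : Type u} [Category.{u} E'']

/-- The object of the localization underlying an object of `Fun X E`. -/
def toLoc (p : Fun X E) : (El.cocart X E).Localization := (El.cocart X E).Q.obj ⟨p.idx, p.fib⟩

noncomputable instance : Category (Fun X E) where
  Hom p q := p.toLoc ⟶ q.toLoc
  id p := 𝟙 p.toLoc
  comp {p q r} f g := (show p.toLoc ⟶ q.toLoc from f) ≫ (show q.toLoc ⟶ r.toLoc from g)
  id_comp {p q} f := Category.id_comp (show p.toLoc ⟶ q.toLoc from f)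
  comp_id {p q} f := Category.comp_id (show p.toLoc ⟶ q.toLoc from f)
  assoc {p q r s} f g h := Category.assoc (show p.toLoc ⟶ q.toLoc from f) 
    (show q.toLoc ⟶ r.toLoc from g) (show r.toLoc ⟶ s.toLoc from h)

variable (X E) in
/-- The localization functor. -/
noncomputable def ι : El X E ⥤ Fun X E where
  obj p := ⟨p.idx, p.fib⟩
  map f := (El.cocart X E).Q.map f
  map_id p := (El.cocart X E).Q.map_id p
  map_comp f g := (El.cocart X E).Q.map_comp f g

lemma isIso_ι {p q : El X E} (f : p ⟶ q) (hf : IsIso f.fiber) : IsIso ((ι X E).map f) := by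
  let e := Localization.Construction.wIso (W := El.cocart X E) f hf
  exact ⟨e.inv, e.hom_inv_id, e.inv_hom_id⟩

instance {i j : X.Idx} (a : j ⟶ i) (F : X.cat i ⥤ E) : IsIso ((ι X E).map (El.trans a F)) :=
  isIso_ι _ (inferInstanceAs (IsIso (𝟙 (X.tr a ⋙ F))))

section
variable {D : Type*} [Category* D]

lemma hom_induction (P : ∀ {p q : Fun X E}, (p ⟶ q) → Prop)
    (h₁ : ∀ {p q : El X E} (f : p ⟶ q), P ((ι X E).map f))
    (h₂ : ∀ {p q : Fun X E} (e : p ≅ q), P e.hom → P e.inv)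
    (h₃ : ∀ {p q r : Fun X E} (f : p ⟶ q) (g : q ⟶ r), P f → P g → P (f ≫ g))
    {p q : Fun X E} (f : p ⟶ q) : P f := by
  let Q : MorphismProperty (El.cocart X E).Localization :=
    fun Z Z' m => P (p := (ι X E).obj Z.as.obj) (q := (ι X E).obj Z'.as.obj) m
  have : Q.IsStableUnderComposition := ⟨fun {Z Z' Z''} f g hf hg =>
    h₃ (p := (ι X E).obj Z.as.obj) (q := (ι X E).obj Z'.as.obj) (r := (ι X E).obj Z''.as.obj) f g hf hg⟩
  have hQ : Q = ⊤ := Localization.Construction.morphismProperty_eq_top' Q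
    (fun _ _ f => h₁ f) (fun Z Z' e he => 
      h₂ (p := (ι X E).obj Z.as.obj) (q := (ι X E).obj Z'.as.obj)
      ⟨e.hom, e.inv, e.hom_inv_id, e.inv_hom_id⟩ he)
  have : Q f := by rw [hQ]; trivial
  exact this

/-- The universal property of the 2-colimit: a functor inverting the cocartesian morphisms
descends to `Fun X E`. -/
noncomputable def lift (G : El X E ⥤ D)
    (hG : ∀ ⦃p q : El X E⦄ (f : p ⟶ q), IsIso f.fiber → IsIso (G.map f)) :
    Fun X E ⥤ D where
  obj p := G.obj ⟨p.idx, p.fib⟩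
  map f := (Localization.Construction.lift (W := El.cocart X E) G hG).map f
  map_id _ := (Localization.Construction.lift (W := El.cocart X E) G hG).map_id _
  map_comp f g := (Localization.Construction.lift (W := El.cocart X E) G hG).map_comp f g

lemma lift_map (G : El X E ⥤ D) (hG) {p q : El X E} (f : p ⟶ q) :
    (lift G hG).map ((ι X E).map f) = G.map f := by
  have := Functor.congr_hom (Localization.Construction.fac (W := El.cocart X E) G hG) f
  exact this.trans ((Category.id_comp _).trans (Category.comp_id _))

lemma naturality_of_ι {F G : Fun X E ⥤ D} (app : ∀ p : Fun X E, F.obj p ⟶ G.obj p)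
    (h : ∀ {p q : El X E} (f : p ⟶ q), F.map ((ι X E).map f) ≫ app ((ι X E).obj q) =
      app ((ι X E).obj p) ≫ G.map ((ι X E).map f))
    {p q : Fun X E} (f : p ⟶ q) : F.map f ≫ app q = app p ≫ G.map f := by
  refine hom_induction (P := fun {p q} f => F.map f ≫ app q = app p ≫ G.map f) h ?_ ?_ f
  · intro p q e he
    rw [← cancel_epi (F.map e.hom), reassoc_of% he, ← Functor.map_comp_assoc, ← Functor.map_comp]
    simp
  · intro p q r f g hf hg
    simp only [Functor.map_comp, Category.assoc, hg, reassoc_of% hf]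

end

/-- Postcomposition with `F : E ⥤ E'`. -/
noncomputable def map (F : E ⥤ E') : Fun X E ⥤ Fun X E' :=
  lift (El.map F ⋙ ι X E') fun _ _ f _ => isIso_ι _
    (inferInstanceAs (IsIso (Functor.whiskerRight f.fiber F)))

lemma map_ι (F : E ⥤ E') {p q : El X E} (f : p ⟶ q) :
    (map F).map ((ι X E).map f) = (ι X E').map ((El.map F).map f) := lift_map _ _ f

lemma map_map_id {p q : Fun X E} (m : p ⟶ q) : (map (𝟭 E)).map m = m := by
  have := naturality_of_ι (F := map (𝟭 E)) (G := 𝟭 _) (fun p => 𝟙 p) (fun {p q} f =>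
    (Category.comp_id _).trans ((map_ι _ f).trans (Category.id_comp _).symm)) m
  exact (Category.comp_id _).symm.trans (this.trans (Category.id_comp _))

lemma map_map_comp (F : E ⥤ E') (G : E' ⥤ E'') {p q : Fun X E} (m : p ⟶ q) :
    (map (F ⋙ G)).map m = (map G).map ((map F).map m) := by
  have := naturality_of_ι (F := map (F ⋙ G)) (G := map F ⋙ map G) (fun p => 𝟙 ((map (F ⋙ G)).obj p))
    (fun {p q} f => (Category.comp_id _).trans <| (map_ι _ f).trans <| Eq.trans (by
      rw [Functor.comp_map, map_ι]; exact (map_ι _ _).symm) (Category.id_comp _).symm) m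
  exact (Category.comp_id _).symm.trans (this.trans (Category.id_comp _))

/-- Postcomposition with a natural transformation. -/
noncomputable def map₂ {F G : E ⥤ E'} (α : F ⟶ G) : (map F : Fun X E ⥤ Fun X E') ⟶ map G where
  app p := (ι X E').map (El.vert (Functor.whiskerLeft p.fib α))
  naturality _ _ m := naturality_of_ι (F := map F) (G := map G)
    (fun p => (ι X E').map (El.vert (Functor.whiskerLeft p.fib α))) (fun {p q} f => by
    rw [map_ι, map_ι]
    refine ((ι X E').map_comp _ _).symm.trans (Eq.trans ?_ ((ι X E').map_comp _ _))
    congr 1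
    refine (El.hom_vert _ _ _).trans (Eq.trans ?_ (El.vert_hom _ _ _).symm)
    exact El.Hom.ext_fiber fun x => α.naturality (f.fiber.app x)) m

lemma map₂_id_app (F : E ⥤ E') (p : Fun X E) : (map₂ (𝟙 F)).app p = 𝟙 ((map F).obj p) :=
  (congrArg (ι X E').map ((congrArg El.vert (Functor.whiskerLeft_id' _)).trans
    (El.vert_id _))).trans ((ι X E').map_id _)

lemma map₂_comp_app {F G H : E ⥤ E'} (α : F ⟶ G) (β : G ⟶ H) (p : Fun X E) :
    (map₂ (α ≫ β)).app p = (map₂ α).app p ≫ (map₂ β).app p :=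
  (congrArg (ι X E').map ((congrArg El.vert (Functor.whiskerLeft_comp _ _ _)).trans
    (El.vert_comp _ _))).trans ((ι X E').map_comp _ _)

lemma map_map₂ {F G : E ⥤ E'} (α : F ⟶ G) (H : E' ⥤ E'') (p : Fun X E) :
    (map H).map ((map₂ α).app p) = (map₂ (Functor.whiskerRight α H)).app p :=
  (map_ι _ _).trans (congrArg (ι X E'').map (El.map_vert _ _))

instance {F G : E ⥤ E'} (α : F ⟶ G) [IsIso α] (p : Fun X E) : IsIso ((map₂ α).app p) :=
  ⟨(map₂ (inv α)).app p, by rw [← map₂_comp_app, IsIso.hom_inv_id, map₂_id_app],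
    by rw [← map₂_comp_app, IsIso.inv_hom_id, map₂_id_app]⟩

end Fun

/-- A morphism of profinite groupoids: an object of the 2-limit (pseudolimit)
`lim_j colim_i Fun(X_i, Y_j)`. -/
structure Hom (X Y : ProfiniteGroupoid.{u}) where
  obj (j : Y.Idx) : Fun X (Y.cat j)
  iso {i j : Y.Idx} (a : i ⟶ j) : (Fun.map (Y.tr a)).obj (obj i) ≅ obj j
  iso_id (j : Y.Idx) : (iso (𝟙 j)).hom = (Fun.map₂ (Y.trId j).hom).app (obj j)
  iso_comp {i j k : Y.Idx} (a : i ⟶ j) (b : j ⟶ k) :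
    (iso (a ≫ b)).hom = (Fun.map₂ (Y.trComp a b).hom).app (obj i) ≫
      (Fun.map (Y.tr b)).map (iso a).hom ≫ (iso b).hom

/-- A 2-morphism of profinite groupoids: a morphism in `lim_j colim_i Fun(X_i, Y_j)`. -/
@[ext]
structure Hom₂ {X Y : ProfiniteGroupoid.{u}} (f g : Hom X Y) where
  app (j : Y.Idx) : f.obj j ⟶ g.obj j
  naturality {i j : Y.Idx} (a : i ⟶ j) :
    (f.iso a).hom ≫ app j = (Fun.map (Y.tr a)).map (app i) ≫ (g.iso a).hom

variable {X E} {Y Z W : ProfiniteGroupoid.{u}} {E' : Type u} [Category.{u} E']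

@[simps]
noncomputable instance : Category (Hom X Y) where
  Hom f g := Hom₂ f g
  id f := ⟨fun _ => 𝟙 _, by simp⟩
  comp η θ := ⟨fun j => η.app j ≫ θ.app j, by
    intro i j a
    rw [reassoc_of% (η.naturality a), θ.naturality, Functor.map_comp_assoc]⟩

namespace Hom

lemma aux_inv {C : Type*} [Category* C] {A B M N : C} {e : A ≅ B} {t : A ⟶ M} {m : M ≅ N}
    {n : N ≅ B} (h : e.hom = t ≫ m.hom ≫ n.hom) : e.inv ≫ t = n.inv ≫ m.inv := by
  rw [Iso.inv_comp_eq, h]; simp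

lemma iso_comp_inv (f : Hom X Y) {i j k : Y.Idx} (a : i ⟶ j) (b : j ⟶ k) :
    (f.iso (a ≫ b)).inv ≫ (Fun.map₂ (Y.trComp a b).hom).app (f.obj i) =
      (f.iso b).inv ≫ (Fun.map (Y.tr b)).map (f.iso a).inv :=
  aux_inv (m := (Fun.map (Y.tr b)).mapIso (f.iso a)) (f.iso_comp a b)

lemma iso_id_inv (f : Hom X Y) (j : Y.Idx) :
    (f.iso (𝟙 j)).inv ≫ (Fun.map₂ (Y.trId j).hom).app (f.obj j) = 𝟙 _ :=
  (congrArg _ (f.iso_id j).symm).trans (f.iso (𝟙 j)).inv_hom_id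

lemma aux_map {C D : Type*} [Category* C] [Category* D] (F : C ⥤ D) {A B M : C} {u : A ⟶ B}
    {v : B ⟶ M} {z : A ⟶ M} {w : F.obj B ⟶ F.obj M} (hw : F.map v = w) (h : u ≫ v = z) :
    F.map u ≫ w = F.map z := by
  rw [← hw, ← h, F.map_comp]

lemma map_iso_id_inv (f : Hom X Y) {j : Y.Idx} (F : Y.cat j ⥤ E) :
    (Fun.map F).map (f.iso (𝟙 j)).inv ≫
      (Fun.map₂ (Functor.whiskerRight (Y.trId j).hom F)).app (f.obj j) =
      𝟙 ((Fun.map F).obj (f.obj j)) :=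
  (aux_map (Fun.map F) (Fun.map_map₂ (Y.trId j).hom F (f.obj j)) (f.iso_id_inv j)).trans
    ((Fun.map F).map_id (f.obj j))

lemma map_iso_comp_inv (f : Hom X Y) {i j k : Y.Idx} (a : i ⟶ j) (b : j ⟶ k) (F : Y.cat k ⥤ E) :
    (Fun.map F).map (f.iso (a ≫ b)).inv ≫
      (Fun.map₂ (Functor.whiskerRight (Y.trComp a b).hom F)).app (f.obj i) =
      (Fun.map F).map (f.iso b).inv ≫ (Fun.map (Y.tr b ⋙ F)).map (f.iso a).inv :=
  (aux_map (Fun.map F) (Fun.map_map₂ (Y.trComp a b).hom F (f.obj i)) (f.iso_comp_inv a b)).trans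
    (((Fun.map F).map_comp _ _).trans (congrArg (fun z => (Fun.map F).map (f.iso b).inv ≫ z)
      (Fun.map_map_comp (Y.tr b) F (f.iso a).inv).symm))

lemma aux_comp {C : Type*} [Category* C] {A B M N P Q : C} {e : A ⟶ B} {k : B ⟶ Q}
    {x : B ⟶ M} {y : M ⟶ N} {z : N ⟶ Q} {a : A ⟶ P} {v : P ⟶ M} {R : C} {y' : P ⟶ R}
    {w : R ⟶ N} (hk : k = x ≫ y ≫ z) (h₁ : e ≫ x = a ≫ v) (h₂ : v ≫ y = y' ≫ w) :
    e ≫ k = (a ≫ y') ≫ w ≫ z := by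
  simp only [hk, reassoc_of% h₁, reassoc_of% h₂, Category.assoc]

/-- The functor on representatives underlying `Hom.ev`. -/
noncomputable def evEl (f : Hom X Y) (E : Type u) [Category.{u} E] : El Y E ⥤ Fun X E where
  obj p := (Fun.map p.fib).obj (f.obj p.idx)
  map {p q} t := (Fun.map p.fib).map (f.iso t.base).inv ≫ (Fun.map₂ t.fiber).app (f.obj q.idx)
  map_id p := f.map_iso_id_inv p.fib
  map_comp {p q r} s t := by
    have h : (Fun.map₂ (s ≫ t).fiber).app (f.obj r.idx) =
        (Fun.map₂ (Functor.whiskerRight (Y.trComp t.base s.base).hom p.fib)).app (f.obj r.idx) ≫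
        (Fun.map₂ s.fiber).app ((Fun.map (Y.tr t.base)).obj (f.obj r.idx)) ≫
        (Fun.map₂ t.fiber).app (f.obj r.idx) := by
      refine (Fun.map₂_comp_app (Functor.whiskerRight (Y.trComp t.base s.base).hom p.fib) 
        (Functor.whiskerLeft (Y.tr t.base) s.fiber ≫ t.fiber) (f.obj r.idx)).trans 
        (congrArg (fun z => (Fun.map₂ (Functor.whiskerRight (Y.trComp t.base s.base).hom p.fib)).app
          (f.obj r.idx) ≫ z) (Fun.map₂_comp_app _ _ _))
    have h₁ := f.map_iso_comp_inv t.base s.base p.fib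
    have h₂ := (Fun.map₂ s.fiber).naturality (f.iso t.base).inv
    exact aux_comp h h₁ h₂

/-- Precomposition with a morphism `f : X ⟶ Y` of profinite groupoids, as a functor
`colim_j Fun(Y_j, E) ⥤ colim_i Fun(X_i, E)`: a functor `F : Y_j ⥤ E` is sent to the composite of the
`j`-th component of `f` with `F`. -/
noncomputable def ev (f : Hom X Y) (E : Type u) [Category.{u} E] : Fun Y E ⥤ Fun X E :=
  Fun.lift (f.evEl E) fun p q t ht => by
    have : IsIso t.fiber := ht
    have h₁ : IsIso ((Fun.map p.fib).map (f.iso t.base).inv) := inferInstance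
    have h₂ : IsIso ((Fun.map₂ t.fiber).app (f.obj q.idx)) := inferInstance
    exact IsIso.comp_isIso' h₁ h₂

lemma ev_ι (f : Hom X Y) {p q : El Y E} (t : p ⟶ q) :
    (f.ev E).map ((Fun.ι Y E).map t) =
      (Fun.map p.fib).map (f.iso t.base).inv ≫ (Fun.map₂ t.fiber).app (f.obj q.idx) :=
  Fun.lift_map (f.evEl E) _ t

lemma aux_sq {C : Type*} [Category* C] {A B : C} {f g : A ⟶ B} (h : f = g) :
    f ≫ 𝟙 B = 𝟙 A ≫ g := by simp [h]

lemma aux_sq' {C : Type*} [Category* C] {A B : C} {f g : A ⟶ B} (h : f ≫ 𝟙 B = 𝟙 A ≫ g) :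
    f = g := by simpa using h

lemma ev_map (f : Hom X Y) (F : E ⥤ E') {p q : Fun Y E} (m : p ⟶ q) :
    (f.ev E').map ((Fun.map F).map m) = (Fun.map F).map ((f.ev E).map m) := 
  aux_sq' <| Fun.naturality_of_ι (F := Fun.map F ⋙ f.ev E') (G := f.ev E ⋙ Fun.map F)
    (fun p => 𝟙 ((f.ev E').obj ((Fun.map F).obj p))) (fun {p q} t => aux_sq <| by
      have h₁ : (f.ev E').map ((Fun.map F).map ((Fun.ι Y E).map t)) =
        (Fun.map (p.fib ⋙ F)).map (f.iso t.base).inv ≫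
          (Fun.map₂ (Functor.whiskerRight t.fiber F)).app (f.obj q.idx) :=
        (congrArg (f.ev E').map (Fun.map_ι F t)).trans (f.ev_ι ((El.map F).map t))
      have h₂ : (Fun.map F).map ((f.ev E).map ((Fun.ι Y E).map t)) = 
        (Fun.map F).map ((Fun.map p.fib).map (f.iso t.base).inv) ≫
          (Fun.map F).map ((Fun.map₂ t.fiber).app (f.obj q.idx)) :=
        (congrArg (Fun.map F).map (f.ev_ι t)).trans ((Fun.map F).map_comp _ _)
      refine h₁.trans (Eq.trans ?_ h₂.symm)
      exact congrArg₂ (fun a b => a ≫ b) (Fun.map_map_comp p.fib F (f.iso t.base).inv) 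
        (Fun.map_map₂ t.fiber F (f.obj q.idx)).symm) m

lemma ev_ι_vert (f : Hom X Y) {j : Y.Idx} {F G : Y.cat j ⥤ E} (α : F ⟶ G) :
    (f.ev E).map ((Fun.ι Y E).map (El.vert α)) = (Fun.map₂ α).app (f.obj j) := by
  have h := Fun.map₂_comp_app (Functor.whiskerRight (Y.trId j).hom F) α (f.obj j)
  have h' := f.map_iso_id_inv F
  refine (f.ev_ι (El.vert α)).trans ?_
  exact (congrArg (fun z => (Fun.map F).map (f.iso (𝟙 j)).inv ≫ z) h).trans
    ((Category.assoc _ _ _).symm.trans 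
      ((congrArg (fun z => z ≫ (Fun.map₂ α).app (f.obj j)) h').trans (Category.id_comp _)))

lemma ev_ι_trans (f : Hom X Y) {i j : Y.Idx} (a : j ⟶ i) (F : Y.cat i ⥤ E) :
    (f.ev E).map ((Fun.ι Y E).map (El.trans a F)) = (Fun.map F).map (f.iso a).inv := by
  have h := Fun.map₂_id_app (Y.tr a ⋙ F) (f.obj j)
  exact (f.ev_ι (El.trans a F)).trans
    ((congrArg (fun z => (Fun.map F).map (f.iso a).inv ≫ z) h).trans (Category.comp_id _))

lemma ev_map₂ (f : Hom X Y) {F G : E ⥤ E'} (α : F ⟶ G) (p : Fun Y E) :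
    (f.ev E').map ((Fun.map₂ α).app p) = (Fun.map₂ α).app ((f.ev E).obj p) :=
  f.ev_ι_vert (Functor.whiskerLeft p.fib α)

lemma aux_map₃ {C D : Type*} [Category* C] [Category* D] (F : C ⥤ D) {A B M N : C} {u : A ⟶ N}
    {a : A ⟶ B} {b : B ⟶ M} {c : M ⟶ N} (h : u = a ≫ b ≫ c) {a' : F.obj A ⟶ F.obj B}
    {b' : F.obj B ⟶ F.obj M} (ha : F.map a = a') (hb : F.map b = b') :
    F.map u = a' ≫ b' ≫ F.map c := by
  rw [← ha, ← hb, h, F.map_comp, F.map_comp]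

/-- Composition of morphisms of profinite groupoids. -/
noncomputable def comp (f : Hom X Y) (g : Hom Y Z) : Hom X Z where
  obj k := (f.ev _).obj (g.obj k)
  iso {i j} a := (f.ev (Z.cat j)).mapIso (g.iso a)
  iso_id k := (congrArg (f.ev _).map (g.iso_id k)).trans (f.ev_map₂ _ _)
  iso_comp {i j k} a b := by
    exact aux_map₃ (f.ev _) (g.iso_comp a b) (f.ev_map₂ (Z.trComp a b).hom (g.obj i))
      (f.ev_map (Z.tr b) (g.iso a).hom)

lemma aux_hom {C : Type*} [Category* C] {A B : C} (e e' : A ≅ B) (h : e.inv = e'.inv) :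
    e.hom = e'.hom :=
  congrArg Iso.inv (Iso.ext h : e.symm = e'.symm)

lemma aux_symm {C : Type*} [Category* C] {A B : C} (e : A ≅ B) {v : B ⟶ A}
    (h : e.hom ≫ v = 𝟙 A) : e.symm.hom = v := by
  simp [← cancel_epi e.hom, h]

lemma aux_symm₂ {C : Type*} [Category* C] {A B M N : C} (e : A ≅ B) {v : B ⟶ N}
    (n : A ≅ M) (m : M ≅ N) (h : e.hom ≫ v = n.hom ≫ m.hom) :
    e.symm.hom = v ≫ m.symm.hom ≫ n.symm.hom := by
  simp [← cancel_epi e.hom, reassoc_of% h]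

variable (X) in
/-- The identity morphism of a profinite groupoid. -/
noncomputable def id : Hom X X where
  obj j := ⟨j, 𝟭 _⟩
  iso {i j} a :=
    (asIso ((Fun.ι X (X.cat j)).map (El.trans a (𝟭 (X.cat j))))).symm
  iso_id j :=
    have h := congrArg (Fun.ι X (X.cat j)).map (El.trans_id (𝟭 (X.cat j)))
    aux_symm (asIso ((Fun.ι X (X.cat j)).map (El.trans (𝟙 j) (𝟭 (X.cat j))))) (((Fun.ι X (X.cat j)).map_comp _ _).symm.trans (h.trans ((Fun.ι X (X.cat j)).map_id _)))
  iso_comp {i j k} a b :=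
    have h := congrArg (Fun.ι X (X.cat k)).map (El.trans_comp a b (𝟭 (X.cat k)))
    have h₁ := Fun.map_ι (X.tr b) (El.trans a (𝟭 (X.cat j)))
    have h₂ := El.map_trans a (𝟭 (X.cat j)) (X.tr b)
    aux_symm₂ (asIso ((Fun.ι X (X.cat k)).map (El.trans (a ≫ b) (𝟭 (X.cat k)))))
      (asIso ((Fun.ι X (X.cat k)).map (El.trans b (𝟭 (X.cat k)))))
      ((Fun.map (X.tr b)).mapIso (asIso ((Fun.ι X (X.cat j)).map (El.trans a (𝟭 (X.cat j)))))) (((Fun.ι X (X.cat k)).map_comp _ _).symm.trans (h.trans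
      (((Fun.ι X (X.cat k)).map_comp _ _).trans
        (congrArg (fun z => (Fun.ι X (X.cat k)).map (El.trans b (𝟭 (X.cat k))) ≫ z)
          (h₁.trans (congrArg (Fun.ι X (X.cat k)).map h₂)).symm))))

lemma id_iso_inv {i j : X.Idx} (a : i ⟶ j) :
    ((Hom.id X).iso a).inv = (Fun.ι X (X.cat j)).map (El.trans a (𝟭 (X.cat j))) := rfl

lemma ev_id {p q : Fun X E} (m : p ⟶ q) : ((Hom.id X).ev E).map m = m :=
  aux_sq' <| Fun.naturality_of_ι (F := (Hom.id X).ev E) (G := 𝟭 (Fun X E)) (fun p => 𝟙 p)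
    (fun {p q} t => aux_sq <| by
      have h₁ := Fun.map_ι p.fib (El.trans t.base (𝟭 (X.cat p.idx)))
      have h₂ := El.map_trans t.base (𝟭 (X.cat p.idx)) p.fib
      have h₃ := (Fun.ι X E).map_comp (El.trans t.base p.fib) (El.vert t.fiber)
      refine ((Hom.id X).ev_ι t).trans ?_
      refine (congrArg (fun z => z ≫ (Fun.ι X E).map (El.vert t.fiber))
        (h₁.trans (congrArg (Fun.ι X E).map h₂))).trans ?_
      exact h₃.symm.trans (congrArg (Fun.ι X E).map (El.trans_vert t.base t.fiber))) m

lemma ev_id_iso (f : Hom X Y) {i j : Y.Idx} (a : i ⟶ j) :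
    (f.ev _).map ((Hom.id Y).iso a).hom = (f.iso a).hom :=
  aux_hom ((f.ev _).mapIso ((Hom.id Y).iso a)) (f.iso a)
    ((f.ev_ι_trans a (𝟭 (Y.cat j))).trans (Fun.map_map_id (f.iso a).inv))

lemma comp_ev (f : Hom X Y) (g : Hom Y Z) {p q : Fun Z E} (m : p ⟶ q) :
    ((f.comp g).ev E).map m = (f.ev E).map ((g.ev E).map m) :=
  aux_sq' <| Fun.naturality_of_ι (F := (f.comp g).ev E) (G := g.ev E ⋙ f.ev E)
    (fun p => 𝟙 (((f.comp g).ev E).obj p))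
    (fun {p q} t => aux_sq <| by
      have h := ((f.ev E).congr_map (g.ev_ι t)).trans ((f.ev E).map_comp _ _)
      refine ((f.comp g).ev_ι t).trans (Eq.trans ?_ h.symm)
      exact congrArg₂ (fun a b => a ≫ b) (f.ev_map p.fib (g.iso t.base).inv).symm
        (f.ev_map₂ t.fiber (g.obj q.idx)).symm) m

lemma aux_conj {C : Type*} [Category* C] {A B A' B' : C} {e : A ≅ B} {e' : A' ≅ B'} {x : B ⟶ B'}
    {y : A ⟶ A'} (h : e.hom ≫ x = y ≫ e'.hom) : e.inv ≫ y = x ≫ e'.inv := by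
  rw [Iso.inv_comp_eq, reassoc_of% h]; simp

lemma aux_nat {C D : Type*} [Category* C] [Category* D] (F : C ⥤ D) {A B A' B' : C} {i : A ⟶ B}
    {i' : A' ⟶ B'} {x : A ⟶ A'} {y : B ⟶ B'} (h : i ≫ y = x ≫ i') {N N' : D} {φ : F.obj B ⟶ N}
    {φ' : F.obj B' ⟶ N'} {y' : F.obj B ⟶ F.obj B'} (hy : y' = F.map y) {z : N ⟶ N'}
    (hn : y' ≫ φ' = φ ≫ z) {m : F.obj A ⟶ N} {m' : F.obj A' ⟶ N'} (hm : m = F.map i ≫ φ)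
    (hm' : m' = F.map i' ≫ φ') : m ≫ z = F.map x ≫ m' := by
  rw [hm, hm', Category.assoc, ← hn, hy, ← F.map_comp_assoc, h, F.map_comp_assoc]

end Hom

namespace Hom₂

/-- The natural transformation between precomposition functors given by a 2-morphism. -/
noncomputable def ev {f g : Hom X Y} (θ : Hom₂ f g) (E : Type u) [Category.{u} E] :
    f.ev E ⟶ g.ev E where
  app p := (Fun.map p.fib).map (θ.app p.idx)
  naturality _ _ m := Fun.naturality_of_ι (F := f.ev E) (G := g.ev E)
    (fun p => (Fun.map p.fib).map (θ.app p.idx)) (fun {p q} t => by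
      have h₁ := f.ev_ι t
      have h₂ := g.ev_ι t
      have h₃ := (Fun.map₂ t.fiber).naturality (θ.app q.idx)
      have h₄ := Fun.map_map_comp (Y.tr t.base) p.fib (θ.app q.idx)
      have h₅ := θ.naturality t.base
      exact Hom.aux_nat (Fun.map p.fib) (Hom.aux_conj h₅) h₄ h₃ h₁ h₂) m

lemma ev_id (f : Hom X Y) (p : Fun Y E) : (ev (𝟙 f) E).app p = 𝟙 ((f.ev E).obj p) :=
  (Fun.map p.fib).map_id _

lemma ev_comp {f g h : Hom X Y} (θ : f ⟶ g) (η : g ⟶ h) (p : Fun Y E) :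
    (ev (θ ≫ η) E).app p = (ev θ E).app p ≫ (ev η E).app p :=
  (Fun.map p.fib).map_comp _ _

end Hom₂

@[ext] lemma hom₂_ext {f g : Hom X Y} {θ η : f ⟶ g} (h : ∀ j, θ.app j = η.app j) : θ = η :=
  Hom₂.ext (funext h)

/-- Isomorphisms of morphisms of profinite groupoids, componentwise. -/
def isoMk {f g : Hom X Y} (e : ∀ j, f.obj j ≅ g.obj j) (h : ∀ {i j : Y.Idx} (a : i ⟶ j),
    (f.iso a).hom ≫ (e j).hom = (Fun.map (Y.tr a)).map (e i).hom ≫ (g.iso a).hom) : f ≅ g where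
  hom := ⟨fun j => (e j).hom, h⟩
  inv := ⟨fun j => (e j).inv, fun {i j} a => by
    rw [Iso.comp_inv_eq, Category.assoc, h, ← Functor.map_comp_assoc]; simp⟩
  hom_inv_id := by ext; simp
  inv_hom_id := by ext; simp

lemma aux_pentagon {C : Type*} [Category* C] (A : C) {u v : A ⟶ A} (hu : u = 𝟙 A) (hv : v = 𝟙 A) :
    u ≫ 𝟙 A ≫ v = 𝟙 A ≫ 𝟙 A := by simp [hu, hv]

lemma aux_triangle {C : Type*} [Category* C] (A : C) {u v : A ⟶ A} (hu : u = 𝟙 A) (hv : v = 𝟙 A) :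
    𝟙 A ≫ u = v := by simp [hu, hv]

lemma refl_nat {C D : Type*} [Category* C] [Category* D] (F : C ⥤ D) {A : C} {B : D}
    {u v : F.obj A ⟶ B} (h : u = v) :
    u ≫ (Iso.refl B).hom = F.map (Iso.refl A).hom ≫ v := by simp [h]

/-- The 2-category of profinite groupoids, `Pro` of the 2-category of finite groupoids. -/
noncomputable instance : Bicategory ProfiniteGroupoid.{u} where
  Hom X Y := Hom X Y
  id X := Hom.id X
  comp f g := Hom.comp f g
  homCategory X Y := inferInstance
  whiskerLeft {X Y Z} f g h η := (⟨fun k => (f.ev _).map (η.app k), fun {i _} a => by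
    have h₁ := (f.ev _).congr_map (η.naturality a)
    have h₂ := f.ev_map (Z.tr a) (η.app i)
    exact ((f.ev _).map_comp _ _).symm.trans (h₁.trans (((f.ev _).map_comp _ _).trans
      (congrArg (fun z => z ≫ (f.ev _).map (h.iso a).hom) h₂)))⟩ : Hom₂ (f.comp g) (f.comp h))
  whiskerRight {X Y Z f g} η h := (⟨fun k => (Hom₂.ev η _).app (h.obj k), fun {i j} a => by
    have h₁ := (Hom₂.ev η _).naturality (h.iso a).hom
    have h₂ := Fun.map_map_comp (h.obj i).fib (Z.tr a) (η.app (h.obj i).idx)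
    exact h₁.trans (congrArg (fun z => z ≫ (g.ev _).map (h.iso a).hom) h₂)⟩ : 
      Hom₂ (f.comp h) (g.comp h))
  associator {W X Y Z} f g h := isoMk (f := (f.comp g).comp h) (g := f.comp (g.comp h))
    (fun k => Iso.refl (((f.comp g).ev _).obj (h.obj k)))
    (fun {i j} a => refl_nat (Fun.map (Z.tr a)) (f.comp_ev g (h.iso a).hom))
  leftUnitor {X Y} f := isoMk (f := (Hom.id X).comp f) (g := f) (fun k => Iso.refl (f.obj k))
    (fun {i j} a => refl_nat (Fun.map (Y.tr a)) (Hom.ev_id (f.iso a).hom))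
  rightUnitor {X Y} f := isoMk (f := f.comp (Hom.id Y)) (g := f) (fun k => Iso.refl (f.obj k)) 
    (fun {i j} a => refl_nat (Fun.map (Y.tr a)) (f.ev_id_iso a))
  whiskerLeft_id f g := by 
    ext k
    exact (f.ev _).map_id _
  whiskerLeft_comp f _ _ _ η θ := by 
    ext k
    exact (f.ev _).map_comp _ _
  id_whiskerLeft {X Y f g} η := by 
    ext k
    refine (Hom.ev_id (η.app k)).trans ?_
    exact ((Category.id_comp _).trans (Category.comp_id _)).symm
  comp_whiskerLeft {W X Y Z} f g h h' η := by 
    ext k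
    refine (f.comp_ev g (η.app k)).trans ?_
    exact ((Category.id_comp _).trans (Category.comp_id _)).symm
  id_whiskerRight f g := by
    ext k
    exact Hom₂.ev_id f (g.obj k)
  comp_whiskerRight {X Y Z f g h} η θ i := by
    ext k
    exact Hom₂.ev_comp η θ (i.obj k)
  whiskerRight_id {X Y f g} η := by
    ext k
    refine (Fun.map_map_id (η.app k)).trans ?_
    exact ((Category.id_comp _).trans (Category.comp_id _)).symm
  whiskerRight_comp {W X Y Z f f'} η g h := by
    ext k
    refine (Fun.map_map_comp _ _ _).trans ?_
    exact ((Category.id_comp _).trans (Category.comp_id _)).symm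
  whisker_assoc {W X Y Z} f g g' η h := by
    ext k
    refine (f.ev_map (h.obj k).fib (η.app (h.obj k).idx)).symm.trans ?_
    exact ((Category.id_comp _).trans (Category.comp_id _)).symm
  whisker_exchange {X Y Z f g h i} η θ := by
    ext k
    exact (Hom₂.ev η _).naturality (θ.app k)
  pentagon f g h i := by
    ext k
    exact aux_pentagon _ ((Fun.map (i.obj k).fib).map_id _) ((f.ev _).map_id _)
  triangle f g := by
    ext k
    exact aux_triangle _ ((f.ev _).map_id _) ((Fun.map (g.obj k).fib).map_id _)

lemma Fun.isIso_of_isGroupoid (hE : IsGroupoid E) {p q : Fun X E} (m : p ⟶ q) : IsIso m := by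
  refine Fun.hom_induction (P := fun {_ _} m => IsIso m) ?_ ?_ ?_ m
  · intro p q t
    have : ∀ x, IsIso (t.fiber.app x) := fun x => hE.all_isIso _
    exact Fun.isIso_ι t (NatIso.isIso_of_isIso_app t.fiber)
  · intro p q e _
    infer_instance
  · intro p q r f g hf hg
    exact IsIso.comp_isIso' hf hg

/-- The 2-category of profinite groupoids is a `(2,1)`-category. -/
instance : IsLocallyGroupoid ProfiniteGroupoid.{u} := fun _ Y => ⟨fun {f g} η => by
  have : ∀ j, IsIso (η.app j) := fun j =>
    Fun.isIso_of_isGroupoid (Y.finite ⟨j⟩).isGroupoid (η.app j)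
  exact (isoMk (f := f) (g := g) (fun j => asIso (η.app j)) fun a => η.naturality a).isIso_hom⟩

end ProfiniteGroupoid

/-- A morphism `f : y ⟶ x` along which pullbacks exist is an effective descent morphism if the
adjunction between `Over y` and `Over x` given by composition with `f` and pullback along `f` is monadic. -/
def IsEffectiveDescent {C : Type u} [Category.{u} C] {y x : C} (f : y ⟶ x) : Prop :=
  ∃ _ : HasPullbacksAlong f, (Monad.comparison (Over.mapPullbackAdj f)).IsEquivalence

/-- A Galois category: a category with finite limits and finite coproducts, a strict (that is, empty)
initial object, disjoint and distributive coproducts, in which every object `x` becomes, on each piece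
`x'_i` of some effective descent morphism `∐ x'_i ⟶ *`, a finite coproduct of copies of `*`. -/
class IsGaloisCategory (C : Type u) [Category.{u} C] : Prop where
  [hasFiniteLimits : HasFiniteLimits C]
  [hasFiniteCoproducts : HasFiniteCoproducts C]
  [hasStrictInitialObjects : HasStrictInitialObjects C]
  disjoint (x y : C) : IsPullback (initial.to x) (initial.to y)
    (coprod.inl : x ⟶ x ⨿ y) (coprod.inr : y ⟶ x ⨿ y)
  distributive {y x : C} (f : y ⟶ x) : PreservesFiniteCoproducts (Over.pullback f)
  locally_split (x : C) : ∃ (n : ℕ) (x' : Fin n → C) (s : Fin n → ℕ),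
    IsEffectiveDescent (terminal.from (∐ x')) ∧
      ∀ i, ∃ e : x ⨯ x' i ≅ ∐ fun _ : Fin (s i) => x' i,
        e.hom ≫ Sigma.desc (fun _ => 𝟙 (x' i)) = prod.snd

/-- A functor of Galois categories: it preserves finite limits, finite coproducts and effective descent
morphisms. -/
structure IsGaloisFunctor {C D : Type u} [Category.{u} C] [Category.{u} D] (F : C ⥤ D) : Prop where
  preservesFiniteLimits : PreservesFiniteLimits F
  preservesFiniteCoproducts : PreservesFiniteCoproducts F
  map_isEffectiveDescent {x y : C} (f : x ⟶ y) : IsEffectiveDescent f → IsEffectiveDescent (F.map f)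

/-- Galois categories (small ones). -/
structure GalCat : Type (u + 1) where
  carrier : Type u
  [category : SmallCategory carrier]
  isGalois : IsGaloisCategory carrier

namespace GalCat

attribute [instance] category

/-- Functors of Galois categories. -/
structure Hom (C D : GalCat.{u}) where
  functor : C.carrier ⥤ D.carrier
  isGalois : IsGaloisFunctor functor

/-- The 2-morphisms are the natural isomorphisms. -/
@[simps]
instance (C D : GalCat.{u}) : Category (Hom C D) where
  Hom F G := F.functor ≅ G.functor
  id F := Iso.refl F.functor
  comp η θ := η ≪≫ θ

/-- A natural isomorphism, as an invertible 2-morphism. -/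
def isoMk {C D : GalCat.{u}} {F G : Hom C D} (e : F.functor ≅ G.functor) : F ≅ G where
  hom := e
  inv := e.symm
  hom_inv_id := Iso.self_symm_id e
  inv_hom_id := Iso.symm_self_id e

/-- The `(2,1)`-category of Galois categories. -/
instance : Bicategory GalCat.{u} where
  Hom C D := Hom C D
  id C := ⟨𝟭 C.carrier, inferInstance, inferInstance, fun _ h => h⟩
  comp F G := ⟨F.functor ⋙ G.functor,
    have := F.isGalois.preservesFiniteLimits
    have := G.isGalois.preservesFiniteLimits
    comp_preservesFiniteLimits _ _,
    have := F.isGalois.preservesFiniteCoproducts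
    have := G.isGalois.preservesFiniteCoproducts
    ⟨fun n => inferInstance⟩,
    fun f h => G.isGalois.map_isEffectiveDescent _ (F.isGalois.map_isEffectiveDescent f h)⟩
  homCategory C D := inferInstance
  whiskerLeft F _ _ η := Functor.isoWhiskerLeft F.functor η
  whiskerRight η H := Functor.isoWhiskerRight η H.functor
  associator F G H := isoMk (Functor.associator F.functor G.functor H.functor)
  leftUnitor F := isoMk F.functor.leftUnitor
  rightUnitor F := isoMk F.functor.rightUnitor
  whiskerLeft_id F G := Iso.ext (NatTrans.ext (funext fun x => by rfl))
  whiskerLeft_comp F _ _ _ η θ := Iso.ext (NatTrans.ext (funext fun x => by rfl))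
  id_whiskerLeft η := Iso.ext (NatTrans.ext (funext fun x =>
    ((Category.id_comp _).trans (Category.comp_id _)).symm))
  comp_whiskerLeft F G _ _ η := Iso.ext (NatTrans.ext (funext fun x =>
    ((Category.id_comp _).trans (Category.comp_id _)).symm))
  id_whiskerRight F G := Iso.ext (NatTrans.ext (funext fun x => G.functor.map_id _))
  comp_whiskerRight η θ G := Iso.ext (NatTrans.ext (funext fun x => G.functor.map_comp _ _))
  whiskerRight_id η := Iso.ext (NatTrans.ext (funext fun x =>
    ((Category.id_comp _).trans (Category.comp_id _)).symm))
  whiskerRight_comp η G H := Iso.ext (NatTrans.ext (funext fun x =>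
    ((Category.id_comp _).trans (Category.comp_id _)).symm))
  whisker_assoc F _ _ η H := Iso.ext (NatTrans.ext (funext fun x =>
    ((Category.id_comp _).trans (Category.comp_id _)).symm))
  whisker_exchange η θ := Iso.ext (NatTrans.ext (funext fun x => (Iso.hom θ).naturality _ |>.symm))
  pentagon F G H I := Iso.ext (NatTrans.ext (funext fun x =>
    ProfiniteGroupoid.aux_pentagon _ (I.functor.map_id _) rfl))
  triangle F G := Iso.ext (NatTrans.ext (funext fun x =>
    ProfiniteGroupoid.aux_triangle _ rfl (G.functor.map_id _)))

end GalCat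

namespace ProfiniteGroupoid

/-- The assignment `X ↦ Fun(X, FinSet)` takes values in Galois categories, and precomposition with a
morphism of profinite groupoids is a functor of Galois categories. Here the category of finite sets is
represented by its small skeleton. -/
structure SendsToGalois : Prop where
  obj (X : ProfiniteGroupoid.{u}) : IsGaloisCategory (Fun X FintypeCat.Skeleton.{u})
  map {X Y : ProfiniteGroupoid.{u}} (f : X ⟶ Y) :
    IsGaloisFunctor (Hom.ev f FintypeCat.Skeleton.{u})

instance {X Y : ProfiniteGroupoid.{u}} {f g : X ⟶ Y} (θ : f ⟶ g) : IsIso θ :=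
  have : IsGroupoid (X ⟶ Y) := (inferInstance : IsLocallyGroupoid ProfiniteGroupoid.{u}) X Y
  IsGroupoid.all_isIso θ

lemma ev_hom_inv {X Y : ProfiniteGroupoid.{u}} {f g : X ⟶ Y} {θ : f ⟶ g} {η : g ⟶ f}
    (h : θ ≫ η = 𝟙 f) (E : Type u) [Category.{u} E] :
    Hom₂.ev θ E ≫ Hom₂.ev η E = 𝟙 (Hom.ev f E) :=
  NatTrans.ext (funext fun p => (Hom₂.ev_comp θ η p).symm.trans
    ((congrArg (fun z => (Hom₂.ev z E).app p) h).trans (Hom₂.ev_id f p)))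

/-- The natural isomorphism of precomposition functors given by a 2-morphism. -/
noncomputable def evIso {X Y : ProfiniteGroupoid.{u}} {f g : X ⟶ Y} (θ : f ⟶ g)
    (E : Type u) [Category.{u} E] : Hom.ev f E ≅ Hom.ev g E where
  hom := Hom₂.ev θ E
  inv := Hom₂.ev (inv θ) E
  hom_inv_id := ev_hom_inv (IsIso.hom_inv_id θ) E
  inv_hom_id := ev_hom_inv (IsIso.inv_hom_id θ) E

/-- The Galois category `Fun(X, FinSet)`. -/
noncomputable def galCat (h : SendsToGalois.{u}) (X : ProfiniteGroupoid.{u}) : GalCat.{u} :=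
  ⟨Fun X FintypeCat.Skeleton.{u}, h.obj X⟩

/-- Precomposition with a morphism of profinite groupoids, as a functor of Galois categories. -/
noncomputable def galHom (h : SendsToGalois.{u}) {X Y : ProfiniteGroupoid.{u}} (f : X ⟶ Y) :
    GalCat.Hom (galCat h Y) (galCat h X) :=
  ⟨Hom.ev f FintypeCat.Skeleton.{u}, h.map f⟩

lemma aux_assoc {C : Type*} [Category* C] (A : C) {u v : A ⟶ A} (hu : u = 𝟙 A) (hv : v = 𝟙 A) :
    u = 𝟙 A ≫ v ≫ 𝟙 A ≫ 𝟙 A ≫ 𝟙 A := by simp [hu, hv]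

lemma aux_unit {C : Type*} [Category* C] (A : C) {u v : A ⟶ A} (hu : u = 𝟙 A) (hv : v = 𝟙 A) :
    u = 𝟙 A ≫ v ≫ 𝟙 A := by simp [hu, hv]

/-- The (pseudo)functor `X ↦ Fun(X, FinSet)` from the opposite of the 2-category of profinite groupoids
to the 2-category of Galois categories. -/
noncomputable def toGalCat (h : SendsToGalois.{u}) : ProfiniteGroupoid.{u}ᵒᵖ ⥤ᵖ GalCat.{u} where
  obj X := galCat h X.unop
  map f := galHom h f.unop
  map₂ θ := evIso θ.unop2 FintypeCat.Skeleton.{u}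
  map₂_id f := Iso.ext (NatTrans.ext (funext fun p => Hom₂.ev_id f.unop p))
  map₂_comp η θ := Iso.ext (NatTrans.ext (funext fun p => Hom₂.ev_comp η.unop2 θ.unop2 p))
  mapId X := GalCat.isoMk (NatIso.ofComponents (fun p => Iso.refl p)
    fun m => Hom.aux_sq (Hom.ev_id m))
  mapComp f g := GalCat.isoMk (NatIso.ofComponents
    (fun p => Iso.refl ((Hom.ev g.unop FintypeCat.Skeleton.{u}).obj
      ((Hom.ev f.unop FintypeCat.Skeleton.{u}).obj p)))
    fun m => Hom.aux_sq (Hom.comp_ev g.unop f.unop m))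
  map₂_whisker_left f _ _ η := Iso.ext (NatTrans.ext (funext fun p => by
    refine (Fun.map_map_comp (f.unop.obj p.idx).fib p.fib
      (η.unop2.app (f.unop.obj p.idx).idx)).symm.trans ?_
    exact ((Category.id_comp _).trans (Category.comp_id _)).symm))
  map₂_whisker_right η h := Iso.ext (NatTrans.ext (funext fun p => by
    refine (h.unop.ev_map p.fib (η.unop2.app p.idx)).symm.trans ?_
    exact ((Category.id_comp _).trans (Category.comp_id _)).symm))
  map₂_associator _ _ h := Iso.ext (NatTrans.ext (funext fun p =>
    aux_assoc _ ((Fun.map p.fib).map_id _) ((Hom.ev h.unop _).map_id _)))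
  map₂_left_unitor f := Iso.ext (NatTrans.ext (funext fun p =>
    aux_unit _ ((Fun.map p.fib).map_id _) ((Hom.ev f.unop _).map_id _)))
  map₂_right_unitor _ := Iso.ext (NatTrans.ext (funext fun p =>
    aux_unit _ ((Fun.map p.fib).map_id _) rfl))

end ProfiniteGroupoid

/-- A pseudofunctor is an equivalence of 2-categories if it is an equivalence on every category of
morphisms and every object of the target is (internally) equivalent to one in its image. -/
def CategoryTheory.Pseudofunctor.IsBiequivalence {B C : Type*} [Bicategory B] [Bicategory C]
    (F : B ⥤ᵖ C) : Prop :=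
  (∀ a b : B, (F.mapFunctor a b).IsEquivalence) ∧ ∀ c : C, ∃ b : B, Nonempty (F.obj b ≌ c)

/-! No fiber functor is given, so points have to be produced first. Finitely many objects and arrows
of a Galois category become constant over the pieces of a finite cover of the terminal object
(`exists_splitting_cover`). Over a non-initial object, a finite subgraph is thus realized by finite
sets and functions whose cardinalities are bounded independently of the subgraph; an ultrafilter on
the finite subgraphs glues these realizations into a functor to finite sets (`exists_isFiber`).
Testing on the pieces of a cover, the fiber functors are jointly conservative and faithful
(`isIso_of_isFiber`, `hom_ext_of_isFiber`).

A parallel pair that is constant on a cover has a coequalizer computed on index sets, which every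
functor preserving finite coproducts preserves. Monadic descent therefore creates coequalizers in a
Galois category, and fiber functors compute them (`exists_coequalizer`). Consequently coequalizers
are universal, and by Beck's theorem effective descent morphisms are the regular epimorphisms, that
is, the morphisms which are surjective on every fiber (`isEffectiveDescent_iff_isRegularEpi`).

The filtered 2-colimit `Fun X E` admits a calculus of fractions, so finite diagrams, their limits
and colimits, and universality of colimits all come from some `X.cat k ⥤ E`. Representable functors
on a finite groupoid split every functor to finite sets. This makes `Fun X FintypeCat.Skeleton` a
Galois category and precomposition a Galois functor (`sendsToGalois`).

For a finite groupoid `H`, every functor from `H` to finite sets is a quotient of a finite coproduct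
of representables at finitely many representatives. So a transformation between exact functors is
determined by finitely many components, which gives `preFunctor_faithful` and `preFunctor_full`. An
exact functor to `Fun X FintypeCat.Skeleton` restricts to a finite diagram of torsors, already
defined and simply transitive at some level, where a functor `X.cat k ⥤ H` represents it
(`exists_pre_iso`). Applied to all `H = Y.cat j`, with the coherence conditions checked through
faithfulness, this is the equivalence on categories of morphisms (`isEquivalence_mapFunctor`).

To recover a Galois category `C`, attach to a finite subgraph `K` the groupoid of all fiber functors
and of isomorphisms between their restrictions to `K`; a splitting of `K` shows that it is finite.
Morphisms of `Fun (fundamentalGroupoid C) E` are the families of maps of stalks that are natural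
over some finite subgraph. An invariant family of subsets of the fibers is the image of a morphism
(`exists_range_eq`): applied to graphs, this makes `evalFunctor` full; applied to the kernel
relation of a covering of a given functor, it makes `evalFunctor` essentially surjective. -/

/-! ### Extensivity of Galois categories. -/

section Extensive

variable {C : Type u} [Category.{u} C]

/-- In `Over x` the terminal object `𝟙 x` is the coproduct of `s` and `t`, because the forgetful
functor reflects colimits. Distributivity transports this to `Over z`, where pulling back `𝟙 x`
gives `z` itself. -/
lemma isColimit_binaryCofan_of_pullback [HasPullbacks C] [HasFiniteCoproducts C] {x z : C}
    (f : z ⟶ x) [PreservesFiniteCoproducts (Over.pullback f)] {a b : C} {s : a ⟶ x} {t : b ⟶ x}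
    (hc : IsColimit (BinaryCofan.mk s t)) {p q : C} {p₁ : p ⟶ z} {p₂ : p ⟶ a} {q₁ : q ⟶ z}
    {q₂ : q ⟶ b} (hp : IsPullback p₁ p₂ f s) (hq : IsPullback q₁ q₂ f t) :
    Nonempty (IsColimit (BinaryCofan.mk p₁ q₁)) := by
  let i : Over.mk s ⟶ Over.mk (𝟙 x) := Over.homMk s (Category.comp_id s)
  let j : Over.mk t ⟶ Over.mk (𝟙 x) := Over.homMk t (Category.comp_id t)
  have h : IsColimit (BinaryCofan.mk i j) :=
    isColimitOfReflects (Over.forget _)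
      ((isColimitMapCoconeBinaryCofanEquiv (Over.forget x) i j).symm hc)
  have h' := mapIsColimitOfPreservesOfIsColimit (Over.pullback f ⋙ Over.forget z) _ _ h
  let ep := hp.isoIsPullback _ _ (IsPullback.of_hasPullback s f).flip
  let eq := hq.isoIsPullback _ _ (IsPullback.of_hasPullback t f).flip
  let ez : pullback (𝟙 x) f ≅ z := asIso (pullback.snd (𝟙 x) f)
  refine ⟨(IsColimit.equivOfNatIsoOfIso (mapPairIso ep eq).symm _ _ ?_) h'⟩
  refine Cocone.ext ez ?_
  rintro ⟨⟨⟩⟩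
  · exact (Category.assoc _ _ _).trans ((congrArg (ep.hom ≫ ·) (pullback.lift_snd _ _ _)).trans
      (IsPullback.isoIsPullback_hom_fst _ _ hp _))
  · exact (Category.assoc _ _ _).trans ((congrArg (eq.hom ≫ ·) (pullback.lift_snd _ _ _)).trans
      (IsPullback.isoIsPullback_hom_fst _ _ hq _))

/-- With `p₁` a monomorphism a lift is determined by its first component, so only existence has to
be checked. -/
lemma isPullback_of_mono {p a b x : C} {p₁ : p ⟶ a} {p₂ : p ⟶ b} {f : a ⟶ x} {g : b ⟶ x}
    (w : p₁ ≫ f = p₂ ≫ g) [Mono p₁] (h : ∀ {t : C} (u : t ⟶ a) (v : t ⟶ b), u ≫ f = v ≫ g →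
      ∃ l, l ≫ p₁ = u ∧ l ≫ p₂ = v) : IsPullback p₁ p₂ f g := by
  refine ⟨⟨w⟩, ⟨PullbackCone.IsLimit.mk _ (fun c => (h c.fst c.snd c.condition).choose)
    (fun c => (h c.fst c.snd c.condition).choose_spec.1)
    (fun c => (h c.fst c.snd c.condition).choose_spec.2) fun c m h₁ _ => ?_⟩⟩
  rw [← cancel_mono p₁, h₁, (h c.fst c.snd c.condition).choose_spec.1]

/-- In a category with finite limits and strict initial object, disjoint and distributive coproducts
are van Kampen. -/
lemma finitaryExtensive_of_disjoint_of_distributive [HasFiniteLimits C] [HasFiniteCoproducts C]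
    [HasStrictInitialObjects C]
    (disj : ∀ x y : C, IsPullback (initial.to x) (initial.to y)
      (coprod.inl : x ⟶ x ⨿ y) (coprod.inr : y ⟶ x ⨿ y))
    (distrib : ∀ {y x : C} (f : y ⟶ x), PreservesFiniteCoproducts (Over.pullback f)) :
    FinitaryExtensive C := by
  -- a coproduct inclusion is a monomorphism whose pullback along the other inclusion is initial
  have key {x y z : C} (s : x ⟶ z) (t : y ⟶ z) (hc : IsColimit (BinaryCofan.mk s t)) :
      Mono s ∧ ∀ {w : C} (u : w ⟶ x) (v : w ⟶ y), u ≫ s = v ≫ t → Nonempty (IsInitial w) := by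
    have hi {w : C} (u : w ⟶ x) (v : w ⟶ y) (h : u ≫ s = v ≫ t) : Nonempty (IsInitial w) := by
      let e : z ⟶ x ⨿ y := hc.desc (BinaryCofan.mk coprod.inl coprod.inr)
      have h₁ : s ≫ e = coprod.inl := hc.fac _ ⟨.left⟩
      have h₂ : t ≫ e = coprod.inr := hc.fac _ ⟨.right⟩
      have h' : u ≫ coprod.inl = v ≫ coprod.inr := by rw [← h₁, ← h₂, reassoc_of% h]
      have := ((disj x y).lift u v h')
      exact ⟨initialIsInitial.ofStrict this⟩
    refine ⟨?_, hi⟩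
    -- Pulling the coproduct `z` back along `s` writes `x` as the coproduct of the kernel pair of
    -- `s` and of an initial object. So the first projection of the kernel pair is invertible.
    have hp := IsPullback.of_hasPullback s s
    have hq := IsPullback.of_hasPullback s t
    have := distrib s
    obtain ⟨h⟩ := isColimit_binaryCofan_of_pullback s hc hp hq
    obtain ⟨hi⟩ := hi _ _ hq.w
    obtain ⟨g, hg, -⟩ : IsIso (pullback.fst s s) :=
      (BinaryCofan.isColimit_iff_isIso_inl hi _).1 ⟨h⟩
    -- The inverse of the first projection is the diagonal, which is also a section of the second
    -- projection; hence the two agree.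
    have hs : pullback.fst s s = pullback.snd s s := by
      have h₁ : pullback.lift (𝟙 x) (𝟙 x) rfl ≫ pullback.fst s s = 𝟙 x := pullback.lift_fst _ _ _
      have h₂ : pullback.lift (𝟙 x) (𝟙 x) rfl ≫ pullback.snd s s = 𝟙 x := pullback.lift_snd _ _ _
      have h₃ : pullback.lift (𝟙 x) (𝟙 x) rfl = g := by
        rw [← Category.comp_id (pullback.lift (𝟙 x) (𝟙 x) rfl), ← hg, reassoc_of% h₁]
      rw [← Category.comp_id (pullback.fst s s), ← h₂, h₃, reassoc_of% hg]
    refine ⟨fun u v huv => ?_⟩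
    have h₁ : pullback.lift u v huv ≫ pullback.fst s s = u := pullback.lift_fst _ _ _
    have h₂ : pullback.lift u v huv ≫ pullback.snd s s = v := pullback.lift_snd _ _ _
    rw [← h₁, hs, h₂]
  have left {x y z : C} (s : x ⟶ z) (t : y ⟶ z) (hc : IsColimit (BinaryCofan.mk s t))
      {x' y' : C} (αX : x' ⟶ x) (αY : y' ⟶ y) (f : x' ⨿ y' ⟶ z)
      (h₁ : αX ≫ s = coprod.inl ≫ f) (h₂ : αY ≫ t = coprod.inr ≫ f) :
      IsPullback coprod.inl αX f s := by
    have := (key _ _ (coprodIsCoprod x' y')).1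
    have hm := (key _ _ hc).1
    refine isPullback_of_mono h₁.symm fun u v huv => ?_
    -- Decompose the source of `u` along `x' ⨿ y'`. The part over `y'` maps compatibly to `x` and to
    -- `y`, so it is initial, and `u` factors through `x'`.
    have := distrib u
    have hp := IsPullback.of_hasPullback u (coprod.inl : x' ⟶ x' ⨿ y')
    have hq := IsPullback.of_hasPullback u (coprod.inr : y' ⟶ x' ⨿ y')
    have hi : Nonempty (IsInitial (pullback u (coprod.inr : y' ⟶ x' ⨿ y'))) := by
      refine (key _ _ hc).2 (pullback.fst _ _ ≫ v) (pullback.snd _ _ ≫ αY) ?_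
      rw [Category.assoc, Category.assoc, ← huv, h₂, hq.w_assoc]
    obtain ⟨g, -, hg⟩ : IsIso (pullback.fst u (coprod.inl : x' ⟶ x' ⨿ y')) :=
      (BinaryCofan.isColimit_iff_isIso_inl hi.some _).1
        (isColimit_binaryCofan_of_pullback u (coprodIsCoprod x' y') hp hq)
    have h₃ : (g ≫ pullback.snd _ _) ≫ coprod.inl = u := by
      rw [Category.assoc, ← hp.w, reassoc_of% hg]
    refine ⟨g ≫ pullback.snd _ _, h₃, ?_⟩
    rw [← cancel_mono s, Category.assoc, h₁, ← Category.assoc _ _ f, h₃, huv]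
  refine ⟨fun {x y} c hc => ?_⟩
  have hc' : IsColimit (BinaryCofan.mk c.inl c.inr) := hc.ofIsoColimit (isoBinaryCofanMk c)
  have hc'' : IsColimit (BinaryCofan.mk c.inr c.inl) := BinaryCofan.isColimitFlip hc
  refine BinaryCofan.isVanKampen_mk c (fun X Y => BinaryCofan.mk coprod.inl coprod.inr)
    (fun X Y => coprodIsCoprod X Y) (fun f g => PullbackCone.mk _ _ (pullback.condition (f := f) (g := g)))
    (fun f g => pullbackIsPullback f g) (fun {x' y'} αX αY f h₁ h₂ => ⟨?_, ?_⟩) (fun {z} f => ?_)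
  · exact left _ _ hc' αX αY f h₁ h₂
  · have := left _ _ hc'' αY αX ((coprod.braiding _ _).hom ≫ f)
      ((coprod.inl_desc_assoc _ _ _).trans h₂.symm).symm
      ((coprod.inr_desc_assoc _ _ _).trans h₁.symm).symm
    exact IsPullback.of_iso this (Iso.refl _) (coprod.braiding _ _) (Iso.refl _) (Iso.refl _)
      ((coprod.inl_desc _ _).trans (Category.id_comp _).symm)
      ((Category.comp_id _).trans (Category.id_comp _).symm) (Category.comp_id _)
      ((Category.comp_id _).trans (Category.id_comp _).symm)
  · have := distrib f
    exact (isColimit_binaryCofan_of_pullback f hc' (IsPullback.of_hasPullback f c.inl)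
      (IsPullback.of_hasPullback f c.inr)).some

end Extensive

section Galois

variable {C : Type u} [Category.{u} C]

attribute [instance] IsGaloisCategory.hasFiniteLimits IsGaloisCategory.hasFiniteCoproducts
  IsGaloisCategory.hasStrictInitialObjects

instance [IsGaloisCategory C] : FinitaryExtensive C :=
  finitaryExtensive_of_disjoint_of_distributive IsGaloisCategory.disjoint
    IsGaloisCategory.distributive

end Galois

/-! ### Finite coproducts in an extensive category. -/

section Coproducts

variable {C : Type u} [Category.{u} C]

/-- The morphisms `i k : x k ⟶ p` exhibit `p` as a coproduct. -/
def IsCoprod {ι : Type*} {x : ι → C} {p : C} (i : ∀ k, x k ⟶ p) : Prop :=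
  Nonempty (IsColimit (Cofan.mk p i))

/-- An object that is not initial. -/
def NonInitial (x : C) : Prop := IsEmpty (IsInitial x)

namespace IsCoprod

variable {ι : Type*} {x : ι → C} {p : C} {i : ∀ k, x k ⟶ p}

lemma sigma [HasFiniteCoproducts C] [Finite ι] (x : ι → C) : IsCoprod (Sigma.ι x) :=
  ⟨coproductIsCoproduct x⟩

/-- The morphism out of a coproduct. -/
noncomputable def desc (h : IsCoprod i) {z : C} (g : ∀ k, x k ⟶ z) : p ⟶ z :=
  Cofan.IsColimit.desc h.some g

@[simp]
lemma fac (h : IsCoprod i) {z : C} (g : ∀ k, x k ⟶ z) (k : ι) : i k ≫ h.desc g = g k :=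
  Cofan.IsColimit.fac h.some g k

@[simp]
lemma fac_assoc (h : IsCoprod i) {z w : C} (g : ∀ k, x k ⟶ z) (k : ι) (m : z ⟶ w) :
    i k ≫ h.desc g ≫ m = g k ≫ m := by
  rw [← Category.assoc, h.fac]

lemma hom_ext (h : IsCoprod i) {z : C} {f g : p ⟶ z} (hfg : ∀ k, i k ≫ f = i k ≫ g) : f = g :=
  Cofan.IsColimit.hom_ext h.some f g hfg

lemma of_exists (hex : ∀ {z : C} (g : ∀ k, x k ⟶ z), ∃ f : p ⟶ z, ∀ k, i k ≫ f = g k)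
    (huniq : ∀ {z : C} {f g : p ⟶ z}, (∀ k, i k ≫ f = i k ≫ g) → f = g) : IsCoprod i :=
  ⟨Cofan.IsColimit.mk _ (fun t => (hex t.inj).choose) (fun t k => (hex t.inj).choose_spec k)
    fun t _ hm => huniq fun k => (hm k).trans ((hex t.inj).choose_spec k).symm⟩

lemma of_iso (h : IsCoprod i) {q : C} {j : ∀ k, x k ⟶ q} (e : p ⟶ q) [IsIso e]
    (he : ∀ k, i k ≫ e = j k) : IsCoprod j :=
  of_exists (fun g => ⟨inv e ≫ h.desc g, fun k => by rw [← he]; simp⟩) fun {z f g} hfg => by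
    rw [← cancel_epi e]
    exact h.hom_ext fun k => by rw [reassoc_of% he, reassoc_of% he, hfg]

lemma isIso (h : IsCoprod i) {q : C} {j : ∀ k, x k ⟶ q} (h' : IsCoprod j) (e : p ⟶ q)
    (he : ∀ k, i k ≫ e = j k) : IsIso e :=
  ⟨h'.desc i, h.hom_ext fun k => by rw [reassoc_of% he, h'.fac, Category.comp_id],
    h'.hom_ext fun k => by rw [h'.fac_assoc, he, Category.comp_id]⟩

lemma reindex (h : IsCoprod i) {ι' : Type*} (e : ι' ≃ ι) : IsCoprod fun k => i (e k) :=
  of_exists (fun g => ⟨h.desc fun k => eqToHom (by simp) ≫ g (e.symm k), fun k => by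
    rw [h.fac]
    obtain ⟨l, rfl⟩ : ∃ l, k = e.symm l := ⟨e k, by simp⟩
    have : ∀ m (hm : m = e.symm l), eqToHom (by rw [hm]) ≫ g m = g (e.symm l) := by
      rintro _ rfl; simp
    exact this _ (by simp)⟩) fun {z f g} hfg =>
    h.hom_ext fun k => by obtain ⟨l, rfl⟩ := e.surjective k; exact hfg l

lemma trans (h : IsCoprod i) {κ : ι → Type*} {y : ∀ k, κ k → C} {j : ∀ k l, y k l ⟶ x k}
    (hj : ∀ k, IsCoprod (j k)) :
    IsCoprod (fun kl : Σ k, κ k => j kl.1 kl.2 ≫ i kl.1) :=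
  of_exists (fun g => ⟨h.desc fun k => (hj k).desc fun l => g ⟨k, l⟩, fun ⟨k, l⟩ => by simp⟩)
    fun {z f g} hfg => h.hom_ext fun k => (hj k).hom_ext fun l => by
      simpa using hfg ⟨k, l⟩

lemma isInitial (h : IsCoprod i) (hx : ∀ k, Nonempty (IsInitial (x k))) : Nonempty (IsInitial p) :=
  ⟨IsInitial.ofUniqueHom (fun _ => h.desc fun k => (hx k).some.to _)
    fun _ _ => h.hom_ext fun k => (hx k).some.hom_ext _ _⟩

section
variable [FinitaryExtensive C] [Finite ι]

lemma pullback (h : IsCoprod i) {z : C} (f : z ⟶ p) {y : ι → C} {a : ∀ k, y k ⟶ z}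
    {b : ∀ k, y k ⟶ x k} (hp : ∀ k, IsPullback (a k) (b k) f (i k)) : IsCoprod a :=
  (FinitaryPreExtensive.isUniversal_finiteCoproducts h.some) (Cofan.mk z a)
    (Discrete.natTrans fun k => b k.as) f
    (NatTrans.ext (funext fun k => (hp k.as).w.symm)) (.of_discrete _) fun k => hp k.as

lemma mono (h : IsCoprod i) (k : ι) : Mono (i k) := FinitaryExtensive.mono_ι h.some ⟨k⟩

lemma isInitial_of_comp_eq (h : IsCoprod i) {k l : ι} (hkl : k ≠ l) {t : C} {u : t ⟶ x k}
    {v : t ⟶ x l} (huv : u ≫ i k = v ≫ i l) : Nonempty (IsInitial t) :=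
  ⟨initialIsInitial.ofStrict ((FinitaryExtensive.isPullback_initial_to h.some ⟨k⟩ ⟨l⟩
    fun h => hkl (congrArg Discrete.as h)).lift u v huv)⟩

/-- The pullbacks of the summands along `f` have coproduct `t`. If all of them were initial, so
would be `t`. Non-initial objects thus serve as approximate points, each meeting some summand. -/
lemma exists_lift [HasPullbacks C] (h : IsCoprod i) {t : C} (ht : NonInitial t) (f : t ⟶ p) :
    ∃ (k : ι) (s : C) (_ : NonInitial s) (u : s ⟶ t) (v : s ⟶ x k), u ≫ f = v ≫ i k := by
  by_contra! H
  have := h.pullback f (fun k => IsPullback.of_hasPullback f (i k))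
  refine (ht.false (this.isInitial fun k => ?_).some)
  by_contra hk
  exact H k _ ⟨fun h => hk ⟨h⟩⟩ _ _ pullback.condition

end

end IsCoprod

end Coproducts

/-! ### Conservativity of pullback along effective descent morphisms. -/

section Descent

variable {C : Type u} [Category.{u} C]

lemma Monad.reflectsIsomorphisms_of_comparison {D : Type*} [Category* D] {D' : Type*} [Category* D']
    {L : D ⥤ D'} {R : D' ⥤ D} (adj : L ⊣ R) [(Monad.comparison adj).IsEquivalence] :
    R.ReflectsIsomorphisms :=
  reflectsIsomorphisms_of_iso (Monad.comparisonForget adj)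

/-- Pullback along an effective descent morphism is conservative. -/
lemma IsEffectiveDescent.isIso_of_isPullback {y x : C} {f : y ⟶ x} (hf : IsEffectiveDescent f)
    {a b a' b' : C} (g : a ⟶ b) (g' : a' ⟶ b') {p : b ⟶ x} {s : a' ⟶ a} {s' : a' ⟶ y} {t : b' ⟶ b}
    {t' : b' ⟶ y} (ha : IsPullback s s' (g ≫ p) f) (hb : IsPullback t t' p f)
    (h : g' ≫ t = s ≫ g) (h' : g' ≫ t' = s') [IsIso g'] : IsIso g := by
  obtain ⟨_, _⟩ := hf
  have := Monad.reflectsIsomorphisms_of_comparison (Over.mapPullbackAdj f)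
  let γ : Over.mk (g ≫ p) ⟶ Over.mk p := Over.homMk g
  let ea := (IsPullback.of_hasPullback (g ≫ p) f).isoIsPullback _ _ ha
  let eb := (IsPullback.of_hasPullback p f).isoIsPullback _ _ hb
  have hγ : ((Over.pullback f).map γ).left = ea.hom ≫ g' ≫ eb.inv := by
    rw [← Category.assoc, Iso.eq_comp_inv]
    refine hb.hom_ext ?_ ?_
    · have h₁ : ((Over.pullback f).map γ).left ≫ pullback.fst p f = pullback.fst (g ≫ p) f ≫ g :=
        pullback.lift_fst _ _ _
      rw [Category.assoc, Category.assoc, h, IsPullback.isoIsPullback_hom_fst_assoc,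
        IsPullback.isoIsPullback_hom_fst, h₁]
    · have h₁ : ((Over.pullback f).map γ).left ≫ pullback.snd p f = pullback.snd (g ≫ p) f :=
        pullback.lift_snd _ _ _
      rw [Category.assoc, Category.assoc, h', IsPullback.isoIsPullback_hom_snd,
        IsPullback.isoIsPullback_hom_snd, h₁]
  have : IsIso ((Over.forget _).map ((Over.pullback f).map γ)) := by
    change IsIso ((Over.pullback f).map γ).left
    rw [hγ]
    infer_instance
  have : IsIso ((Over.pullback f).map γ) := isIso_of_reflects_iso _ (Over.forget _)
  have : IsIso γ := isIso_of_reflects_iso _ (Over.pullback f)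
  exact inferInstanceAs (IsIso ((Over.forget _).map γ))

/-- If the pullback were initial, then `initial.to z` would become an isomorphism after pullback
along `f`, and conservativity would make `z` initial. -/
lemma IsEffectiveDescent.nonInitial_pullback [HasPullbacks C] [HasInitial C]
    [HasStrictInitialObjects C] {y x z : C} {f : y ⟶ x} (hf : IsEffectiveDescent f) (p : z ⟶ x)
    (hz : NonInitial z) : NonInitial (pullback p f) := by
  refine ⟨fun hi => hz.false ?_⟩
  have h₁ := IsPullback.of_hasPullback (initial.to z ≫ p) f
  have h₂ := IsPullback.of_hasPullback p f
  have h₀ : IsInitial (pullback (initial.to z ≫ p) f) :=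
    initialIsInitial.ofStrict (pullback.fst (initial.to z ≫ p) f)
  let g' : pullback (initial.to z ≫ p) f ⟶ pullback p f := h₀.to _
  have : IsIso g' := hi.isIso_to g'
  have := hf.isIso_of_isPullback (initial.to z) g' h₁ h₂ (h₀.hom_ext _ _) (h₀.hom_ext _ _)
  exact initialIsInitial.ofIso (asIso (initial.to z))

end Descent

/-! ### Finite sets and the construction of fiber functors. -/

namespace FintypeCat.Skeleton

/-- The elements of an object of the skeleton of the category of finite sets. -/
abbrev Elem (S : FintypeCat.Skeleton.{u}) : Type u := ULift.{u} (Fin S.len)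

/-- The function underlying a morphism of the skeleton of the category of finite sets. -/
def ap {S T : FintypeCat.Skeleton.{u}} (f : S ⟶ T) : Elem S → Elem T := f

/-- The morphism given by a function. -/
def ofFun {S T : FintypeCat.Skeleton.{u}} (f : Elem S → Elem T) : S ⟶ T := f

@[simp] lemma ap_ofFun {S T : FintypeCat.Skeleton.{u}} (f : Elem S → Elem T) : ap (ofFun f) = f := rfl

@[simp] lemma ap_id (S : FintypeCat.Skeleton.{u}) (a : Elem S) : ap (𝟙 S) a = a := rfl

@[simp] lemma ap_comp {S T U : FintypeCat.Skeleton.{u}} (f : S ⟶ T) (g : T ⟶ U) (a : Elem S) :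
    ap (f ≫ g) a = ap g (ap f a) := rfl

lemma hom_ext {S T : FintypeCat.Skeleton.{u}} {f g : S ⟶ T} (h : ∀ a, ap f a = ap g a) : f = g :=
  funext h

lemma isIso_of_bijective {S T : FintypeCat.Skeleton.{u}} (f : S ⟶ T)
    (h : Function.Bijective (ap f)) : IsIso f :=
  ⟨ofFun (Equiv.ofBijective _ h).symm, hom_ext fun a => (Equiv.ofBijective _ h).symm_apply_apply a,
    hom_ext fun a => (Equiv.ofBijective _ h).apply_symm_apply a⟩

lemma bijective_of_isIso {S T : FintypeCat.Skeleton.{u}} (f : S ⟶ T) [IsIso f] :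
    Function.Bijective (ap f) :=
  Function.bijective_iff_has_inverse.2 ⟨ap (inv f), fun a => congrFun (IsIso.hom_inv_id f) a,
    fun a => congrFun (IsIso.inv_hom_id f) a⟩

end FintypeCat.Skeleton

open FintypeCat.Skeleton

section Fiber

variable {C : Type u} [Category.{u} C]

/-- A fiber functor: a functor to finite sets preserving finite limits and finite coproducts and
sending effective descent morphisms to surjections. -/
structure IsFiber (F : C ⥤ FintypeCat.Skeleton.{u}) : Prop where
  terminal {t : C} (ht : IsTerminal t) : ∃ a : Elem (F.obj t), ∀ b, b = a
  pullback {p a b x : C} {p₁ : p ⟶ a} {p₂ : p ⟶ b} {f : a ⟶ x} {g : b ⟶ x}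
    (h : IsPullback p₁ p₂ f g) {u : Elem (F.obj a)} {v : Elem (F.obj b)}
    (huv : ap (F.map f) u = ap (F.map g) v) : ∃ w, ap (F.map p₁) w = u ∧ ap (F.map p₂) w = v
  pullback_ext {p a b x : C} {p₁ : p ⟶ a} {p₂ : p ⟶ b} {f : a ⟶ x} {g : b ⟶ x}
    (h : IsPullback p₁ p₂ f g) {w w' : Elem (F.obj p)} (h₁ : ap (F.map p₁) w = ap (F.map p₁) w')
    (h₂ : ap (F.map p₂) w = ap (F.map p₂) w') : w = w'
  coprod {ι : Type} [Finite ι] {x : ι → C} {p : C} {i : ∀ k, x k ⟶ p} (h : IsCoprod i)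
    (a : Elem (F.obj p)) : ∃ k b, ap (F.map (i k)) b = a
  coprod_ext {ι : Type} [Finite ι] {x : ι → C} {p : C} {i : ∀ k, x k ⟶ p} (h : IsCoprod i)
    {k l : ι} {b : Elem (F.obj (x k))} {b' : Elem (F.obj (x l))}
    (hb : ap (F.map (i k)) b = ap (F.map (i l)) b') : (⟨k, b⟩ : Σ k, Elem (F.obj (x k))) = ⟨l, b'⟩
  descent {x y : C} {f : x ⟶ y} (hf : IsEffectiveDescent f) : Function.Surjective (ap (F.map f))

/-- The sections `e s` of the projection of `x × q` to `q` locally exhaust, and are disjoint. -/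
structure IsLocalSplitting {q x : C} {n : ℕ} (e : Fin n → (q ⟶ x)) : Prop where
  inj {t : C} (ht : NonInitial t) (f : t ⟶ q) {s s' : Fin n} : f ≫ e s = f ≫ e s' → s = s'
  surj {t : C} (ht : NonInitial t) (f : t ⟶ q) (g : t ⟶ x) :
    ∃ (t' : C) (_ : NonInitial t') (u : t' ⟶ t) (s : Fin n), u ≫ g = u ≫ f ≫ e s

lemma IsLocalSplitting.comp {q x : C} {n : ℕ} {e : Fin n → (q ⟶ x)} (h : IsLocalSplitting e)
    {r : C} (f : r ⟶ q) : IsLocalSplitting fun s => f ≫ e s where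
  inj ht g _ _ hs := h.inj ht (g ≫ f) (by simpa using hs)
  surj ht g k := by simpa using h.surj ht (g ≫ f) k

/-- Finitely many conditions that are local for the refinement by non-initial objects can be
achieved simultaneously. -/
lemma exists_refinement {ι : Type*} [Finite ι] {q : C} (hq : NonInitial q)
    (R : ι → ∀ {t : C}, (t ⟶ q) → Prop)
    (stable : ∀ k {t t' : C} (f : t ⟶ q) (u : t' ⟶ t), R k f → R k (u ≫ f))
    (dense : ∀ k {t : C} (_ : NonInitial t) (f : t ⟶ q),
      ∃ (t' : C) (_ : NonInitial t') (u : t' ⟶ t), R k (u ≫ f)) :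
    ∃ (t : C) (_ : NonInitial t) (f : t ⟶ q), ∀ k, R k f := by
  classical
  have := Fintype.ofFinite ι
  have (J : Finset ι) : ∃ (t : C) (_ : NonInitial t) (f : t ⟶ q), ∀ k ∈ J, R k f := by
    induction J using Finset.induction with
    | empty => exact ⟨q, hq, 𝟙 q, by simp⟩
    | insert k J _ ih =>
      obtain ⟨t, ht, f, hf⟩ := ih
      obtain ⟨t', ht', u, hu⟩ := dense k ht f
      refine ⟨t', ht', u ≫ f, fun l hl => ?_⟩
      obtain rfl | hl := Finset.mem_insert.1 hl
      · exact hu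
      · exact stable l f u (hf l hl)
  obtain ⟨t, ht, f, hf⟩ := this Finset.univ
  exact ⟨t, ht, f, fun k => hf k (Finset.mem_univ k)⟩

/-- An arrow of a category. -/
abbrev Arr (C : Type u) [Category.{u} C] := Σ x y : C, x ⟶ y

/-- Two refinements of `W` are made: one over which every object of `S` has a local splitting, and
one over which the arrows of `T` carry the chosen sections to chosen sections. The bound `N` does
not depend on `S` and `T`, and `n` and `φ` are total with natural number values, so that
realizations of different subgraphs can be compared along an ultrafilter. -/
lemma exists_finite_realization {W : C} (hW : NonInitial W) (S : Finset C) (T : Finset (Arr C))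
    (N : C → ℕ) (hN : ∀ x, ∀ {t : C} (_ : NonInitial t),
      ∃ (t' : C) (_ : NonInitial t') (_ : t' ⟶ t) (n : ℕ) (_ : n ≤ N x) (e : Fin n → (t' ⟶ x)),
        IsLocalSplitting e) :
    ∃ (q : C) (_ : NonInitial q) (_ : q ⟶ W) (n : C → ℕ) (e : ∀ x ∈ S, Fin (n x) → (q ⟶ x))
      (φ : Arr C → ℕ → ℕ), (∀ x, n x ≤ N x) ∧ (∀ x hx, IsLocalSplitting (e x hx)) ∧
      ∀ m ∈ T, ∀ hx hy, ∀ s : Fin (n m.1), ∃ h : φ m s < n m.2.1, e m.1 hx s ≫ m.2.2 = e m.2.1 hy ⟨φ m s, h⟩ := by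
  classical
  obtain ⟨q, hq, w, h⟩ := exists_refinement hW
    (fun (x : S) {t} _ => ∃ (n : ℕ) (_ : n ≤ N x) (e : Fin n → (t ⟶ x)), IsLocalSplitting e)
    (fun x t t' f u ⟨n, hn, e, he⟩ => ⟨n, hn, _, he.comp u⟩)
    (fun x t ht f => by
      obtain ⟨t', ht', u, h⟩ := hN x ht
      exact ⟨t', ht', u, h⟩)
  choose n hn e he using h
  obtain ⟨n, rfl⟩ : ∃ n' : C → ℕ, n = fun x => n' x.1 :=
    ⟨fun x => if hx : x ∈ S then n ⟨x, hx⟩ else 0, funext fun x => by simp⟩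
  obtain ⟨q', hq', u, h⟩ := exists_refinement hq
    (fun (m : Σ m : {m : T // m.1.1 ∈ S ∧ m.1.2.1 ∈ S}, Fin (n m.1.1.1)) {t} f =>
      ∃ s' : Fin (n m.1.1.1.2.1), f ≫ e ⟨_, m.1.2.1⟩ m.2 ≫ m.1.1.1.2.2 = f ≫ e ⟨_, m.1.2.2⟩ s')
    (fun m t t' f u ⟨s', h⟩ => ⟨s', by simp [h]⟩)
    (fun m t ht f => by
      obtain ⟨t', ht', u, s', h⟩ := (he ⟨_, m.1.2.2⟩).surj ht f (f ≫ e ⟨_, m.1.2.1⟩ m.2 ≫ m.1.1.1.2.2)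
      exact ⟨t', ht', u, s', by simpa using h⟩)
  choose φ hφ using h
  -- The value `0` outside `S` keeps the bound `n x ≤ N x` valid for every object.
  refine ⟨q', hq', u ≫ w, fun x => if x ∈ S then n x else 0,
    fun x hx s => u ≫ e ⟨x, hx⟩ (s.cast (if_pos hx)),
    fun m s => if hm : m ∈ T ∧ m.1 ∈ S ∧ m.2.1 ∈ S then
      if hs : s < n m.1 then φ ⟨⟨⟨m, hm.1⟩, hm.2⟩, ⟨s, hs⟩⟩ else 0 else 0, ?_, ?_, ?_⟩
  · intro x
    dsimp only
    split_ifs with hx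
    · exact hn ⟨x, hx⟩
    · simp
  · intro x hx
    have hc : (if x ∈ S then n x else 0) = n x := if_pos hx
    have := (he ⟨x, hx⟩).comp u
    refine ⟨fun ht f s s' h => ?_, fun ht f g => ?_⟩
    · simpa [Fin.ext_iff] using this.inj ht f h
    · obtain ⟨t', ht', v, s, h⟩ := this.surj ht f g
      exact ⟨t', ht', v, s.cast hc.symm, h⟩
  · intro m hm hx hy s
    have hs : (s : ℕ) < n m.1 := lt_of_lt_of_eq s.2 (if_pos hx)
    have key : (if hm : m ∈ T ∧ m.1 ∈ S ∧ m.2.1 ∈ S then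
      if hs : (s : ℕ) < n m.1 then (φ ⟨⟨⟨m, hm.1⟩, hm.2⟩, ⟨s, hs⟩⟩ : ℕ) else 0 else 0) =
        φ ⟨⟨⟨m, hm⟩, hx, hy⟩, ⟨s, hs⟩⟩ := by
      rw [dif_pos ⟨hm, hx, hy⟩, dif_pos hs]
    have h := hφ ⟨⟨⟨m, hm⟩, hx, hy⟩, ⟨s, hs⟩⟩
    refine ⟨key.trans_lt ((φ ⟨⟨⟨m, hm⟩, hx, hy⟩, ⟨s, hs⟩⟩).2.trans_eq (if_pos hy).symm), ?_⟩
    refine (Category.assoc _ _ _).trans (h.trans ?_)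
    exact congrArg (fun z => u ≫ e ⟨_, hy⟩ z) (Fin.ext key.symm)

variable [IsGaloisCategory C]

/-- Two sections that agree over a non-initial object would contradict disjointness of the summands.
For exhaustion, `(g, f)` is a map to `x ⨯ q`, and over some non-initial object it factors through a
summand. -/
lemma IsCoprod.isLocalSplitting {q x : C} {n : ℕ} {e : Fin n → (q ⟶ x)}
    (h : IsCoprod fun s => prod.lift (e s) (𝟙 q)) : IsLocalSplitting e where
  inj {t} ht f s s' hs := by
    by_contra hne
    refine ht.false (h.isInitial_of_comp_eq hne (u := f) (v := f) ?_).some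
    ext <;> simp [hs]
  surj {t} ht f g := by
    obtain ⟨s, t', ht', u, v, huv⟩ := h.exists_lift ht (prod.lift g f)
    have h₁ := congrArg (· ≫ prod.fst) huv
    have h₂ := congrArg (· ≫ prod.snd) huv
    simp only [Category.assoc, prod.lift_fst, prod.lift_snd, Category.comp_id] at h₁ h₂
    exact ⟨t', ht', u, s, by rw [h₁, ← h₂, Category.assoc]⟩

/-- The splitting cover of an object. -/
lemma IsGaloisCategory.exists_cover (x : C) : ∃ (n : ℕ) (q : Fin n → C) (s : Fin n → ℕ)
    (e : ∀ i, Fin (s i) → (q i ⟶ x)), IsEffectiveDescent (terminal.from (∐ q)) ∧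
      ∀ i, IsCoprod fun k => prod.lift (e i k) (𝟙 (q i)) := by
  obtain ⟨n, q, s, hq, h⟩ := IsGaloisCategory.locally_split x
  choose w hw using h
  refine ⟨n, q, s, fun i k => Sigma.ι (fun _ : Fin (s i) => q i) k ≫ (w i).inv ≫ prod.fst, hq,
    fun i => (IsCoprod.sigma fun _ : Fin (s i) => q i).of_iso (w i).inv fun k => ?_⟩
  have : (w i).inv ≫ prod.snd = Limits.Sigma.desc (fun _ => 𝟙 (q i)) := by
    rw [Iso.inv_comp_eq, hw]
  apply Limits.prod.hom_ext
  · simp only [Category.assoc, prod.lift_fst]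
  · simp only [Category.assoc, prod.lift_snd, this]
    exact Limits.Sigma.ι_desc _ _

/-- A non-initial object meets some piece of a cover. -/
lemma exists_nonInitial_prod {ι : Type} [Finite ι] {q : ι → C} {p : C} {i : ∀ k, q k ⟶ p}
    (h : IsCoprod i) (hp : IsEffectiveDescent (terminal.from p)) {t : C} (ht : NonInitial t) :
    ∃ (k : ι) (s : C) (_ : NonInitial s) (_ : s ⟶ t), Nonempty (s ⟶ q k) := by
  have h' := hp.nonInitial_pullback (terminal.from t) ht
  obtain ⟨k, s, hs, u, v, -⟩ := h.exists_lift h' (pullback.snd _ _)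
  exact ⟨k, s, hs, u ≫ pullback.fst _ _, ⟨v⟩⟩

/-- The cover has finitely many pieces, so the maximum of their numbers of sections bounds them all,
whichever piece `t` meets. -/
lemma exists_bound_isLocalSplitting (x : C) : ∃ N : ℕ, ∀ {t : C} (_ : NonInitial t),
    ∃ (t' : C) (_ : NonInitial t') (_ : t' ⟶ t) (n : ℕ) (_ : n ≤ N) (e : Fin n → (t' ⟶ x)),
      IsLocalSplitting e := by
  obtain ⟨n, q, s, e, hq, h⟩ := IsGaloisCategory.exists_cover x
  refine ⟨Finset.univ.sup s, fun {t} ht => ?_⟩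
  obtain ⟨k, t', ht', u, ⟨v⟩⟩ := exists_nonInitial_prod (IsCoprod.sigma q) hq ht
  exact ⟨t', ht', u, s k, Finset.le_sup (Finset.mem_univ k), _, (h k).isLocalSplitting.comp v⟩

/-- A compactness argument: there are a system of cardinalities and of functions that is realized, on
every finite subgraph, by a compatible system of local splittings over a non-initial object over `W`. -/
lemma exists_realization {W : C} (hW : NonInitial W) :
    ∃ (n : C → ℕ) (φ : ∀ {x y : C}, (x ⟶ y) → Fin (n x) → Fin (n y)),
      ∀ (S : Finset C) (T : Finset (Arr C)), ∃ (q : C) (_ : NonInitial q) (_ : q ⟶ W)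
        (e : ∀ x ∈ S, Fin (n x) → (q ⟶ x)), (∀ x hx, IsLocalSplitting (e x hx)) ∧
        ∀ m ∈ T, ∀ hx hy s, e m.1 hx s ≫ m.2.2 = e m.2.1 hy (φ m.2.2 s) := by
  classical
  choose N hN using exists_bound_isLocalSplitting (C := C)
  choose q hq w n e φ hnN he hφ using
    fun K : Finset C × Finset (Arr C) => exists_finite_realization hW K.1 K.2 N hN
  -- An ultrafilter finer than `atTop` contains the set of subgraphs that include any given finite
  -- one.
  let U : Ultrafilter (Finset C × Finset (Arr C)) := Ultrafilter.of Filter.atTop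
  have hU (K) : ∀ᶠ L in (↑U : Filter (Finset C × Finset (Arr C))), K ≤ L :=
    (Ultrafilter.of_le Filter.atTop) (Filter.eventually_ge_atTop K)
  -- The cardinality at `x` takes at most `N x + 1` values, so one of them is taken on a set of the
  -- ultrafilter.
  have h₁ (x : C) : ∃ k : ℕ, ∀ᶠ K in (↑U : Filter (Finset C × Finset (Arr C))), n K x = k := by
    obtain ⟨k, -, hk⟩ := (Ultrafilter.eventually_exists_mem_iff (f := U)
      (P := fun k K => n K x = k) (Set.finite_le_nat (N x))).1
      (Filter.Eventually.of_forall fun K => ⟨n K x, hnN K x, rfl⟩)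
    exact ⟨k, hk⟩
  choose n' hn' using h₁
  -- Once the cardinalities are fixed there are finitely many functions between the fibers, so one
  -- of them prevails.
  have h₂ {x y : C} (f : x ⟶ y) : ∃ g : Fin (n' x) → Fin (n' y),
      ∀ᶠ K in (↑U : Filter (Finset C × Finset (Arr C))), ∀ s : Fin (n' x), φ K ⟨x, y, f⟩ (s : ℕ) = g s := by
    refine Ultrafilter.eventually_exists_iff.1 ?_
    filter_upwards [hn' x, hn' y, hU ({x, y}, {⟨x, y, f⟩})] with K hx hy hK
    refine ⟨fun s => ⟨φ K ⟨x, y, f⟩ s, ?_⟩, fun s => rfl⟩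
    obtain ⟨h, -⟩ := hφ K ⟨x, y, f⟩ (hK.2 (by simp)) (hK.1 (by simp)) (hK.1 (by simp))
      (s.cast hx.symm)
    rw [← hy]
    exact h
  choose g hg using @h₂
  refine ⟨n', @g, fun S T => ?_⟩
  have h₃ : ∀ᶠ K in (↑U : Filter (Finset C × Finset (Arr C))), ∀ x ∈ S, n K x = n' x :=
    (Filter.eventually_all_finset S).2 fun x _ => hn' x
  have h₄ : ∀ᶠ K in (↑U : Filter (Finset C × Finset (Arr C))), ∀ m ∈ T, ∀ s : Fin (n' m.1), φ K m s = g m.2.2 s :=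
    (Filter.eventually_all_finset T).2 fun m _ => hg m.2.2
  obtain ⟨K, hK₃, hK₄, hK⟩ := (h₃.and (h₄.and (hU (S, T)))).exists
  refine ⟨q K, hq K, w K, fun x hx s => e K x (hK.1 hx) (s.cast (hK₃ x hx).symm), ?_, ?_⟩
  · intro x hx
    have := he K x (hK.1 hx)
    refine ⟨fun ht f s s' h => ?_, fun ht f k => ?_⟩
    · simpa [Fin.ext_iff] using this.inj ht f h
    · obtain ⟨t', ht', v, s, h⟩ := this.surj ht f k
      exact ⟨t', ht', v, s.cast (hK₃ x hx), h⟩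
  · intro m hm hx hy s
    obtain ⟨h, h'⟩ := hφ K m (hK.2 hm) (hK.1 hx) (hK.1 hy) (s.cast (hK₃ _ hx).symm)
    refine h'.trans (congrArg _ (Fin.ext (hK₄ m hm s)))

/-- The functor to finite sets given by a system of cardinalities and of functions. -/
def realizationFunctor (n : C → ℕ) (φ : ∀ {x y : C}, (x ⟶ y) → Fin (n x) → Fin (n y))
    (hid : ∀ x s, φ (𝟙 x) s = s)
    (hcomp : ∀ {x y z : C} (f : x ⟶ y) (g : y ⟶ z) (s), φ (f ≫ g) s = φ g (φ f s)) :
    C ⥤ FintypeCat.Skeleton.{u} where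
  obj x := .mk (n x)
  map f := ofFun fun a => ⟨φ f a.down⟩
  map_id x := hom_ext fun a => congrArg ULift.up (hid x a.down)
  map_comp f g := hom_ext fun a => congrArg ULift.up (hcomp f g a.down)

/-- There are enough fiber functors. -/
theorem exists_isFiber {W : C} (hW : NonInitial W) :
    ∃ F : C ⥤ FintypeCat.Skeleton.{u}, IsFiber F ∧ Nonempty (Elem (F.obj W)) := by
  classical
  obtain ⟨n, φ, H⟩ := exists_realization hW
  -- Each law of a functor, and below each axiom of a fiber functor, concerns finitely many objects
  -- and arrows. It is checked in a realization of that finite subgraph, where `inj` turns equality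
  -- of sections into equality of indices.
  have hid (x s) : φ (𝟙 x) s = s := by
    obtain ⟨q, hq, w, e, he, h⟩ := H {x} {⟨x, x, 𝟙 x⟩}
    refine (he x (by simp)).inj hq (𝟙 q) ?_
    simpa using (h ⟨x, x, 𝟙 x⟩ (by simp) (by simp) (by simp) s).symm
  have hcomp {x y z : C} (f : x ⟶ y) (g : y ⟶ z) (s) : φ (f ≫ g) s = φ g (φ f s) := by
    obtain ⟨q, hq, w, e, he, h⟩ := H {x, y, z} {⟨x, y, f⟩, ⟨y, z, g⟩, ⟨x, z, f ≫ g⟩}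
    refine (he z (by simp)).inj hq (𝟙 q) ?_
    have h₁ := h ⟨x, y, f⟩ (by simp) (by simp) (by simp) s
    have h₂ := h ⟨y, z, g⟩ (by simp) (by simp) (by simp) (φ f s)
    have h₃ := h ⟨x, z, f ≫ g⟩ (by simp) (by simp) (by simp) s
    dsimp only at h₁ h₂ h₃
    rw [← h₃, ← h₂, ← h₁, Category.assoc]
  refine ⟨realizationFunctor n φ hid hcomp, ?_, ?_⟩
  · constructor
    · intro t ht
      obtain ⟨q, hq, w, e, he, h⟩ := H {t} ∅
      obtain ⟨-, -, -, a, -⟩ := (he t (by simp)).surj hq (𝟙 q) (ht.from q)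
      exact ⟨⟨a⟩, fun b => congrArg ULift.up
        ((he t (by simp)).inj hq (𝟙 q) (ht.hom_ext _ _) : b.down = a)⟩
    · intro p a b x p₁ p₂ f g hp u v huv
      obtain ⟨q, hq, w, e, he, h⟩ := H {p, a, b, x}
        {⟨p, a, p₁⟩, ⟨p, b, p₂⟩, ⟨a, x, f⟩, ⟨b, x, g⟩}
      have h₁ := h ⟨p, a, p₁⟩ (by simp) (by simp) (by simp)
      have h₂ := h ⟨p, b, p₂⟩ (by simp) (by simp) (by simp)
      have h₃ := h ⟨a, x, f⟩ (by simp) (by simp) (by simp) u.down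
      have h₄ := h ⟨b, x, g⟩ (by simp) (by simp) (by simp) v.down
      have huv' : φ f u.down = φ g v.down := congrArg ULift.down huv
      dsimp only at h₁ h₂ h₃ h₄
      have h₅ := h₃.trans ((congrArg _ huv').trans h₄.symm)
      -- The sections for `u` and `v` give a map from `q` to the pullback; locally it is one of the
      -- sections of `p`, whose index is the element sought.
      obtain ⟨t, ht, m, s, hs⟩ := (he p (by simp)).surj hq (𝟙 q) (hp.lift _ _ h₅)
      rw [Category.id_comp] at hs
      refine ⟨⟨s⟩, congrArg ULift.up ((he a (by simp)).inj ht m ?_ : φ p₁ s = u.down),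
        congrArg ULift.up ((he b (by simp)).inj ht m ?_ : φ p₂ s = v.down)⟩
      · rw [← h₁, ← reassoc_of% hs, hp.lift_fst]
      · rw [← h₂, ← reassoc_of% hs, hp.lift_snd]
    · intro p a b x p₁ p₂ f g hp s s' hs₁ hs₂
      obtain ⟨q, hq, w, e, he, h⟩ := H {p, a, b} {⟨p, a, p₁⟩, ⟨p, b, p₂⟩}
      have h₁ := h ⟨p, a, p₁⟩ (by simp) (by simp) (by simp)
      have h₂ := h ⟨p, b, p₂⟩ (by simp) (by simp) (by simp)
      have h₃ : φ p₁ s.down = φ p₁ s'.down := congrArg ULift.down hs₁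
      have h₄ : φ p₂ s.down = φ p₂ s'.down := congrArg ULift.down hs₂
      refine congrArg ULift.up ((he p (by simp)).inj hq (𝟙 q) ?_ : s.down = s'.down)
      rw [Category.id_comp, Category.id_comp]
      exact hp.hom_ext ((h₁ s.down).trans ((congrArg _ h₃).trans (h₁ s'.down).symm))
        ((h₂ s.down).trans ((congrArg _ h₄).trans (h₂ s'.down).symm))
    · intro ι _ x p i hi a
      have := Fintype.ofFinite ι
      obtain ⟨q, hq, w, e, he, h⟩ := H (insert p (Finset.univ.image x))
        (Finset.univ.image fun k => ⟨x k, p, i k⟩)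
      obtain ⟨k, s, hs, u, v, huv⟩ := hi.exists_lift hq (e p (by simp) a.down)
      obtain ⟨t, ht, m, b, hb⟩ := (he (x k) (by simp)).surj hs u v
      refine ⟨k, ⟨b⟩, congrArg ULift.up ((he p (by simp)).inj ht (m ≫ u) ?_ : φ (i k) b = a.down)⟩
      have := h ⟨x k, p, i k⟩ (Finset.mem_image_of_mem _ (Finset.mem_univ k)) (by simp) (by simp) b
      dsimp only at this
      rw [← this, Category.assoc, Category.assoc, huv, reassoc_of% hb]
    · intro ι _ x p i hi k l b b' hb
      have := Fintype.ofFinite ι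
      obtain ⟨q, hq, w, e, he, h⟩ := H (insert p (Finset.univ.image x))
        (Finset.univ.image fun k => ⟨x k, p, i k⟩)
      have hb' : φ (i k) b.down = φ (i l) b'.down := congrArg ULift.down hb
      have h₁ := h ⟨x k, p, i k⟩ (Finset.mem_image_of_mem _ (Finset.mem_univ k)) (by simp) (by simp) b.down
      have h₂ := h ⟨x l, p, i l⟩ (Finset.mem_image_of_mem _ (Finset.mem_univ l)) (by simp) (by simp) b'.down
      dsimp only at h₁ h₂
      have h₃ := h₁.trans ((congrArg _ hb').trans h₂.symm)
      obtain rfl : k = l := by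
        by_contra hkl
        exact hq.false (hi.isInitial_of_comp_eq hkl h₃).some
      have := hi.mono k
      rw [cancel_mono] at h₃
      exact congrArg _ (congrArg ULift.up ((he (x k) (by simp)).inj hq (𝟙 q)
        (congrArg _ h₃) : b.down = b'.down))
    · intro x y f hf a
      obtain ⟨q, hq, w, e, he, h⟩ := H {x, y} {⟨x, y, f⟩}
      -- The section of `y` labelled `a` is pulled back along `f`. By descent the result is not
      -- initial, so a section of `x` above it can be found.
      have hz := hf.nonInitial_pullback (e y (by simp) a.down) hq
      obtain ⟨t, ht, m, b, hb⟩ := (he x (by simp)).surj hz (pullback.fst _ _) (pullback.snd _ _)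
      refine ⟨⟨b⟩, congrArg ULift.up ((he y (by simp)).inj ht (m ≫ pullback.fst _ _) ?_ :
        φ f b = a.down)⟩
      have := h ⟨x, y, f⟩ (by simp) (by simp) (by simp) b
      dsimp only at this
      rw [← this, Category.assoc, Category.assoc, pullback.condition, reassoc_of% hb]
  · obtain ⟨q, hq, w, e, he, h⟩ := H {W} ∅
    obtain ⟨-, -, -, a, -⟩ := (he W (by simp)).surj hq (𝟙 q) w
    exact ⟨⟨a⟩⟩

end Fiber

/-! ### Split objects and the fibers at them. -/

section Splitting

variable {C : Type u} [Category.{u} C]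

lemma isPullback_prod [HasFiniteLimits C] (x y : C) :
    IsPullback (prod.fst : x ⨯ y ⟶ x) prod.snd (terminal.from x) (terminal.from y) :=
  IsPullback.of_is_product' (prodIsProd x y) terminalIsTerminal

namespace IsFiber

variable {F : C ⥤ FintypeCat.Skeleton.{u}} (hF : IsFiber F)
include hF

lemma nonempty_terminal {t : C} (ht : IsTerminal t) : Nonempty (Elem (F.obj t)) :=
  ⟨(hF.terminal ht).choose⟩

lemma terminal_ext {t : C} (ht : IsTerminal t) (a b : Elem (F.obj t)) : a = b := by
  obtain ⟨c, hc⟩ := hF.terminal ht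
  rw [hc a, hc b]

lemma exists_prod [HasFiniteLimits C] {x y : C} (a : Elem (F.obj x)) (b : Elem (F.obj y)) :
    ∃ c, ap (F.map (prod.fst : x ⨯ y ⟶ x)) c = a ∧ ap (F.map (prod.snd : x ⨯ y ⟶ y)) c = b :=
  hF.pullback (isPullback_prod x y) (hF.terminal_ext terminalIsTerminal _ _)

lemma prod_ext [HasFiniteLimits C] {x y : C} {c d : Elem (F.obj (x ⨯ y))}
    (h₁ : ap (F.map (prod.fst : x ⨯ y ⟶ x)) c = ap (F.map (prod.fst : x ⨯ y ⟶ x)) d)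
    (h₂ : ap (F.map (prod.snd : x ⨯ y ⟶ y)) c = ap (F.map (prod.snd : x ⨯ y ⟶ y)) d) : c = d :=
  hF.pullback_ext (isPullback_prod x y) h₁ h₂

omit hF in
lemma ap_map_comp {x y z : C} (f : x ⟶ y) (g : y ⟶ z) (a : Elem (F.obj x)) :
    ap (F.map (f ≫ g)) a = ap (F.map g) (ap (F.map f) a) := by
  rw [F.map_comp, ap_comp]

omit hF in
lemma ap_map_id (x : C) (a : Elem (F.obj x)) : ap (F.map (𝟙 x)) a = a := by
  rw [F.map_id, ap_id]

omit hF in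
lemma ap_map_eq {x y z : C} {f : x ⟶ y} {g : y ⟶ z} {h : x ⟶ z} (w : f ≫ g = h)
    (a : Elem (F.obj x)) : ap (F.map g) (ap (F.map f) a) = ap (F.map h) a := by
  rw [← w, ap_map_comp]

end IsFiber

/-- Finitely many properties that hold locally for finite coproduct decompositions hold
simultaneously on the pieces of one decomposition. -/
lemma exists_coprod_refinement {ι : Type*} [Finite ι] (q : C)
    (R : ι → ∀ {t : C}, (t ⟶ q) → Prop)
    (stable : ∀ k {t t' : C} (f : t ⟶ q) (u : t' ⟶ t), R k f → R k (u ≫ f))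
    (dense : ∀ k {t : C} (f : t ⟶ q), ∃ (κ : Type) (_ : Finite κ) (t' : κ → C)
      (u : ∀ l, t' l ⟶ t), IsCoprod u ∧ ∀ l, R k (u l ≫ f)) :
    ∃ (κ : Type) (_ : Finite κ) (t : κ → C) (f : ∀ l, t l ⟶ q), IsCoprod f ∧
      ∀ k l, R k (f l) := by
  classical
  have := Fintype.ofFinite ι
  have (J : Finset ι) : ∃ (κ : Type) (_ : Finite κ) (t : κ → C) (f : ∀ l, t l ⟶ q), IsCoprod f ∧
      ∀ k ∈ J, ∀ l, R k (f l) := by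
    induction J using Finset.induction with
    | empty => exact ⟨Unit, inferInstance, fun _ => q, fun _ => 𝟙 q,
        .of_exists (fun g => ⟨g (), fun _ => Category.id_comp _⟩)
          (fun h => by simpa using h ()), by simp⟩
    | insert k J _ ih =>
      obtain ⟨κ, hκ, t, f, h, hf⟩ := ih
      choose κ' hκ' t' u hu hu' using fun l => dense k (f l)
      refine ⟨Σ l, κ' l, Finite.instSigma, fun l => t' l.1 l.2, fun l => u l.1 l.2 ≫ f l.1, h.trans hu,
        fun j hj l => ?_⟩
      obtain rfl | hj := Finset.mem_insert.1 hj
      · exact hu' _ _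
      · exact stable _ _ _ (hf j hj _)
  obtain ⟨κ, hκ, t, f, h, hf⟩ := this Finset.univ
  exact ⟨κ, hκ, t, f, h, fun k => hf k (Finset.mem_univ k)⟩

/-- The summands outside the image of `g` are initial, so they impose no condition on a map out of
`p`. -/
lemma IsCoprod.of_injective {ι κ : Type*} {x : ι → C} {p : C} {i : ∀ k, x k ⟶ p}
    (h : IsCoprod i) {g : κ → ι} (hg : Function.Injective g) {y : κ → C} (b : ∀ k, y k ⟶ x (g k))
    [∀ k, IsIso (b k)] (hi : ∀ l, (∀ k, g k ≠ l) → Nonempty (IsInitial (x l))) :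
    IsCoprod fun k => b k ≫ i (g k) := by
  refine .of_exists (fun {z} t => ?_) (fun {z f f'} hf => h.hom_ext fun l => ?_)
  · have (l : ι) : ∃ m : x l ⟶ z, ∀ k (hk : g k = l), b k ≫ eqToHom (by rw [hk]) ≫ m = t k := by
      by_cases hl : ∃ k, g k = l
      · obtain ⟨k, rfl⟩ := hl
        refine ⟨inv (b k) ≫ t k, fun k' hk' => ?_⟩
        obtain rfl := hg hk'
        simp
      · exact ⟨(hi l fun k hk => hl ⟨k, hk⟩).some.to z, fun k hk => (hl ⟨k, hk⟩).elim⟩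
    choose m hm using this
    exact ⟨h.desc m, fun k => by simpa using hm (g k) k rfl⟩
  · by_cases hl : ∃ k, g k = l
    · obtain ⟨k, rfl⟩ := hl
      simpa [cancel_epi] using hf k
    · exact (hi l fun k hk => hl ⟨k, hk⟩).some.hom_ext _ _

variable [HasFiniteLimits C]

/-- The sections `e` exhibit `x × p` as a finite coproduct of copies of `p`. -/
def IsSplitting {ι : Type} {p x : C} (e : ι → (p ⟶ x)) : Prop :=
  IsCoprod fun s => prod.lift (e s) (𝟙 p)

/-- A fiber functor turns the decomposition of `x ⨯ p` into a bijection between `F x × F p` and the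
disjoint union of copies of `F p` indexed by `ι`. The claim is its restriction to the fiber over
`a`. -/
lemma IsSplitting.bijective {ι : Type} [Finite ι] {p x : C} {e : ι → (p ⟶ x)} (he : IsSplitting e)
    {F : C ⥤ FintypeCat.Skeleton.{u}} (hF : IsFiber F) (a : Elem (F.obj p)) :
    Function.Bijective fun s => ap (F.map (e s)) a := by
  refine ⟨fun s s' h => ?_, fun b => ?_⟩
  · have h₁ : ap (F.map (prod.lift (e s) (𝟙 p))) a = ap (F.map (prod.lift (e s') (𝟙 p))) a := by
      refine hF.prod_ext ?_ ?_
      · rw [IsFiber.ap_map_eq (prod.lift_fst _ _), IsFiber.ap_map_eq (prod.lift_fst _ _)]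
        exact h
      · rw [IsFiber.ap_map_eq (prod.lift_snd _ _), IsFiber.ap_map_eq (prod.lift_snd _ _)]
    exact congrArg Sigma.fst (hF.coprod_ext he h₁)
  · obtain ⟨c, hc, hc'⟩ := hF.exists_prod b a
    obtain ⟨s, a', h⟩ := hF.coprod he c
    have h₁ := IsFiber.ap_map_eq (F := F) (prod.lift_snd (e s) (𝟙 p)) a'
    have h₂ := IsFiber.ap_map_eq (F := F) (prod.lift_fst (e s) (𝟙 p)) a'
    rw [h, hc', IsFiber.ap_map_id] at h₁
    rw [h, hc, ← h₁] at h₂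
    exact ⟨s, h₂.symm⟩

/-- The graph of `f ≫ e s` is the pullback of the graph of `e s` along `prod.map (𝟙 x) f`, and
finite coproducts are universal. -/
lemma IsSplitting.comp [FinitaryExtensive C] {ι : Type} [Finite ι] {p x : C} {e : ι → (p ⟶ x)}
    (he : IsSplitting e) {r : C} (f : r ⟶ p) : IsSplitting fun s => f ≫ e s := by
  refine IsCoprod.pullback he (prod.map (𝟙 x) f) (b := fun _ => f) fun s => ?_
  have : Mono (prod.lift (f ≫ e s) (𝟙 r)) := mono_of_mono_fac (prod.lift_snd _ _)
  refine isPullback_of_mono ?_ fun {t} v w h => ⟨v ≫ prod.snd, ?_, ?_⟩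
  · apply Limits.prod.hom_ext <;> simp
  · have h₁ := congrArg (· ≫ prod.fst) h
    have h₂ := congrArg (· ≫ prod.snd) h
    simp only [Category.assoc, prod.map_fst, prod.map_snd, Category.comp_id, prod.lift_fst,
      prod.lift_snd] at h₁ h₂
    apply Limits.prod.hom_ext
    · rw [Category.assoc, Category.assoc, prod.lift_fst, h₁, reassoc_of% h₂]
    · rw [Category.assoc, prod.lift_snd, Category.comp_id]
  · have h₂ := congrArg (· ≫ prod.snd) h
    simp only [Category.assoc, prod.map_snd, prod.lift_snd, Category.comp_id] at h₂
    simpa using h₂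

lemma IsCoprod.exists_lifts [FinitaryExtensive C] {ι : Type} [Finite ι] {x : ι → C} {p : C}
    {i : ∀ k, x k ⟶ p} (h : IsCoprod i) {t : C} (f : t ⟶ p) :
    ∃ (κ : Type) (_ : Finite κ) (t' : κ → C) (u : ∀ l, t' l ⟶ t), IsCoprod u ∧
      ∀ l, ∃ k v, u l ≫ f = v ≫ i k :=
  ⟨ι, inferInstance, _, _, h.pullback f fun k => IsPullback.of_hasPullback f (i k),
    fun k => ⟨k, _, pullback.condition⟩⟩

/-- A splitting of a coproduct, compatible with the decomposition, splits the summands. -/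
lemma IsSplitting.summand [FinitaryExtensive C] {ι : Type} [Finite ι] {κ : Type*} [Finite κ] {p z : C} {e : ι → (p ⟶ z)}
    (he : IsSplitting e) {x : κ → C} {i : ∀ k, x k ⟶ z} (h : IsCoprod i) {c : ι → κ}
    {l : ∀ s, p ⟶ x (c s)} (hl : ∀ s, l s ≫ i (c s) = e s) (k : κ) :
    IsSplitting fun s : {s // c s = k} => l s.1 ≫ eqToHom (congrArg x s.2) := by
  have h₁ := IsCoprod.pullback he (prod.map (i k) (𝟙 p)) fun s => IsPullback.of_hasPullback _ _
  -- For a section that lands in the summand `x k`, the part of its graph over `x k` is all of `p`;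
  -- `b s` is this identification.
  let b (s : {s // c s = k}) : p ⟶ pullback (prod.map (i k) (𝟙 p)) (prod.lift (e s.1) (𝟙 p)) :=
    pullback.lift (prod.lift (l s.1 ≫ eqToHom (congrArg x s.2)) (𝟙 p)) (𝟙 p) (by
      obtain ⟨s, rfl⟩ := s
      apply Limits.prod.hom_ext <;> simp [hl])
  have hb₁ (s : {s // c s = k}) : b s ≫ pullback.fst _ _ = prod.lift (l s.1 ≫ eqToHom (congrArg x s.2)) (𝟙 p) :=
    pullback.lift_fst _ _ _
  have hb₂ (s : {s // c s = k}) : b s ≫ pullback.snd _ _ = 𝟙 p := pullback.lift_snd _ _ _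
  have (s : {s // c s = k}) : IsIso (b s) := by
    have := h.mono k
    refine ⟨pullback.snd _ _, hb₂ s, ?_⟩
    ext1
    · rw [Category.assoc, hb₁, Category.id_comp]
      have hc := pullback.condition (f := prod.map (i k) (𝟙 p)) (g := prod.lift (e s.1) (𝟙 p))
      have hc₁ := congrArg (· ≫ prod.fst) hc
      have hc₂ := congrArg (· ≫ prod.snd) hc
      simp only [Category.assoc, prod.map_fst, prod.map_snd, Category.comp_id, prod.lift_fst,
        prod.lift_snd] at hc₁ hc₂
      apply Limits.prod.hom_ext
      · rw [← cancel_mono (i k), Category.assoc, Category.assoc, Category.assoc, hc₁,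
          prod.lift_fst_assoc]
        obtain ⟨s, rfl⟩ := s
        simp [hl]
      · rw [Category.assoc, prod.lift_snd, Category.comp_id, hc₂]
    · rw [Category.assoc, hb₂, Category.id_comp, Category.comp_id]
  -- A section landing in another summand meets `x k` in an initial object, by disjointness.
  have h₂ := h₁.of_injective Subtype.val_injective b fun s hs => by
    have hs' : c s ≠ k := fun h => hs ⟨s, h⟩ rfl
    refine h.isInitial_of_comp_eq hs' (u := pullback.snd _ _ ≫ l s)
      (v := pullback.fst (prod.map (i k) (𝟙 p)) (prod.lift (e s) (𝟙 p)) ≫ prod.fst) ?_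
    have hc := congrArg (· ≫ prod.fst)
      (pullback.condition (f := prod.map (i k) (𝟙 p)) (g := prod.lift (e s) (𝟙 p)))
    simp only [Category.assoc, prod.map_fst, prod.lift_fst] at hc
    rw [Category.assoc, Category.assoc, hl, hc]
  simp only [hb₁] at h₂
  exact h₂

/-- The object `p` splits the objects of `S` in such a way that the arrows in `T` become constant. -/
def Splits (S : Finset C) (T : Finset (Arr C)) (p : C) : Prop :=
  ∃ (n : C → Type) (_ : ∀ x, Finite (n x)) (e : ∀ x ∈ S, n x → (p ⟶ x)),
    (∀ x hx, IsSplitting (e x hx)) ∧ ∀ m ∈ T, ∀ hx hy s, ∃ s', e m.1 hx s ≫ m.2.2 = e m.2.1 hy s'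

end Splitting

/-! ### Covers splitting a finite subgraph. -/

section Cover

variable {C : Type u} [Category.{u} C] [IsGaloisCategory C]

/-- Every finite subgraph of a Galois category is split by the pieces of a cover of the terminal
object. -/
theorem exists_splitting_cover (S : Finset C) (T : Finset (Arr C)) :
    ∃ (κ : Type) (_ : Finite κ) (p : κ → C) (q : C) (i : ∀ k, p k ⟶ q), IsCoprod i ∧
      IsEffectiveDescent (terminal.from q) ∧ ∀ k, Splits S T (p k) := by
  classical
  -- Splitting the coproduct of all the objects of `S` provides one cover for all of them.
  obtain ⟨n, q, s, e, hq, he⟩ := IsGaloisCategory.exists_cover (∐ fun x : S => x.1)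
  have hS : IsCoprod _ := IsCoprod.sigma fun x : S => x.1
  have key (k : Fin n) : ∃ (κ : Type) (_ : Finite κ) (p : κ → C) (i : ∀ k', p k' ⟶ q k),
      IsCoprod i ∧ ∀ k', Splits S T (p k') := by
    -- Decompose the piece until every section of the coproduct lands in a single summand;
    -- `IsSplitting.summand` then splits each object of `S`.
    obtain ⟨κ, _, t, f, hf, H⟩ := exists_coprod_refinement (q k)
      (fun (a : Fin (s k)) {t} f => ∃ (x : S) (l : t ⟶ x.1), l ≫ Sigma.ι (fun x : S => x.1) x = f ≫ e k a)
      (fun a t t' f u ⟨x, l, h⟩ => ⟨x, u ≫ l, by simp [h]⟩)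
      (fun a t f => by
        have h := hS.reindex S.equivFin.symm
        obtain ⟨κ, _, t', u, hu, hu'⟩ := h.exists_lifts (f ≫ e k a)
        refine ⟨κ, inferInstance, t', u, hu, fun l => ?_⟩
        obtain ⟨k, v, hv⟩ := hu' l
        exact ⟨_, v, by rw [← hv, Category.assoc]⟩)
    choose c l hl using H
    have h₁ (j : κ) : ∃ (n : C → Type) (_ : ∀ x, Finite (n x)) (e : ∀ x ∈ S, n x → (t j ⟶ x)),
        ∀ x hx, IsSplitting (e x hx) := by
      have h₂ : IsSplitting fun s => f j ≫ e k s := IsSplitting.comp (he k) (f j)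
      exact ⟨fun x => {a // (c a j).1 = x}, inferInstance,
        fun x hx a => l a.1 j ≫ eqToHom a.2, fun x hx => by
          have := (h₂.summand hS (fun s => hl s j) ⟨x, hx⟩)
          refine IsCoprod.reindex this (Equiv.subtypeEquivRight fun a => Subtype.ext_iff.symm)⟩
    choose n' _ e' he' using h₁
    have h₂ (j : κ) : ∃ (κ' : Type) (_ : Finite κ') (p : κ' → C) (i : ∀ k', p k' ⟶ t j),
        IsCoprod i ∧ ∀ k', Splits S T (p k') := by
      -- A section followed by an arrow is a map to a split object; after a further decomposition it
      -- coincides with one of the sections of the target.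
      obtain ⟨κ', _, t', f', hf', H⟩ := exists_coprod_refinement (t j)
        (fun (m : Σ m : {m : T // m.1.1 ∈ S ∧ m.1.2.1 ∈ S}, n' j m.1.1.1) {r} f =>
          ∃ s', f ≫ e' j _ m.1.2.1 m.2 ≫ m.1.1.1.2.2 = f ≫ e' j _ m.1.2.2 s')
        (fun m r r' f u ⟨s', h⟩ => ⟨s', by simp [h]⟩)
        (fun m r f => by
          obtain ⟨κ, _, t', u, hu, hu'⟩ := IsCoprod.exists_lifts (he' j _ m.1.2.2)
            (prod.lift (f ≫ e' j _ m.1.2.1 m.2 ≫ m.1.1.1.2.2) f)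
          refine ⟨κ, inferInstance, t', u, hu, fun l => ?_⟩
          obtain ⟨k, v, hv⟩ := hu' l
          have h₁ := congrArg (· ≫ prod.fst) hv
          have h₂ := congrArg (· ≫ prod.snd) hv
          simp only [Category.assoc, prod.lift_fst, prod.lift_snd, Category.comp_id] at h₁ h₂
          exact ⟨k, by rw [Category.assoc, h₁, h₂]⟩)
      refine ⟨κ', inferInstance, t', f', hf', fun k' => ⟨n' j, inferInstance,
        fun x hx s => f' k' ≫ e' j x hx s, fun x hx => IsSplitting.comp (he' j x hx) _, ?_⟩⟩
      intro m hm hx hy s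
      obtain ⟨s', hs'⟩ := H ⟨⟨⟨m, hm⟩, hx, hy⟩, s⟩ k'
      exact ⟨s', by simpa using hs'⟩
    choose κ' _ p i hi hp using h₂
    exact ⟨Σ j, κ' j, inferInstance, _, _, hf.trans hi, fun j => hp _ _⟩
  choose κ _ p i hi hp using key
  exact ⟨Σ j, κ j, inferInstance, _, _, _, (IsCoprod.sigma q).trans hi, hq, fun j => hp _ _⟩

end Cover

/-! ### Joint conservativity and faithfulness of the fiber functors. -/

section Conservative

variable {C : Type u} [Category.{u} C] [IsGaloisCategory C]

lemma IsFiber.exists_elem {F : C ⥤ FintypeCat.Skeleton.{u}} (hF : IsFiber F) {q : C}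
    (hq : IsEffectiveDescent (terminal.from q)) : Nonempty (Elem (F.obj q)) := by
  obtain ⟨a⟩ := hF.nonempty_terminal terminalIsTerminal
  exact ⟨(hF.descent hq a).choose⟩

lemma IsCoprod.prodMap {ι : Type} [Finite ι] {p : ι → C} {q : C} {i : ∀ k, p k ⟶ q}
    (h : IsCoprod i) (x : C) : IsCoprod fun k => prod.map (𝟙 x) (i k) := by
  refine h.pullback prod.snd (b := fun k => prod.snd) fun k => ?_
  have := h.mono k
  refine isPullback_of_mono (prod.map_snd _ _) fun {t} v w hvw => ⟨prod.lift (v ≫ prod.fst) w, ?_, ?_⟩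
  · apply Limits.prod.hom_ext
    · rw [Category.assoc, prod.map_fst, prod.lift_fst_assoc, Category.comp_id]
    · rw [Category.assoc, prod.map_snd, prod.lift_snd_assoc, hvw]
  · exact prod.lift_snd _ _

/-- The fiber functors are jointly conservative. -/
theorem isIso_of_isFiber {x y : C} (f : x ⟶ y)
    (h : ∀ F : C ⥤ FintypeCat.Skeleton.{u}, IsFiber F → Function.Bijective (ap (F.map f))) :
    IsIso f := by
  classical
  obtain ⟨κ, _, p, q, i, hi, hq, hp⟩ := exists_splitting_cover {x, y} {⟨x, y, f⟩}
  have key (k : κ) : IsIso (prod.map f (𝟙 (p k))) := by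
    by_cases hk : Nonempty (IsInitial (p k))
    · obtain ⟨hk⟩ := hk
      have h₁ : IsInitial (x ⨯ p k) := hk.ofStrict prod.snd
      have h₂ : IsInitial (y ⨯ p k) := hk.ofStrict prod.snd
      exact isIso_of_isInitial h₁ h₂ _
    -- On a non-initial piece `f` acts by a function `φ` of index sets. An element `a` of the fiber
    -- of the piece identifies `φ` with the map on fibers, so a single fiber functor suffices to see
    -- that `φ` is bijective.
    · obtain ⟨F, hF, ⟨a⟩⟩ := exists_isFiber (W := p k) ⟨fun h => hk ⟨h⟩⟩
      obtain ⟨n, _, e, he, H⟩ := hp k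
      have hx : x ∈ ({x, y} : Finset C) := by simp
      have hy : y ∈ ({x, y} : Finset C) := by simp
      choose φ hφ using H ⟨x, y, f⟩ (by simp) hx hy
      have hφ' : Function.Bijective φ := by
        rw [← Function.Bijective.of_comp_iff' ((he y hy).bijective hF a)]
        convert (h F hF).comp ((he x hx).bijective hF a) using 1
        funext s
        exact (IsFiber.ap_map_eq (hφ s) a).symm
      refine IsCoprod.isIso (he x hx) (IsCoprod.reindex (he y hy) (Equiv.ofBijective φ hφ')) _
        fun s => ?_
      apply Limits.prod.hom_ext
      · rw [Category.assoc, prod.map_fst, prod.lift_fst_assoc, prod.lift_fst]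
        exact hφ s
      · rw [Category.assoc, prod.map_snd, prod.lift_snd_assoc, prod.lift_snd, Category.comp_id]
  have h₁ : IsIso (prod.map f (𝟙 q)) := by
    refine IsCoprod.isIso (hi.prodMap x) ((hi.prodMap y).of_injective Function.injective_id
      (fun k => prod.map f (𝟙 (p k))) fun l hl => (hl l rfl).elim) _ fun k => ?_
    simp
  have hx : IsPullback (prod.fst : x ⨯ q ⟶ x) prod.snd (f ≫ terminal.from y) (terminal.from q) := by
    rw [terminal.comp_from]
    exact isPullback_prod x q
  exact hq.isIso_of_isPullback f (prod.map f (𝟙 q)) hx (isPullback_prod y q) (prod.map_fst _ _)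
    (by rw [prod.map_snd, Category.comp_id])

/-- The fiber functors are jointly faithful. -/
theorem hom_ext_of_isFiber {x y : C} {f g : x ⟶ y}
    (h : ∀ F : C ⥤ FintypeCat.Skeleton.{u}, IsFiber F → ∀ a, ap (F.map f) a = ap (F.map g) a) :
    f = g := by
  -- The pullback of the diagonal is the equalizer of `f` and `g`; its inclusion in `x` is bijective
  -- on all fibers, hence an isomorphism.
  have hp := IsPullback.of_hasPullback (prod.lift f g) (prod.lift (𝟙 y) (𝟙 y))
  have h₁ := congrArg (· ≫ prod.fst) hp.w
  have h₂ := congrArg (· ≫ prod.snd) hp.w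
  simp only [Category.assoc, prod.lift_fst, prod.lift_snd, Category.comp_id] at h₁ h₂
  have : IsIso (pullback.fst (prod.lift f g) (prod.lift (𝟙 y) (𝟙 y))) := by
    refine isIso_of_isFiber _ fun F hF => ⟨fun a b hab => hF.pullback_ext hp hab ?_, fun a => ?_⟩
    · rw [← h₁, IsFiber.ap_map_comp, IsFiber.ap_map_comp, hab]
    · obtain ⟨b, hb, -⟩ := hF.pullback hp (u := a) (v := ap (F.map f) a) (hF.prod_ext
        (by simp only [IsFiber.ap_map_eq (prod.lift_fst _ _), IsFiber.ap_map_id])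
        (by simp only [IsFiber.ap_map_eq (prod.lift_snd _ _), IsFiber.ap_map_id, h F hF]))
      exact ⟨b, hb⟩
  rw [← cancel_epi (pullback.fst (prod.lift f g) (prod.lift (𝟙 y) (𝟙 y))), h₁, h₂]

end Conservative

/-! ### Coequalizers of locally constant pairs, and descent of coequalizers. -/

section ConstantPair

variable {D : Type u} [Category.{u} D]

lemma IsCoprod.map {D' : Type u} [Category.{u} D'] (G : D ⥤ D') [PreservesFiniteCoproducts G]
    {ι : Type} [Finite ι] {x : ι → D} {p : D} {i : ∀ k, x k ⟶ p} (h : IsCoprod i) :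
    IsCoprod fun k => G.map (i k) :=
  ⟨isColimitCofanMkObjOfIsColimit G _ _ h.some⟩

lemma IsCoprod.over {q : D} {ι : Type*} {x : ι → Over q} {p : Over q} {i : ∀ k, x k ⟶ p}
    (h : IsCoprod fun k => (i k).left) : IsCoprod i :=
  .of_exists (fun g => ⟨Over.homMk (h.desc fun k => (g k).left)
    (h.hom_ext fun k => (h.fac_assoc _ k _).trans ((Over.w (g k)).trans (Over.w (i k)).symm)), fun k => Over.OverMorphism.ext
      (h.fac _ k)⟩) fun hfg => Over.OverMorphism.ext (h.hom_ext fun k =>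
        congrArg CommaMorphism.left (hfg k))

/-- The cocone on a parallel pair given by a morphism out of its target. -/
def coconeOfMap {L : WalkingParallelPair ⥤ D} {q : D} (d : L.obj .one ⟶ q)
    (h : L.map .left ≫ d = L.map .right ≫ d) : Cocone L where
  pt := q
  ι := { app := fun | .zero => L.map .left ≫ d
                    | .one => d
         naturality := by
          rintro _ _ ⟨⟩
          · exact (Category.comp_id _).symm
          · exact h.symm.trans (Category.comp_id _).symm
          · exact (congrArg (· ≫ _) (L.map_id _)).trans ((Category.id_comp _).trans
              (Category.comp_id _).symm) }

/-- A parallel pair that is given by functions of finite sets on each of finitely many summands. -/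
structure ConstantPair (L : WalkingParallelPair ⥤ D) where
  κ : Type
  [finite_κ : Finite κ]
  p : κ → D
  A : κ → Type
  B : κ → Type
  [finite_A : ∀ k, Finite (A k)]
  [finite_B : ∀ k, Finite (B k)]
  φ (k : κ) : A k → B k
  ψ (k : κ) : A k → B k
  iA (s : Σ k, A k) : p s.1 ⟶ L.obj .zero
  iB (s : Σ k, B k) : p s.1 ⟶ L.obj .one
  isCoprod_iA : IsCoprod iA
  isCoprod_iB : IsCoprod iB
  left (k : κ) (a : A k) : iA ⟨k, a⟩ ≫ L.map .left = iB ⟨k, φ k a⟩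
  right (k : κ) (a : A k) : iA ⟨k, a⟩ ≫ L.map .right = iB ⟨k, ψ k a⟩

namespace ConstantPair

attribute [instance] finite_κ finite_A finite_B

variable {L : WalkingParallelPair ⥤ D} (c : ConstantPair L)

/-- The coequalizer of the functions of finite sets. -/
abbrev Q (k : c.κ) : Type := Quot fun b b' : c.B k => ∃ a, c.φ k a = b ∧ c.ψ k a = b'

/-- The image under a functor preserving finite coproducts. -/
def map {D' : Type u} [Category.{u} D'] (G : D ⥤ D') [PreservesFiniteCoproducts G] :
    ConstantPair (L ⋙ G) where
  κ := c.κ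
  p k := G.obj (c.p k)
  A := c.A
  B := c.B
  φ := c.φ
  ψ := c.ψ
  iA s := G.map (c.iA s)
  iB s := G.map (c.iB s)
  isCoprod_iA := c.isCoprod_iA.map G
  isCoprod_iB := c.isCoprod_iB.map G
  left k a := (G.map_comp _ _).symm.trans (congrArg G.map (c.left k a))
  right k a := (G.map_comp _ _).symm.trans (congrArg G.map (c.right k a))

/-- A cocone formed by the coequalizers of finite sets is a colimit. -/
lemma isColimit (s : Cocone L) (iQ : ∀ r : Σ k, c.Q k, c.p r.1 ⟶ s.pt) (hQ : IsCoprod iQ)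
    (h : ∀ k b, c.iB ⟨k, b⟩ ≫ s.ι.app .one = iQ ⟨k, Quot.mk _ b⟩) : Nonempty (IsColimit s) := by
  have H (t : Cocone L) (k : c.κ) (b b' : c.B k) (hb : ∃ a, c.φ k a = b ∧ c.ψ k a = b') :
      c.iB ⟨k, b⟩ ≫ t.ι.app .one = c.iB ⟨k, b'⟩ ≫ t.ι.app .one := by
    obtain ⟨a, rfl, rfl⟩ := hb
    rw [← c.left, ← c.right, Category.assoc, Category.assoc, t.w, t.w]
  refine ⟨{ desc := fun t => hQ.desc fun r => Quot.lift (fun b => c.iB ⟨r.1, b⟩ ≫ t.ι.app .one)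
              (H t r.1) r.2
            fac := fun t => ?_
            uniq := fun t m hm => hQ.hom_ext fun r => ?_ }⟩
  · have h₁ : s.ι.app .one ≫ (hQ.desc fun r => Quot.lift (fun b => c.iB ⟨r.1, b⟩ ≫ t.ι.app .one)
              (H t r.1) r.2) = t.ι.app .one :=
      c.isCoprod_iB.hom_ext fun ⟨k, b⟩ => by rw [← Category.assoc, h, hQ.fac]
    rintro ⟨⟩
    · rw [← s.w .left, ← t.w .left, Category.assoc, h₁]
    · exact h₁
  · obtain ⟨k, r⟩ := r
    induction r using Quot.ind with
    | mk b =>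
      exact ((congrArg (· ≫ m) (h k b).symm).trans ((Category.assoc _ _ _).trans
        (congrArg _ (hm .one)))).trans (hQ.fac (fun r => Quot.lift (fun b => c.iB ⟨r.1, b⟩ ≫ t.ι.app .one)
        (H t r.1) r.2) ⟨k, Quot.mk _ b⟩).symm

/-- The cocone formed by the coequalizers of finite sets. -/
noncomputable def cocone {q : D} {iQ : ∀ r : Σ k, c.Q k, c.p r.1 ⟶ q} (_ : IsCoprod iQ) : Cocone L :=
  coconeOfMap (c.isCoprod_iB.desc fun s => iQ ⟨s.1, Quot.mk _ s.2⟩)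
    (c.isCoprod_iA.hom_ext fun ⟨k, a⟩ => by
      rw [← Category.assoc, ← Category.assoc, c.left, c.right, IsCoprod.fac, IsCoprod.fac]
      exact congrArg (β := c.p k ⟶ q) (fun z : c.Q k => iQ ⟨k, z⟩) (Quot.sound ⟨a, rfl, rfl⟩))

lemma iB_cocone {q : D} {iQ : ∀ r : Σ k, c.Q k, c.p r.1 ⟶ q} (h : IsCoprod iQ) (k) (b) :
    c.iB ⟨k, b⟩ ≫ (c.cocone h).ι.app .one = iQ ⟨k, Quot.mk _ b⟩ :=
  IsCoprod.fac c.isCoprod_iB (fun s => iQ ⟨s.1, Quot.mk _ s.2⟩) ⟨k, b⟩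

lemma isColimit_cocone {q : D} {iQ : ∀ r : Σ k, c.Q k, c.p r.1 ⟶ q} (h : IsCoprod iQ) :
    Nonempty (IsColimit (c.cocone h)) :=
  c.isColimit (c.cocone h) iQ h (c.iB_cocone h)

/-- The coequalizer is computed on the index sets. A functor that preserves finite coproducts leaves
these sets unchanged, so it sends the colimit cocone to one of the same form. -/
lemma preservesColimit {q : D} {iQ : ∀ r : Σ k, c.Q k, c.p r.1 ⟶ q} (h : IsCoprod iQ)
    {D' : Type u} [Category.{u} D'] (G : D ⥤ D') [PreservesFiniteCoproducts G] :
    PreservesColimit L G :=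
  preservesColimit_of_preserves_colimit_cocone (c.isColimit_cocone h).some
    ((c.map G).isColimit (G.mapCocone (c.cocone h)) (fun r => G.map (iQ r)) (h.map G) fun k b =>
      (G.map_comp _ _).symm.trans (congrArg G.map (c.iB_cocone h k b))).some

end ConstantPair

end ConstantPair

section Coequalizer

variable {C : Type u} [Category.{u} C] [IsGaloisCategory C]

/-- The cover formed by the pieces of a cover of an object times a split object. -/
lemma IsSplitting.isCoprod_pullback {κ : Type} [Finite κ] {p : κ → C} {q : C} {i : ∀ k, p k ⟶ q}
    (hi : IsCoprod i) {x : C} {A : κ → Type} {e : ∀ k, A k → (p k ⟶ x)}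
    (he : ∀ k, IsSplitting (e k)) :
    IsCoprod fun s : Σ k, A k => (pullback.lift (e s.1 s.2) (i s.1) (terminal.hom_ext _ _) :
      p s.1 ⟶ pullback (terminal.from x) (terminal.from q)) := by
  have h₁ : IsCoprod fun s : Σ k, A k => prod.lift (e s.1 s.2) (𝟙 (p s.1)) ≫ prod.map (𝟙 x) (i s.1) :=
    (hi.prodMap x).trans he
  let m : x ⨯ q ≅ pullback (terminal.from x) (terminal.from q) :=
    (isPullback_prod x q).isoIsPullback _ _ (IsPullback.of_hasPullback _ _)
  refine h₁.of_iso m.hom fun s => ?_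
  apply pullback.hom_ext
  · rw [Category.assoc, IsPullback.isoIsPullback_hom_fst, pullback.lift_fst, Category.assoc,
      prod.map_fst, prod.lift_fst_assoc, Category.comp_id]
  · rw [Category.assoc, IsPullback.isoIsPullback_hom_snd, pullback.lift_snd, Category.assoc,
      prod.map_snd, prod.lift_snd_assoc, Category.id_comp]

lemma lift_comp_pullback_map_left {p q t : C} {f : q ⟶ t} {Y Z : Over t} (m : Y ⟶ Z) (u : p ⟶ Y.left)
    (v : p ⟶ q) (w : u ≫ Y.hom = v ≫ f) (w' : (u ≫ m.left) ≫ Z.hom = v ≫ f) :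
    (pullback.lift u v w : p ⟶ pullback Y.hom f) ≫ ((Over.pullback f).map m).left =
      pullback.lift (u ≫ m.left) v w' := by
  have h₁ : ((Over.pullback f).map m).left ≫ pullback.fst Z.hom f = pullback.fst Y.hom f ≫ m.left :=
    pullback.lift_fst _ _ _
  have h₂ : ((Over.pullback f).map m).left ≫ pullback.snd Z.hom f = pullback.snd Y.hom f :=
    pullback.lift_snd _ _ _
  apply pullback.hom_ext
  · exact (Category.assoc _ _ _).trans ((congrArg _ h₁).trans
      ((pullback.lift_fst_assoc _ _ _ _).trans (pullback.lift_fst _ _ _).symm))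
  · exact (Category.assoc _ _ _).trans ((congrArg _ h₂).trans
      ((pullback.lift_snd _ _ _).trans (pullback.lift_snd _ _ _).symm))

/-- A Galois category has coequalizers, and they are preserved by the fiber functors. -/
theorem exists_coequalizer {x y : C} (f g : x ⟶ y) :
    ∃ (z : C) (c : y ⟶ z) (w : f ≫ c = g ≫ c), Nonempty (IsColimit (Cofork.ofπ c w)) ∧
      ∀ F : C ⥤ FintypeCat.Skeleton.{u}, IsFiber F → Function.Surjective (ap (F.map c)) ∧
        ∀ u v, ap (F.map c) u = ap (F.map c) v →
          Relation.EqvGen (fun u v => ∃ a, ap (F.map f) a = u ∧ ap (F.map g) a = v) u v := by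
  classical
  obtain ⟨κ, _, p, q, i, hi, hq, hp⟩ := exists_splitting_cover {x, y} {⟨x, y, f⟩, ⟨x, y, g⟩}
  choose n hn e he H using hp
  have hx : x ∈ ({x, y} : Finset C) := by simp
  have hy : y ∈ ({x, y} : Finset C) := by simp
  choose φ hφ using fun k => H k ⟨x, y, f⟩ (by simp) hx hy
  choose ψ hψ using fun k => H k ⟨x, y, g⟩ (by simp) hx hy
  dsimp only at φ ψ hφ hψ
  let R : Over (⊤_ C) ⥤ Over q := Over.pullback (terminal.from q)
  let f' : Over.mk (terminal.from x) ⟶ Over.mk (terminal.from y) :=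
    Over.homMk f (terminal.hom_ext _ _)
  let g' : Over.mk (terminal.from x) ⟶ Over.mk (terminal.from y) :=
    Over.homMk g (terminal.hom_ext _ _)
  let K := parallelPair f' g'
  let iA (s : Σ k, n k x) : Over.mk (i s.1) ⟶ R.obj (Over.mk (terminal.from x)) :=
    Over.homMk (pullback.lift (e s.1 x hx s.2) (i s.1) (terminal.hom_ext _ _))
      (pullback.lift_snd _ _ _)
  let iB (s : Σ k, n k y) : Over.mk (i s.1) ⟶ R.obj (Over.mk (terminal.from y)) :=
    Over.homMk (pullback.lift (e s.1 y hy s.2) (i s.1) (terminal.hom_ext _ _))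
      (pullback.lift_snd _ _ _)
  -- After pullback to the cover `q`, the two arrows are the functions `φ k` and `ψ k` of index sets
  -- on each piece.
  let c : ConstantPair (K ⋙ R) :=
    { κ := κ
      p := fun k => Over.mk (i k)
      A := fun k => n k x
      B := fun k => n k y
      φ := φ
      ψ := ψ
      iA := iA
      iB := iB
      isCoprod_iA := IsCoprod.over (IsSplitting.isCoprod_pullback hi fun k => he k x hx)
      isCoprod_iB := IsCoprod.over (IsSplitting.isCoprod_pullback hi fun k => he k y hy)
      left := fun k a => Over.OverMorphism.ext ((lift_comp_pullback_map_left f' _ _ _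
        (terminal.hom_ext _ _)).trans (by congr 1; exact hφ k a))
      right := fun k a => Over.OverMorphism.ext ((lift_comp_pullback_map_left g' _ _ _
        (terminal.hom_ext _ _)).trans (by congr 1; exact hψ k a)) }
  let iQ (r : Σ k, c.Q k) : Over.mk (i r.1) ⟶
      Over.mk (Limits.Sigma.desc fun r : Σ k, c.Q k => i r.1) :=
    Over.homMk (Sigma.ι (fun r : Σ k, c.Q k => p r.1) r) (Limits.Sigma.ι_desc _ _)
  have hiQ : IsCoprod iQ := IsCoprod.over (IsCoprod.sigma fun r : Σ k, c.Q k => p r.1)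
  obtain ⟨_, hq'⟩ := id hq
  let : MonadicRightAdjoint R := ⟨_, Over.mapPullbackAdj (terminal.from q), hq'⟩
  have hR : PreservesFiniteCoproducts R := IsGaloisCategory.distributive _
  -- The left adjoint preserves colimits, and `R` preserves finite coproducts by distributivity. So
  -- the monad, and its square, preserve the coequalizer of the constant pair, which is what
  -- monadicity of `R` needs to create it.
  have hL : PreservesFiniteCoproducts (monadicLeftAdjoint R) :=
    have := (monadicAdjunction R).leftAdjoint_preservesColimits
    ⟨fun n => inferInstance⟩
  have hT : PreservesFiniteCoproducts (monadicLeftAdjoint R ⋙ R) := ⟨fun n => inferInstance⟩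
  have h₁ : PreservesColimit (K ⋙ R) (monadicLeftAdjoint R ⋙ R) := c.preservesColimit hiQ _
  have h₂ : PreservesColimit ((K ⋙ R) ⋙ monadicLeftAdjoint R ⋙ R) (monadicLeftAdjoint R ⋙ R) :=
    (c.map (monadicLeftAdjoint R ⋙ R)).preservesColimit (hiQ.map (monadicLeftAdjoint R ⋙ R)) _
  let : CreatesColimit K R := monadicCreatesColimitOfPreservesColimit R K
  have : HasColimit (K ⋙ R) := ⟨⟨c.cocone hiQ, (c.isColimit_cocone hiQ).some⟩⟩
  have : HasColimit K := hasColimit_of_created K R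
  have hπ := coequalizerIsCoequalizer f' g'
  let d : Over.mk (Limits.Sigma.desc fun r : Σ k, c.Q k => i r.1) ≅ R.obj (coequalizer f' g') :=
    (c.isColimit_cocone hiQ).some.coconePointUniqueUpToIso
    (isColimitOfPreserves R (colimit.isColimit K))
  let J (r : Σ k, c.Q k) : p r.1 ⟶ pullback (coequalizer f' g').hom (terminal.from q) :=
    (iQ r ≫ d.hom).left
  have hJ : IsCoprod J := by
    have h₁ : IsCoprod (fun r => iQ r ≫ d.hom) :=
      hiQ.of_iso d.hom fun k => rfl
    have h₂ : PreservesFiniteCoproducts (Over.forget q) := ⟨fun n => inferInstance⟩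
    exact h₁.map (Over.forget q)
  -- The pullback of the coequalizer is a coproduct of pieces indexed by classes of sections of `y`;
  -- on the class of `b`, the inclusion is the section `b` followed by the projection to the
  -- coequalizer.
  have hJ' (k b) : J ⟨k, Quot.mk _ b⟩ = pullback.lift (e k y hy b ≫ (coequalizer.π f' g').left) (i k)
      (terminal.hom_ext _ _) := by
    have h₁ := (c.isColimit_cocone hiQ).some.comp_coconePointUniqueUpToIso_hom
      (isColimitOfPreserves R (colimit.isColimit K)) .one
    have h₂ : iQ ⟨k, Quot.mk _ b⟩ ≫ d.hom = iB ⟨k, b⟩ ≫ R.map (coequalizer.π f' g') :=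
      (congrArg (· ≫ d.hom) (c.iB_cocone hiQ k b).symm).trans
        ((Category.assoc _ _ _).trans (congrArg _ h₁))
    exact (congrArg CommaMorphism.left h₂).trans (lift_comp_pullback_map_left _ _ _ _ _)
  have hw : f ≫ (coequalizer.π f' g').left = g ≫ (coequalizer.π f' g').left :=
    congrArg CommaMorphism.left (coequalizer.condition f' g')
  have hP := IsPullback.of_hasPullback (coequalizer f' g').hom (terminal.from q)
  refine ⟨_, (coequalizer.π f' g').left, hw,
    ⟨isColimitCoforkMapOfIsColimit (Over.forget _) _ (coequalizerIsCoequalizer f' g')⟩,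
    fun F hF => ⟨fun w => ?_, fun u v huv => ?_⟩⟩
  all_goals
    obtain ⟨a₀⟩ := hF.exists_elem hq
    obtain ⟨k, a, ha⟩ := hF.coprod hi a₀
  · obtain ⟨t, ht, -⟩ := hF.pullback hP (u := w) (v := a₀) (hF.terminal_ext terminalIsTerminal _ _)
    obtain ⟨⟨k', r⟩, a', ha'⟩ := hF.coprod hJ t
    obtain ⟨b, rfl⟩ := Quot.exists_rep r
    refine ⟨ap (F.map (e k' y hy b)) a', ?_⟩
    rw [← ht, ← ha', hJ', IsFiber.ap_map_eq (pullback.lift_fst _ _ _), IsFiber.ap_map_comp]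
  -- At the point `a` of a piece, elements of the fiber of `y` are sections. Two with the same image
  -- have the same class in `c.Q k`, so a chain of values of `φ k` and `ψ k` joins them; evaluation
  -- at `a` turns it into a chain in the fiber.
  · obtain ⟨b, rfl⟩ := ((he k y hy).bijective hF a).2 u
    obtain ⟨b', rfl⟩ := ((he k y hy).bijective hF a).2 v
    have h₃ : ap (F.map (J ⟨k, Quot.mk _ b⟩)) a = ap (F.map (J ⟨k, Quot.mk _ b'⟩)) a := by
      refine hF.pullback_ext hP ?_ ?_
      · rw [hJ', hJ', IsFiber.ap_map_eq (pullback.lift_fst _ _ _),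
          IsFiber.ap_map_eq (pullback.lift_fst _ _ _), IsFiber.ap_map_comp, IsFiber.ap_map_comp]
        exact huv
      · rw [hJ', hJ', IsFiber.ap_map_eq (pullback.lift_snd _ _ _),
          IsFiber.ap_map_eq (pullback.lift_snd _ _ _)]
    have h₄ := hF.coprod_ext hJ h₃
    simp only [Sigma.mk.injEq, heq_eq_eq, true_and] at h₄
    have h₅ := Quot.eqvGen_exact h₄.1
    clear h₃ h₄ huv
    induction h₅ with
    | rel b b' h =>
      obtain ⟨s, rfl, rfl⟩ := h
      exact .rel _ _ ⟨ap (F.map (e k x hx s)) a, IsFiber.ap_map_eq (hφ k s) a,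
        IsFiber.ap_map_eq (hψ k s) a⟩
    | refl b => exact .refl _
    | symm b b' _ ih => exact .symm _ _ ih
    | trans b b' b'' _ _ ih ih' => exact .trans _ _ _ ih ih'

end Coequalizer

/-! ### Universality of colimits, detected by conservative families of functors to types. -/

namespace CategoryTheory.Limits

section TypeColimits

variable {J : Type} [Category.{0} J]

/-- The relation on the elements of a diagram of types given by the transition maps. -/
def Types.Linked (F : J ⥤ Type u) (p q : Σ j, F.obj j) : Prop :=
  ∃ m : p.1 ⟶ q.1, F.map m p.2 = q.2

lemma Types.eqvGen_of_isColimit {F : J ⥤ Type u} {c : Cocone F} (hc : IsColimit c)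
    (p q : Σ j, F.obj j) (h : c.ι.app p.1 p.2 = c.ι.app q.1 q.2) :
    Relation.EqvGen (Types.Linked F) p q := by
  let s : Cocone F :=
    { pt := Quot (Types.Linked F)
      ι := { app := fun j => TypeCat.ofHom fun x => Quot.mk _ ⟨j, x⟩
             naturality := fun i j m => by
               ext x
               exact (Quot.sound (r := Types.Linked F) (a := ⟨i, x⟩) (b := ⟨j, F.map m x⟩)
                 ⟨m, rfl⟩).symm } }
  have hs (p : Σ j, F.obj j) : hc.desc s (c.ι.app p.1 p.2) = Quot.mk _ p :=
    ConcreteCategory.congr_hom (hc.fac s p.1) p.2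
  refine Quot.eqvGen_exact ?_
  rw [← hs, ← hs, h]

lemma Types.isColimit_of_eqvGen {F : J ⥤ Type u} {c : Cocone F}
    (hs : ∀ z : c.pt, ∃ p : Σ j, F.obj j, c.ι.app p.1 p.2 = z)
    (he : ∀ p q : Σ j, F.obj j, c.ι.app p.1 p.2 = c.ι.app q.1 q.2 →
      Relation.EqvGen (Types.Linked F) p q) : Nonempty (IsColimit c) := by
  choose σ hσ using hs
  have key (s : Cocone F) (p q : Σ j, F.obj j) (h : Relation.EqvGen (Types.Linked F) p q) :
      s.ι.app p.1 p.2 = s.ι.app q.1 q.2 := by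
    induction h with
    | rel p q h =>
      obtain ⟨m, h⟩ := h
      rw [← h]
      exact (ConcreteCategory.congr_hom (s.w m) p.2).symm
    | refl p => rfl
    | symm p q _ ih => exact ih.symm
    | trans p q r _ _ ih ih' => exact ih.trans ih'
  exact ⟨{
    desc := fun s => TypeCat.ofHom fun z => s.ι.app (σ z).1 (σ z).2
    fac := fun s j => by
      ext x
      exact key s _ ⟨j, x⟩ (he _ _ (hσ _))
    uniq := fun s m hm => by
      ext z
      change m z = s.ι.app (σ z).1 (σ z).2
      rw [← hm]
      exact congrArg m (hσ z).symm }⟩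

/-- Colimits of types are stable under pullback. -/
theorem Types.isUniversalColimit {F : J ⥤ Type u} {c : Cocone F} (hc : IsColimit c) :
    IsUniversalColimit c := by
  intro F' c' α f hα _ hp
  have hα' (p : Σ j, F'.obj j) : c.ι.app p.1 (α.app p.1 p.2) = f (c'.ι.app p.1 p.2) :=
    ConcreteCategory.congr_hom (NatTrans.congr_app hα p.1) p.2
  refine Types.isColimit_of_eqvGen (fun z => ?_) fun p q hpq => ?_
  · obtain ⟨j, x, hx⟩ := Types.jointly_surjective_of_isColimit hc (f z)
    obtain ⟨w, hw, -⟩ := Types.exists_of_isPullback (hp j) z x hx.symm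
    exact ⟨⟨j, w⟩, hw⟩
  -- The chain that links the images in `F` is lifted to `F'`. Equality of the images in `c.pt` is
  -- carried along because, in the transitive case, the intermediate element is lifted by the
  -- pullback property, which requires it.
  · have key (a b : Σ j, F.obj j) (h : Relation.EqvGen (Types.Linked F) a b) :
        c.ι.app a.1 a.2 = c.ι.app b.1 b.2 ∧
        ∀ (p : F'.obj a.1) (q : F'.obj b.1), α.app a.1 p = a.2 → α.app b.1 q = b.2 →
          c'.ι.app a.1 p = c'.ι.app b.1 q → Relation.EqvGen (Types.Linked F') ⟨a.1, p⟩ ⟨b.1, q⟩ := by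
      induction h with
      | rel a b h =>
        obtain ⟨m, h⟩ := h
        have h' (x) : c'.ι.app b.1 (F'.map m x) = c'.ι.app a.1 x :=
          ConcreteCategory.congr_hom (c'.w m) x
        have hn (x) : α.app b.1 (F'.map m x) = F.map m (α.app a.1 x) :=
          ConcreteCategory.congr_hom (α.naturality m) x
        refine ⟨?_, fun p q hp' hq' hpq => ?_⟩
        · rw [← h]
          exact (ConcreteCategory.congr_hom (c.w m) a.2).symm
        · refine .rel _ _ ⟨m, Types.ext_of_isPullback (hp b.1) ?_ ?_⟩
          · exact (h' p).trans hpq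
          · exact (hn p).trans ((congrArg (F.map m) hp').trans (h.trans hq'.symm))
      | refl a =>
        refine ⟨rfl, fun p q hp' hq' hpq => ?_⟩
        rw [Types.ext_of_isPullback (hp a.1) hpq (hp'.trans hq'.symm)]
        exact .refl _
      | symm a b _ ih => exact ⟨ih.1.symm, fun p q hp' hq' h => .symm _ _ (ih.2 q p hq' hp' h.symm)⟩
      | trans a b d _ _ ih ih' =>
        refine ⟨ih.1.trans ih'.1, fun p q hp' hq' hpq => ?_⟩
        obtain ⟨r, hr, hr'⟩ := Types.exists_of_isPullback (hp b.1) (c'.ι.app a.1 p) b.2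
          ((hα' ⟨a.1, p⟩).symm.trans ((congrArg (c.ι.app a.1) hp').trans ih.1))
        exact .trans _ _ _ (ih.2 p r hp' hr' hr.symm) (ih'.2 r q hr' hq' (hr.trans hpq))
    refine (key ⟨p.1, α.app p.1 p.2⟩ ⟨q.1, α.app q.1 q.2⟩
      (Types.eqvGen_of_isColimit hc _ _ ?_)).2 p.2 q.2 rfl rfl hpq
    exact (hα' p).trans ((congrArg f hpq).trans (hα' q).symm)

/-- Colimits in a category are stable under pullback if they are preserved by a jointly conservative
family of functors to types, which also preserve pullbacks. -/
theorem isUniversalColimit_of_jointlyReflectIsomorphisms {C : Type*} [Category* C]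
    [HasColimitsOfShape J C] {I : Type*} {G : I → C ⥤ Type u} (hG : JointlyReflectIsomorphisms G)
    [∀ i, PreservesColimitsOfShape J (G i)] [∀ i, PreservesLimitsOfShape WalkingCospan (G i)]
    {F : J ⥤ C} {c : Cocone F} (hc : IsColimit c) : IsUniversalColimit c := by
  intro F' c' α f hα he hp
  refine ⟨hG.jointlyReflectsColimit fun i => (Types.isUniversalColimit
    (isColimitOfPreserves (G i) hc) ((G i).mapCocone c') (Functor.whiskerRight α (G i))
    ((G i).map f) ?_ ?_ ?_).some⟩
  · ext j : 2
    exact ((G i).map_comp _ _).symm.trans ((congrArg (G i).map (NatTrans.congr_app hα j)).trans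
      ((G i).map_comp _ _))
  · intro j j' m
    exact (he m).map (G i)
  · exact fun j => (hp j).map (G i)

end TypeColimits

section Universal

variable {J : Type} [Category.{0} J] {C : Type*} [Category* C] [HasPullbacks C]

/-- The diagram of pullbacks of the legs of a cocone. -/
noncomputable def Cocone.pullbackDiagram {F : J ⥤ C} (c : Cocone F) {z : C} (f : z ⟶ c.pt) : J ⥤ C where
  obj j := pullback f (c.ι.app j)
  map {i j} m := pullback.lift (pullback.fst _ _) (pullback.snd _ _ ≫ F.map m)
    (by rw [Category.assoc, c.w, pullback.condition])
  map_id j := by apply pullback.hom_ext <;> simp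
  map_comp m n := by
    apply pullback.hom_ext <;> simp only [Category.assoc, pullback.lift_fst, pullback.lift_snd,
      pullback.lift_snd_assoc, Functor.map_comp]

/-- The pullback of a cocone along a morphism to its point. -/
noncomputable def Cocone.pullback {F : J ⥤ C} (c : Cocone F) {z : C} (f : z ⟶ c.pt) :
    Cocone (c.pullbackDiagram f) where
  pt := z
  ι := { app := fun _ => pullback.fst _ _
         naturality := fun _ _ _ => (pullback.lift_fst _ _ _).trans (Category.comp_id _).symm }

theorem _root_.CategoryTheory.IsUniversalColimit.pullback {F : J ⥤ C} {c : Cocone F} (hc : IsUniversalColimit c) {z : C}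
    (f : z ⟶ c.pt) : Nonempty (IsColimit (c.pullback f)) := by
  have h (j) : IsPullback ((c.pullback f).ι.app j) (pullback.snd f (c.ι.app j)) f (c.ι.app j) :=
    IsPullback.of_hasPullback _ _
  let α : c.pullbackDiagram f ⟶ F := ⟨fun _ => pullback.snd _ _, fun _ _ _ => pullback.lift_snd _ _ _⟩
  refine hc _ α f ?_ ?_ h
  · ext j
    exact pullback.condition.symm
  · intro i j m
    have h₁ : (c.pullbackDiagram f).map m ≫ pullback.fst f (c.ι.app j) = pullback.fst f (c.ι.app i) :=
      pullback.lift_fst _ _ _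
    refine IsPullback.flip (IsPullback.of_bot (v₂₁ := pullback.fst f (c.ι.app j)) ?_
      (α.naturality m).symm (h j).flip)
    rw [c.w, h₁]
    exact (h i).flip

/-- Pullback preserves universal colimits. -/
theorem preservesColimitsOfShape_overPullback (hJ : ∀ {F : J ⥤ C} {c : Cocone F}, IsColimit c →
    IsUniversalColimit c) [HasColimitsOfShape J C] {x y : C} (f : y ⟶ x) : PreservesColimitsOfShape J (Over.pullback f) where
  preservesColimit {K} := ⟨fun {c} hc => by
    have hc' := isColimitOfPreserves (Over.forget x) hc
    let c' := (Over.forget y).mapCocone ((Over.pullback f).mapCocone c)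
    let α : (K ⋙ Over.pullback f) ⋙ Over.forget y ⟶ K ⋙ Over.forget x :=
      ⟨fun j => pullback.fst (K.obj j).hom f, fun i j m => pullback.lift_fst _ _ _⟩
    have h {a b : Over x} (m : a ⟶ b) : IsPullback ((Over.pullback f).map m).left
      (pullback.fst a.hom f) (pullback.fst b.hom f) m.left := by
      refine IsPullback.of_right (h₁₂ := pullback.snd b.hom f) (v₁₃ := f) (h₂₂ := b.hom) ?_
        (pullback.lift_fst _ _ _) (IsPullback.of_hasPullback _ _).flip
      have h₁ : ((Over.pullback f).map m).left ≫ pullback.snd b.hom f = pullback.snd a.hom f :=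
        pullback.lift_snd _ _ _
      rw [h₁, Over.w]
      exact (IsPullback.of_hasPullback _ _).flip
    refine ⟨isColimitOfReflects (Over.forget y)
      (hJ hc' c' α (pullback.fst c.pt.hom f) ?_ ?_ fun j => h (c.ι.app j)).some⟩
    · ext j
      exact (h (c.ι.app j)).w.symm
    · intro i j m
      exact h (K.map m)⟩

end Universal

end CategoryTheory.Limits

/-! ### Beck's theorem: regular epimorphisms are effective descent morphisms. -/

section Beck

variable {C : Type u} [Category.{u} C] [HasPullbacks C] [HasCoequalizers C]

lemma isRegularEpi_of_isColimit {C : Type*} [Category* C] {F : WalkingParallelPair ⥤ C} {c : Cocone F} (hc : IsColimit c) :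
    IsRegularEpi (c.ι.app .one) :=
  ⟨⟨{ W := F.obj .zero
      left := F.map .left
      right := F.map .right
      w := (c.w WalkingParallelPairHom.left).trans (c.w WalkingParallelPairHom.right).symm
      isColimit := IsColimit.ofIsoColimit ((IsColimit.precomposeInvEquiv
        (diagramIsoParallelPair F) c).symm hc) (Cofork.ext (Iso.refl _) (by
          dsimp [Cofork.π]; simp)) }⟩⟩

/-- Beck's theorem: if coequalizers are stable under pullback, regular epimorphisms are effective
descent morphisms. -/
theorem isEffectiveDescent_of_isRegularEpi (huniv : ∀ {F : WalkingParallelPair ⥤ C} {c : Cocone F},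
    IsColimit c → IsUniversalColimit c) {x y : C} (f : y ⟶ x) [IsRegularEpi f] :
    IsEffectiveDescent f := by
  have hf (z : C) (g : z ⟶ x) : IsRegularEpi (pullback.fst g f) :=
    isRegularEpi_of_isColimit ((huniv (IsRegularEpi.isColimit f)).pullback g).some
  have : PreservesColimitsOfShape WalkingParallelPair (Over.pullback f) :=
    preservesColimitsOfShape_overPullback huniv f
  have : (Over.pullback f).Faithful :=
    have (z : C) (g : z ⟶ x) : Epi (pullback.fst g f) := inferInstance
    inferInstance
  -- If `m` becomes invertible, it is a monomorphism because a faithful functor reflects these. It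
  -- is also a strong epimorphism, since composed with the projection of `a` it is an isomorphism
  -- followed by a regular epimorphism.
  have : (Over.pullback f).ReflectsIsomorphisms := ⟨fun {a b} m hm => by
    have : Mono m := (Over.pullback f).mono_of_mono_map (inferInstance : Mono _)
    have hm' : IsIso ((Over.pullback f).map m).left :=
      inferInstanceAs (IsIso ((Over.forget y).map ((Over.pullback f).map m)))
    have h₁ : pullback.fst a.hom f ≫ m.left = ((Over.pullback f).map m).left ≫ pullback.fst b.hom f :=
      (pullback.lift_fst _ _ _).symm
    have : StrongEpi (((Over.pullback f).map m).left ≫ pullback.fst b.hom f) :=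
      strongEpi_comp _ _
    have : StrongEpi (pullback.fst a.hom f ≫ m.left) := by rwa [h₁]
    have : StrongEpi m.left := strongEpi_of_strongEpi (pullback.fst a.hom f) _
    have : IsIso m.left := isIso_of_mono_of_strongEpi _
    have : IsIso ((Over.forget x).map m) := this
    exact isIso_of_reflects_iso m (Over.forget x)⟩
  have : Monad.HasCoequalizerOfIsSplitPair (Over.pullback f) := ⟨fun _ _ _ => inferInstance⟩
  have : Monad.PreservesColimitOfIsSplitPair (Over.pullback f) := ⟨fun _ _ _ => inferInstance⟩
  exact ⟨inferInstance, (Monad.monadicOfHasPreservesGSplitCoequalizersOfReflectsIsomorphisms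
    (Over.mapPullbackAdj f)).eqv⟩

end Beck

/-! ### Exactness of the fiber functors, and regular epimorphisms in Galois categories. -/

namespace FintypeCat.Skeleton

/-- The functor taking a finite set to its type of elements. -/
def toType : FintypeCat.Skeleton.{u} ⥤ Type u where
  obj S := Elem S
  map f := TypeCat.ofHom (ap f)

/-- The elements functor factors through the category of finite types. -/
def inclForget : incl.{u} ⋙ forget FintypeCat ≅ toType.{u} := Iso.refl _

instance : PreservesFiniteLimits toType.{u} :=
  preservesFiniteLimits_of_natIso inclForget

instance : PreservesFiniteColimits toType.{u} :=
  preservesFiniteColimits_of_natIso inclForget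

instance : toType.{u}.ReflectsIsomorphisms := ⟨fun f _ =>
  isIso_of_bijective f ((CategoryTheory.isIso_iff_bijective (toType.map f)).1 inferInstance)⟩

instance : HasFiniteLimits FintypeCat.Skeleton.{u} := ⟨fun _ _ _ =>
  Adjunction.hasLimitsOfShape_of_equivalence incl⟩

instance : HasFiniteColimits FintypeCat.Skeleton.{u} := ⟨fun _ _ _ =>
  Adjunction.hasColimitsOfShape_of_equivalence incl⟩

end FintypeCat.Skeleton

section Galois

variable {C : Type u} [Category.{u} C]

lemma IsFiber.preservesPullbacks {F : C ⥤ FintypeCat.Skeleton.{u}} (hF : IsFiber F) :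
    PreservesLimitsOfShape WalkingCospan (F ⋙ toType) := by
  suffices ∀ {a b x : C} (f : a ⟶ x) (g : b ⟶ x), PreservesLimit (cospan f g) (F ⋙ toType) from
    ⟨fun {K} => preservesLimit_of_iso_diagram _ (diagramIsoCospan K).symm⟩
  intro a b x f g
  refine ⟨fun {c} hc => ?_⟩
  have h : IsPullback (PullbackCone.fst c) (PullbackCone.snd c) f g := IsPullback.of_isLimit hc
  have h' : IsPullback ((F ⋙ toType).map (PullbackCone.fst c))
      ((F ⋙ toType).map (PullbackCone.snd c)) ((F ⋙ toType).map f) ((F ⋙ toType).map g) :=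
    (Types.isPullback_iff _ _ _ _).2 ⟨by rw [← Functor.map_comp, h.w, Functor.map_comp],
      fun _ _ h₁ => hF.pullback_ext h h₁.1 h₁.2, fun _ _ h₁ => hF.pullback h h₁⟩
  exact ⟨(PullbackCone.isLimitMapConeEquiv c (F ⋙ toType)).symm h'.isLimit⟩

variable [IsGaloisCategory C]

instance : HasCoequalizers C :=
  have {x y : C} {f g : x ⟶ y} : HasColimit (parallelPair f g) := by
    obtain ⟨z, c, w, ⟨h⟩, -⟩ := exists_coequalizer f g
    exact ⟨⟨_, h⟩⟩
  hasCoequalizers_of_hasColimit_parallelPair C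

lemma IsFiber.preservesCoequalizers {F : C ⥤ FintypeCat.Skeleton.{u}} (hF : IsFiber F) :
    PreservesColimitsOfShape WalkingParallelPair (F ⋙ toType) := by
  suffices ∀ {x y : C} (f g : x ⟶ y), PreservesColimit (parallelPair f g) (F ⋙ toType) from
    ⟨fun {K} => preservesColimit_of_iso_diagram _ (diagramIsoParallelPair K).symm⟩
  intro x y f g
  obtain ⟨z, c, w, ⟨h⟩, h'⟩ := exists_coequalizer f g
  obtain ⟨hs, he⟩ := h' F hF
  refine preservesColimit_of_preserves_colimit_cocone h (Nonempty.some ?_)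
  let K := parallelPair f g ⋙ F ⋙ toType
  have key (p : Σ j, K.obj j) : ∃ b : Elem (F.obj y),
      Relation.EqvGen (Types.Linked K) p ⟨.one, b⟩ ∧
        ((F ⋙ toType).mapCocone (Cofork.ofπ c w)).ι.app p.1 p.2 = ap (F.map c) b := by
    obtain ⟨_ | _, b⟩ := p
    · exact ⟨ap (F.map f) b, .rel _ _ ⟨.left, rfl⟩, IsFiber.ap_map_comp f c b⟩
    · exact ⟨b, .refl _, rfl⟩
  refine Types.isColimit_of_eqvGen (fun b => ?_) fun p q hpq => ?_
  · obtain ⟨a, ha⟩ := hs b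
    exact ⟨⟨.one, a⟩, ha⟩
  · obtain ⟨b, hb, hb'⟩ := key p
    obtain ⟨d, hd, hd'⟩ := key q
    refine .trans _ _ _ hb (.trans _ _ _ ?_ (.symm _ _ hd))
    have hbd := he b d (hb'.symm.trans (hpq.trans hd'))
    clear hb hb' hd hd'
    induction hbd with
    | rel b d h =>
      obtain ⟨a, rfl, rfl⟩ := h
      exact .trans _ ⟨.zero, a⟩ _ (.symm _ _ (.rel _ _ ⟨.left, rfl⟩)) (.rel _ _ ⟨.right, rfl⟩)
    | refl b => exact .refl _
    | symm b d _ ih => exact .symm _ _ ih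
    | trans b d e _ _ ih ih' => exact .trans _ _ _ ih ih'

lemma jointlyReflectIsomorphisms_isFiber : JointlyReflectIsomorphisms
    (fun F : {F : C ⥤ FintypeCat.Skeleton.{u} // IsFiber F} => F.1 ⋙ toType) := ⟨fun f _ =>
  isIso_of_isFiber f fun F hF =>
    have : IsIso ((F ⋙ toType).map f) :=
     (inferInstance : ∀ (F : {F : C ⥤ FintypeCat.Skeleton.{u} // IsFiber F}),
       IsIso ((F.1 ⋙ toType).map f)) ⟨F, hF⟩
    (CategoryTheory.isIso_iff_bijective ((F ⋙ toType).map f)).1 this⟩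

/-- Coequalizers are universal for sets, and the fiber functors preserve coequalizers and pullbacks
and are jointly conservative. -/
lemma isUniversalColimit_coequalizer {F : WalkingParallelPair ⥤ C} {c : Cocone F}
    (hc : IsColimit c) : IsUniversalColimit c :=
  have (F : {F : C ⥤ FintypeCat.Skeleton.{u} // IsFiber F}) := F.2.preservesCoequalizers
  have (F : {F : C ⥤ FintypeCat.Skeleton.{u} // IsFiber F}) := F.2.preservesPullbacks
  isUniversalColimit_of_jointlyReflectIsomorphisms jointlyReflectIsomorphisms_isFiber hc

/-- Compare `x` with the coequalizer of the kernel pair of `f`. On each fiber the comparison is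
injective because the kernel pair is preserved, and surjective because `f` is, so it is an
isomorphism. -/
lemma isRegularEpi_of_isFiber {x y : C} (f : y ⟶ x)
    (h : ∀ F : C ⥤ FintypeCat.Skeleton.{u}, IsFiber F → Function.Surjective (ap (F.map f))) :
    IsRegularEpi f := by
  obtain ⟨z, c, w, ⟨hc⟩, H⟩ := exists_coequalizer (pullback.fst f f) (pullback.snd f f)
  let m : z ⟶ x := Cofork.IsColimit.desc hc f pullback.condition
  have hm : c ≫ m = f := Cofork.IsColimit.π_desc' hc f pullback.condition
  have : IsIso m := by
    refine isIso_of_isFiber m fun F hF => ⟨fun u v huv => ?_, fun u => ?_⟩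
    · obtain ⟨u, rfl⟩ := (H F hF).1 u
      obtain ⟨v, rfl⟩ := (H F hF).1 v
      rw [IsFiber.ap_map_eq hm, IsFiber.ap_map_eq hm] at huv
      obtain ⟨t, rfl, rfl⟩ := hF.pullback (IsPullback.of_hasPullback f f) huv
      rw [IsFiber.ap_map_eq w, IsFiber.ap_map_comp]
    · obtain ⟨t, rfl⟩ := h F hF u
      exact ⟨ap (F.map c) t, IsFiber.ap_map_eq hm t⟩
  exact ⟨⟨{ W := _, left := pullback.fst f f, right := pullback.snd f f, w := pullback.condition
            isColimit := hc.ofIsoColimit (Cofork.ext (asIso m) hm) }⟩⟩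

/-- This replaces the monadicity condition by one that any functor preserving coequalizers respects,
and that can be tested on fibers. -/
lemma isEffectiveDescent_iff_isRegularEpi {x y : C} (f : y ⟶ x) :
    IsEffectiveDescent f ↔ IsRegularEpi f :=
  ⟨fun h => isRegularEpi_of_isFiber f fun _ hF => hF.descent h,
    fun _ => isEffectiveDescent_of_isRegularEpi isUniversalColimit_coequalizer f⟩

/-- A functor between Galois categories preserving finite limits, finite coproducts and coequalizers
is a functor of Galois categories. -/
lemma IsGaloisFunctor.of_preserves {D : Type u} [Category.{u} D] [IsGaloisCategory D] (G : C ⥤ D)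
    [PreservesFiniteLimits G] [PreservesFiniteCoproducts G]
    [PreservesColimitsOfShape WalkingParallelPair G] : IsGaloisFunctor G where
  preservesFiniteLimits := inferInstance
  preservesFiniteCoproducts := inferInstance
  map_isEffectiveDescent f hf := by
    rw [isEffectiveDescent_iff_isRegularEpi] at hf ⊢
    exact isRegularEpi_of_isColimit (isColimitOfPreserves G (IsRegularEpi.isColimit f))

end Galois

lemma CategoryTheory.comp_square {C : Type*} [Category* C] {a b a' b' a'' b'' : C} {f : a ⟶ b} {p : a ⟶ a'}
    {q : b ⟶ b'} {g : a' ⟶ b'} {p' : a' ⟶ a''} {q' : b' ⟶ b''} {h : a'' ⟶ b''}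
    (e : f ≫ q = p ≫ g) (e' : g ≫ q' = p' ≫ h) : f ≫ q ≫ q' = (p ≫ p') ≫ h := by
  rw [reassoc_of% e, e', Category.assoc]

lemma CategoryTheory.comp_eq_of_square {C : Type*} [Category* C] {a b w w' a' b' : C} {f : a ⟶ b}
    {s : b ⟶ w} {φ : a ⟶ w} (h : f ≫ s = φ) {t : w ⟶ w'} {tb : b ⟶ b'} {β : b' ⟶ w'}
    (h₂ : s ≫ t = tb ≫ β) {ta : a ⟶ a'} {α : a' ⟶ w'} (h₃ : φ ≫ t = ta ≫ α) {β' : w' ⟶ b'}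
    (h₄ : β ≫ β' = 𝟙 _) {γ : a' ⟶ b'} (h₅ : γ = α ≫ β') {ta' : a ⟶ a'} (h₆ : ta' = ta)
    {tb' : b ⟶ b'} (h₇ : tb' = tb) : f ≫ tb' = ta' ≫ γ := by
  subst h h₅ h₆ h₇
  rw [← Category.assoc ta', ← h₃, Category.assoc, Category.assoc, reassoc_of% h₂, h₄,
    Category.comp_id]

/-! ### Calculus of fractions in the filtered 2-colimit. -/

namespace ProfiniteGroupoid

variable {X : ProfiniteGroupoid.{u}} {E : Type u} [Category.{u} E]

namespace El

instance : (El.cocart X E).IsMultiplicative where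
  id_mem p := inferInstanceAs (IsIso (Functor.whiskerRight (X.trId p.idx).hom p.fib))
  comp_mem f g (hf : IsIso f.fiber) (hg : IsIso g.fiber) := by
    have h : IsIso (Functor.whiskerLeft (X.tr g.base) f.fiber) := inferInstance
    exact IsIso.comp_isIso' (inferInstanceAs (IsIso (Functor.whiskerRight (X.trComp g.base f.base).hom _)))
      (IsIso.comp_isIso' h hg)

/-- Cocartesian morphisms have the lifting property. -/
lemma exists_comp_eq {r p w : El X E} (s : r ⟶ p) (hs : IsIso s.fiber) (c : w.idx ⟶ p.idx)
    (g : r ⟶ w) (hg : g.base = c ≫ s.base) : ∃ ψ : p ⟶ w, ψ.base = c ∧ s ≫ ψ = g := by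
  obtain ⟨k, W⟩ := w
  obtain ⟨b, γ⟩ := g
  obtain rfl : b = c ≫ s.base := hg
  refine ⟨⟨c, Functor.whiskerLeft (X.tr c) (inv s.fiber) ≫
    Functor.whiskerRight (X.trComp c s.base).inv r.fib ≫ γ⟩, rfl, Hom.ext_fiber fun x => ?_⟩
  change r.fib.map ((X.trComp c s.base).hom.app x) ≫ s.fiber.app ((X.tr c).obj x) ≫
    (inv s.fiber).app ((X.tr c).obj x) ≫ r.fib.map ((X.trComp c s.base).inv.app x) ≫ γ.app x = _
  have h : s.fiber.app ((X.tr c).obj x) ≫ (inv s.fiber).app ((X.tr c).obj x) = 𝟙 _ := by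
    rw [← NatTrans.comp_app, IsIso.hom_inv_id, NatTrans.id_app]
  have h' : r.fib.map ((X.trComp c s.base).hom.app x) ≫ r.fib.map ((X.trComp c s.base).inv.app x) =
      𝟙 _ := by
    rw [← Functor.map_comp, Iso.hom_inv_id_app]
    exact r.fib.map_id _
  rw [reassoc_of% h]
  exact (Category.assoc _ _ _).symm.trans ((congrArg (· ≫ γ.app x) h').trans (Category.id_comp _))

lemma eq_of_comp_eq {r p w : El X E} (s : r ⟶ p) (hs : IsIso s.fiber) {ψ ψ' : p ⟶ w}
    (hb : ψ.base = ψ'.base) (h : s ≫ ψ = s ≫ ψ') : ψ = ψ' := by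
  obtain ⟨k, W⟩ := w
  obtain ⟨c, α⟩ := ψ
  obtain ⟨c', β⟩ := ψ'
  obtain rfl : c = c' := hb
  have h₁ := eq_of_heq (Hom.mk.inj h).2
  have h₂ : IsIso (Functor.whiskerLeft (X.tr c) s.fiber) := inferInstance
  rw [cancel_epi] at h₁
  have h₃ : α = β := (cancel_epi (Functor.whiskerLeft (X.tr c) s.fiber)).1 h₁
  rw [h₃]

/-- Cofilteredness of the indices supplies an index at which the two base maps agree. There the
lifting property of cocartesian morphisms completes the square, and cocartesian morphisms can be
cancelled. -/
instance : (El.cocart X E).HasLeftCalculusOfFractions where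
  exists_leftFraction p q φ := by
    let c := IsCofiltered.minToLeft p.idx q.idx
    let d := IsCofiltered.minToRight p.idx q.idx
    let e := IsCofiltered.eqHom (c ≫ φ.s.base) (d ≫ φ.f.base)
    have he : e ≫ c ≫ φ.s.base = e ≫ d ≫ φ.f.base := IsCofiltered.eq_condition _ _
    let t := trans (e ≫ d) q.fib
    obtain ⟨ψ, -, h⟩ := exists_comp_eq φ.s φ.hs (e ≫ c) (φ.f ≫ t)
      ((Category.assoc e d φ.f.base).trans (he.symm.trans (Category.assoc _ _ _).symm))
    exact ⟨⟨ψ, t, inferInstanceAs (IsIso (𝟙 (X.tr (e ≫ d) ⋙ q.fib)))⟩, h.symm⟩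
  ext r p q f₁ f₂ s hs h := by
    let e := IsCofiltered.eqHom f₁.base f₂.base
    refine ⟨_, trans e q.fib, inferInstanceAs (IsIso (𝟙 (X.tr e ⋙ q.fib))),
      eq_of_comp_eq s hs (IsCofiltered.eq_condition _ _) ?_⟩
    rw [← Category.assoc, h, Category.assoc]

lemma eq_trans_vert {k l : X.Idx} {F : X.cat k ⥤ E} {W : X.cat l ⥤ E}
    (f : (⟨k, F⟩ : El X E) ⟶ ⟨l, W⟩) {a : l ⟶ k} (h : f.base = a) :
    ∃ α : X.tr a ⋙ F ⟶ W, f = trans a F ≫ vert α ∧ (IsIso f.fiber → IsIso α) := by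
  subst h
  exact ⟨f.fiber, (trans_vert _ _).symm, id⟩

end El

namespace Fun

lemma ι_fac {p q : El X E} (f : (ι X E).obj p ⟶ (ι X E).obj q) :
    ∃ (w : El X E) (φ : p ⟶ w) (s : q ⟶ w), IsIso s.fiber ∧ f ≫ (ι X E).map s = (ι X E).map φ := by
  obtain ⟨ψ, hψ⟩ := Localization.exists_leftFraction (El.cocart X E).Q (El.cocart X E) f
  refine ⟨ψ.Y', ψ.f, ψ.s, ψ.hs, ?_⟩
  have h := ψ.map_comp_map_s (El.cocart X E).Q (Localization.inverts _ _)
  exact (congrArg (fun z => z ≫ (El.cocart X E).Q.map ψ.s) hψ).trans h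

lemma ι_map_eq_iff {p q : El X E} (f g : p ⟶ q) (h : (ι X E).map f = (ι X E).map g) :
    ∃ (w : El X E) (s : q ⟶ w), IsIso s.fiber ∧ f ≫ s = g ≫ s := by
  obtain ⟨w, s, hs, h⟩ :=
    (MorphismProperty.map_eq_iff_postcomp (El.cocart X E).Q (El.cocart X E) f g).1 h
  exact ⟨w, s, hs, h⟩

variable (X E) in
/-- The canonical functor from `Fun(X_k, E)` to the colimit. -/
noncomputable def level (k : X.Idx) : (X.cat k ⥤ E) ⥤ Fun X E where
  obj F := ⟨k, F⟩
  map α := (ι X E).map (El.vert α)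
  map_id F := (congrArg (ι X E).map (El.vert_id F)).trans ((ι X E).map_id _)
  map_comp α β := (congrArg (ι X E).map (El.vert_comp α β)).trans ((ι X E).map_comp _ _)

variable (X) in
/-- A refinement of an index `k`: a smaller index, together with a functor isomorphic to the
transition functor. -/
structure Ref (k : X.Idx) where
  idx : X.Idx
  base : idx ⟶ k
  fn : X.cat idx ⥤ X.cat k
  iso : X.tr base ≅ fn

namespace Ref

/-- The refinement given by a transition functor. -/
def ofHom {k l : X.Idx} (a : l ⟶ k) : Ref X k := ⟨l, a, X.tr a, Iso.refl _⟩

/-- The composition of refinements. -/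
def comp {k : X.Idx} (r : Ref X k) (s : Ref X r.idx) : Ref X k where
  idx := s.idx
  base := s.base ≫ r.base
  fn := s.fn ⋙ r.fn
  iso := X.trComp _ _ ≪≫ Functor.isoWhiskerLeft _ r.iso ≪≫ Functor.isoWhiskerRight s.iso _

/-- The morphism from a functor to its restriction along a refinement. -/
def el {k : X.Idx} (r : Ref X k) (F : X.cat k ⥤ E) :
    (⟨k, F⟩ : El X E) ⟶ ⟨r.idx, r.fn ⋙ F⟩ :=
  ⟨r.base, Functor.whiskerRight r.iso.hom F⟩

lemma isIso_map_el {k : X.Idx} (r : Ref X k) (F : X.cat k ⥤ E) : IsIso ((ι X E).map (r.el F)) :=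
  isIso_ι _ (inferInstanceAs (IsIso (Functor.whiskerRight r.iso.hom F)))

/-- A functor is isomorphic to its restriction along a refinement. -/
noncomputable def toIso {k : X.Idx} (r : Ref X k) (F : X.cat k ⥤ E) :
    (level X E k).obj F ≅ (level X E r.idx).obj (r.fn ⋙ F) :=
  @asIso _ _ _ _ ((ι X E).map (r.el F)) (r.isIso_map_el F)

lemma toIso_naturality {k : X.Idx} (r : Ref X k) {F G : X.cat k ⥤ E} (α : F ⟶ G) :
    (level X E k).map α ≫ (r.toIso G).hom =
      (r.toIso F).hom ≫ (level X E r.idx).map (Functor.whiskerLeft r.fn α) := by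
  refine ((ι X E).map_comp (El.vert α) (r.el G)).symm.trans (Eq.trans ?_ ((ι X E).map_comp (r.el F)
    (El.vert (Functor.whiskerLeft r.fn α))))
  refine congrArg _ ((El.vert_hom _ _ _).trans (Eq.trans ?_ (El.hom_vert _ _ _).symm))
  exact El.Hom.ext_fiber fun x => (α.naturality (r.iso.hom.app x)).symm

/-- A refinement carries its own functor `fn`, so `fn` of a composite is the composite on the nose,
and the constraint `trComp` of the pseudofunctor is absorbed once and for all in the component
`iso`. -/
lemma toIso_comp {k : X.Idx} (r : Ref X k) (s : Ref X r.idx) (F : X.cat k ⥤ E) :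
    ((r.comp s).toIso F).hom = (r.toIso F).hom ≫ (s.toIso (r.fn ⋙ F)).hom := by
  have h : (r.comp s).el F = r.el F ≫ s.el (r.fn ⋙ F) := El.Hom.ext_fiber fun x => by
    change F.map ((X.trComp _ _).hom.app x ≫ r.iso.hom.app _ ≫ r.fn.map (s.iso.hom.app x)) =
      F.map ((X.trComp _ _).hom.app x) ≫ F.map (r.iso.hom.app _) ≫
        F.map (r.fn.map (s.iso.hom.app x))
    rw [F.map_comp, F.map_comp]
  exact (congrArg (ι X E).map h).trans ((ι X E).map_comp (r.el F) (s.el (r.fn ⋙ F)))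

lemma el_ofHom {k l : X.Idx} (a : l ⟶ k) (F : X.cat k ⥤ E) : (ofHom a).el F = El.trans a F :=
  El.Hom.ext_fiber fun _ => F.map_id _

/-- The restriction isomorphism, as an isomorphism of functors. -/
noncomputable def natIso {k : X.Idx} (r : Ref X k) :
    level X E k ≅ (Functor.whiskeringLeft _ _ E).obj r.fn ⋙ level X E r.idx :=
  NatIso.ofComponents (fun F => r.toIso F) fun α => r.toIso_naturality α

/-- Conditions on refinements which are stable under, and can be achieved by, further refinement can
be achieved simultaneously. -/
lemma exists_forall {κ : Type*} [Finite κ] {k : X.Idx} (P : κ → Ref X k → Prop)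
    (stable : ∀ i (r : Ref X k) (s : Ref X r.idx), P i r → P i (r.comp s))
    (dense : ∀ i (r : Ref X k), ∃ s : Ref X r.idx, P i (r.comp s)) : ∃ r : Ref X k, ∀ i, P i r := by
  classical
  have := Fintype.ofFinite κ
  have (J : Finset κ) : ∃ r : Ref X k, ∀ i ∈ J, P i r := by
    induction J using Finset.induction with
    | empty => exact ⟨ofHom (𝟙 _), by simp⟩
    | insert j J _ ih =>
      obtain ⟨r, hr⟩ := ih
      obtain ⟨s, hs⟩ := dense j r
      refine ⟨r.comp s, fun l hl => ?_⟩
      obtain rfl | hl := Finset.mem_insert.1 hl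
      · exact hs
      · exact stable l _ _ (hr l hl)
  obtain ⟨r, hr⟩ := this Finset.univ
  exact ⟨r, fun i => hr i (Finset.mem_univ i)⟩

/-- The morphism `h` represents the morphism `f` after the refinement `r`. -/
def Lifts {k : X.Idx} (r : Ref X k) {F G : X.cat k ⥤ E}
    (f : (level X E k).obj F ⟶ (level X E k).obj G) (h : r.fn ⋙ F ⟶ r.fn ⋙ G) : Prop :=
  f ≫ (r.toIso G).hom = (r.toIso F).hom ≫ (level X E r.idx).map h

lemma Lifts.comp {k : X.Idx} {r : Ref X k} {F G : X.cat k ⥤ E}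
    {f : (level X E k).obj F ⟶ (level X E k).obj G} {h : r.fn ⋙ F ⟶ r.fn ⋙ G} (hf : r.Lifts f h)
    (s : Ref X r.idx) : (r.comp s).Lifts f (Functor.whiskerLeft s.fn h) := by
  have h₁ := r.toIso_comp s F
  have h₂ := r.toIso_comp s G
  have h₃ := s.toIso_naturality h
  exact (congrArg (f ≫ ·) h₂).trans ((comp_square hf h₃).trans
    (congrArg (· ≫ (level X E s.idx).map (Functor.whiskerLeft s.fn h)) h₁.symm))

/-- A morphism is a fraction whose legs may have different base maps to `k`. Restricting to an index
that equalizes them puts both legs over the same base map, and the denominator can be inverted in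
the fiber. -/
lemma exists_lifts {k : X.Idx} {F G : X.cat k ⥤ E}
    (f : (level X E k).obj F ⟶ (level X E k).obj G) : ∃ (r : Ref X k) (h : _), r.Lifts f h := by
  obtain ⟨w, φ, s, hs, h⟩ := ι_fac (p := ⟨k, F⟩) (q := ⟨k, G⟩) f
  let e := IsCofiltered.eqHom φ.base s.base
  have he : e ≫ φ.base = e ≫ s.base := IsCofiltered.eq_condition _ _
  obtain ⟨α, hα, -⟩ := El.eq_trans_vert (φ ≫ El.trans e w.fib) (a := e ≫ φ.base) rfl
  obtain ⟨β, hβ, hβ'⟩ := El.eq_trans_vert (s ≫ El.trans e w.fib) (a := e ≫ φ.base) he.symm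
  obtain ⟨β', h₁, -⟩ := hβ' ((El.cocart X E).comp_mem s (El.trans e w.fib) hs
    (inferInstanceAs (IsIso (𝟙 (X.tr e ⋙ w.fib)))))
  refine ⟨ofHom (e ≫ φ.base), α ≫ β', ?_⟩
  let a := e ≫ φ.base
  have h₂ : (ι X E).map s ≫ (ι X E).map (El.trans e w.fib) =
      (ι X E).map (El.trans a G) ≫ (level X E _).map β :=
    ((ι X E).map_comp _ _).symm.trans ((congrArg _ hβ).trans ((ι X E).map_comp _ _))
  have h₃ : (ι X E).map φ ≫ (ι X E).map (El.trans e w.fib) =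
      (ι X E).map (El.trans a F) ≫ (level X E _).map α :=
    ((ι X E).map_comp _ _).symm.trans ((congrArg _ hα).trans ((ι X E).map_comp _ _))
  have h₄ : (level X E _).map β ≫ (level X E _).map β' = 𝟙 _ :=
    ((level X E _).map_comp β β').symm.trans ((congrArg _ h₁).trans ((level X E _).map_id _))
  have h₅ : (level X E _).map (α ≫ β') = (level X E _).map α ≫ (level X E _).map β' :=
    (level X E _).map_comp α β'
  have h₆ : ((ofHom a).toIso F).hom = (ι X E).map (El.trans a F) :=
    congrArg (ι X E).map (el_ofHom a F)
  have h₇ : ((ofHom a).toIso G).hom = (ι X E).map (El.trans a G) :=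
    congrArg (ι X E).map (el_ofHom a G)
  exact comp_eq_of_square h h₂ h₃ h₄ h₅ h₆ h₇

/-- Equality in the localization means equality after composition with a cocartesian morphism. The
base of that morphism is the refinement, and its invertible fiber component cancels. -/
lemma exists_eq_of_level_map_eq {k : X.Idx} {F G : X.cat k ⥤ E} {g h : F ⟶ G}
    (hgh : (level X E k).map g = (level X E k).map h) :
    ∃ r : Ref X k, Functor.whiskerLeft r.fn g = Functor.whiskerLeft r.fn h := by
  obtain ⟨w, s, hs, h'⟩ := ι_map_eq_iff _ _ hgh
  obtain ⟨l, W⟩ := w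
  obtain ⟨b, γ⟩ := s
  have : IsIso γ := hs
  refine ⟨ofHom b, ?_⟩
  have h₁ := (El.vert_hom b g γ).symm.trans (h'.trans (El.vert_hom b h γ))
  have h₂ := eq_of_heq (El.Hom.mk.inj h₁).2
  exact (cancel_mono γ).1 h₂

end Ref

/-- Finitely many objects are defined over a common index. -/
lemma exists_level {κ : Type*} [Finite κ] (k : X.Idx) (p : κ → Fun X E) : ∃ (r : Ref X k)
    (P : κ → (X.cat r.idx ⥤ E)), Nonempty (∀ i, p i ≅ (level X E r.idx).obj (P i)) := by
  have h (i) (r : Ref X k) : ∃ s : Ref X r.idx,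
      ∃ P, Nonempty (p i ≅ (level X E (r.comp s).idx).obj P) := by
    let c := IsCofiltered.minToLeft r.idx (p i).idx
    let d := IsCofiltered.minToRight r.idx (p i).idx
    exact ⟨Ref.ofHom c, _, ⟨(Ref.ofHom d).toIso (p i).fib⟩⟩
  obtain ⟨r, hr⟩ := Ref.exists_forall (fun i r => ∃ P, Nonempty (p i ≅ (level X E r.idx).obj P))
    (fun i r s ⟨P, ⟨e⟩⟩ => ⟨_, ⟨e ≪≫ s.toIso P⟩⟩) h
  choose P hP using hr
  exact ⟨r, P, ⟨fun i => (hP i).some⟩⟩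

lemma exists_lifts_family {κ : Type*} [Finite κ] {k : X.Idx} {F G : κ → (X.cat k ⥤ E)}
    (f : ∀ i, (level X E k).obj (F i) ⟶ (level X E k).obj (G i)) :
    ∃ (r : Ref X k) (h : ∀ i, r.fn ⋙ F i ⟶ r.fn ⋙ G i), ∀ i, r.Lifts (f i) (h i) := by
  obtain ⟨r, hr⟩ := Ref.exists_forall (fun i r => ∃ h, r.Lifts (f i) h)
    (fun i r s ⟨h, hh⟩ => ⟨_, hh.comp s⟩) fun i r => by
    obtain ⟨s, h, hs⟩ := Ref.exists_lifts ((r.toIso (F i)).inv ≫ f i ≫ (r.toIso (G i)).hom)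
    refine ⟨s, h, ?_⟩
    have h₁ := r.toIso_comp s (F i)
    have h₂ := r.toIso_comp s (G i)
    exact (congrArg (f i ≫ ·) h₂).trans ((comp_square (by simp) hs).trans
      (congrArg (· ≫ (level X E s.idx).map h) h₁.symm))
  choose h hh using hr
  exact ⟨r, h, hh⟩

lemma exists_eq_family {κ : Type*} [Finite κ] {k : X.Idx} {F G : κ → (X.cat k ⥤ E)}
    {g h : ∀ i, F i ⟶ G i} (hgh : ∀ i, (level X E k).map (g i) = (level X E k).map (h i)) :
    ∃ (r : Ref X k), ∀ i, Functor.whiskerLeft r.fn (g i) = Functor.whiskerLeft r.fn (h i) := by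
  refine Ref.exists_forall (fun i r => Functor.whiskerLeft r.fn (g i) = Functor.whiskerLeft r.fn (h i))
    (fun i r s h => congrArg (Functor.whiskerLeft s.fn) h) fun i r => ?_
  have h₁ := (r.toIso_naturality (g i)).symm.trans ((congrArg (· ≫ (r.toIso (G i)).hom) (hgh i)).trans
    (r.toIso_naturality (h i)))
  exact Ref.exists_eq_of_level_map_eq ((cancel_epi (r.toIso (F i)).hom).1 h₁)

end Fun

end ProfiniteGroupoid
universe v

lemma CategoryTheory.Iso.conj_fac {C : Type*} [Category* C] {a b d a' b' d' : C} {e : a ≅ a'}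
    {p : b ≅ b'} {q : d ≅ d'} {l : a' ⟶ b'} {w : b' ⟶ d'} {v : b ⟶ d} {h : a' ⟶ d'} {f : a ⟶ d}
    (h₁ : p.inv ≫ v ≫ q.hom = w) (h₂ : l ≫ w = h) (h₃ : h = e.inv ≫ f ≫ q.hom) :
    (e.hom ≫ l ≫ p.inv) ≫ v = f := by
  subst h₁
  rw [h₃, ← cancel_epi e.hom] at h₂
  simpa [← Category.assoc] using h₂

lemma CategoryTheory.Iso.conj_fac' {C : Type*} [Category* C] {a b d a' b' d' : C} {e : a ≅ a'}
    {p : b ≅ b'} {q : d ≅ d'} {l : b' ⟶ d'} {w : a' ⟶ b'} {v : a ⟶ b} {h : a' ⟶ d'} {f : a ⟶ d}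
    (h₁ : e.inv ≫ v ≫ p.hom = w) (h₂ : w ≫ l = h) (h₃ : h = e.inv ≫ f ≫ q.hom) :
    v ≫ p.hom ≫ l ≫ q.inv = f := by
  subst h₁
  rw [h₃, ← cancel_epi e.hom] at h₂
  rw [← cancel_mono q.hom]
  simpa using h₂

/-! ### Finite limits and colimits in the filtered 2-colimit. -/

namespace ProfiniteGroupoid

namespace Fun

variable {X : ProfiniteGroupoid.{u}} {E : Type u} [Category.{u} E]

lemma Ref.level_map_whiskerLeft_eq {k : X.Idx} (r : Ref X k) {F G : X.cat k ⥤ E} {g h : F ⟶ G}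
    (hgh : (level X E k).map g = (level X E k).map h) : (level X E r.idx).map (Functor.whiskerLeft r.fn g) =
      (level X E r.idx).map (Functor.whiskerLeft r.fn h) :=
  (cancel_epi (r.toIso F).hom).1 ((r.toIso_naturality g).symm.trans
    ((congrArg (· ≫ (r.toIso G).hom) hgh).trans (r.toIso_naturality h)))

lemma Ref.Lifts.level_map {k : X.Idx} {r : Ref X k} {F G : X.cat k ⥤ E}
    {f : (level X E k).obj F ⟶ (level X E k).obj G} {h : r.fn ⋙ F ⟶ r.fn ⋙ G} (hf : r.Lifts f h) :
    (level X E r.idx).map h = (r.toIso F).inv ≫ f ≫ (r.toIso G).hom :=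
  ((Iso.inv_comp_eq _).2 hf).symm

section Diagrams

variable {J : Type v} [SmallCategory J] [FinCategory J]

instance finite_arrows : Finite (Σ i j : J, i ⟶ j) := inferInstance

/-- Finite diagrams in the colimit are defined over some index. -/
theorem exists_diagram (G : J ⥤ Fun X E) :
    ∃ (k : X.Idx) (F : J ⥤ X.cat k ⥤ E), Nonempty (F ⋙ level X E k ≅ G) := by
  obtain ⟨k₀⟩ : Nonempty X.Idx := IsCofiltered.nonempty
  -- Four successive refinements realize the objects, the arrows, the identity law and the
  -- composition law; finiteness of `J` makes each a finite set of conditions.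
  obtain ⟨r, P, ⟨e⟩⟩ := exists_level k₀ G.obj
  obtain ⟨s, h, hh⟩ := exists_lifts_family (κ := Σ i j : J, i ⟶ j)
    (fun m => (e m.1).inv ≫ G.map m.2.2 ≫ (e m.2.1).hom)
  let e' (j : J) : G.obj j ≅ (level X E s.idx).obj (s.fn ⋙ P j) := e j ≪≫ s.toIso (P j)
  have hh' {i j : J} (m : i ⟶ j) : (level X E s.idx).map (h ⟨i, j, m⟩) =
      (e' i).inv ≫ G.map m ≫ (e' j).hom :=
    (hh ⟨i, j, m⟩).level_map.trans (by simp [e'])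
  obtain ⟨t, ht⟩ := exists_eq_family (g := fun j : J => h ⟨j, j, 𝟙 j⟩) (h := fun j => 𝟙 (s.fn ⋙ P j))
    (fun j => by rw [hh', CategoryTheory.Functor.map_id]; simp)
  obtain ⟨v, hv⟩ := exists_eq_family (κ := Σ i j l : J, (i ⟶ j) × (j ⟶ l))
    (g := fun m => Functor.whiskerLeft t.fn (h ⟨_, _, m.2.2.2.1 ≫ m.2.2.2.2⟩))
    (h := fun m => Functor.whiskerLeft t.fn (h ⟨_, _, m.2.2.2.1⟩ ≫ h ⟨_, _, m.2.2.2.2⟩))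
    (fun m => t.level_map_whiskerLeft_eq (by
      rw [hh', CategoryTheory.Functor.map_comp, CategoryTheory.Functor.map_comp, hh', hh']; simp))
  let F : J ⥤ X.cat v.idx ⥤ E :=
    { obj := fun j => v.fn ⋙ t.fn ⋙ s.fn ⋙ P j
      map := fun {i j} m => Functor.whiskerLeft v.fn (Functor.whiskerLeft t.fn (h ⟨i, j, m⟩))
      map_id := fun j => by rw [ht]; rfl
      map_comp := fun m n => hv ⟨_, _, _, m, n⟩ }
  refine ⟨v.idx, F, ⟨(NatIso.ofComponents
    (fun j => e' j ≪≫ t.toIso _ ≪≫ v.toIso _) fun {i j} m => ?_).symm⟩⟩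
  have h₁ := t.toIso_naturality (h ⟨i, j, m⟩)
  have h₂ := v.toIso_naturality (Functor.whiskerLeft t.fn (h ⟨i, j, m⟩))
  have h₃ : G.map m ≫ (e' j).hom = (e' i).hom ≫ (level X E s.idx).map (h ⟨i, j, m⟩) := by
    rw [hh']; simp
  exact comp_square h₃ ((comp_square h₁ h₂))

section Limits

variable [HasLimitsOfShape J E] {k : X.Idx} {G : J ⥤ X.cat k ⥤ E} {c : Cone G} (hc : IsLimit c)
include hc

/-- The finitely many components and their compatibilities hold at some finer index. Restriction
along the refinement keeps `c` a limit cone, since limits of functors are pointwise, so the lift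
exists there. -/
lemma exists_level_lift {P : X.cat k ⥤ E} (f : ∀ j, (level X E k).obj P ⟶ (level X E k).obj (G.obj j))
    (hf : ∀ {i j} (m : i ⟶ j), f i ≫ (level X E k).map (G.map m) = f j) :
    ∃ g : (level X E k).obj P ⟶ (level X E k).obj c.pt,
      ∀ j, g ≫ (level X E k).map (c.π.app j) = f j := by
  obtain ⟨r, h, hh⟩ := exists_lifts_family f
  obtain ⟨s, hs⟩ := exists_eq_family (κ := Σ i j : J, i ⟶ j)
    (g := fun m => h m.1 ≫ Functor.whiskerLeft r.fn (G.map m.2.2)) (h := fun m => h m.2.1) (fun m => by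
      have h₁ := (Iso.eq_inv_comp _).2 (r.toIso_naturality (G.map m.2.2)).symm
      rw [CategoryTheory.Functor.map_comp, (hh _).level_map, (hh _).level_map, ← hf m.2.2, h₁]
      simp)
  let s' : Cone (G ⋙ (Functor.whiskeringLeft _ _ E).obj (r.comp s).fn) :=
    { pt := (r.comp s).fn ⋙ P
      π := { app := fun j => Functor.whiskerLeft s.fn (h j)
             naturality := fun i j m => (Category.id_comp _).trans (hs ⟨i, j, m⟩).symm } }
  let hc' := isLimitOfPreserves ((Functor.whiskeringLeft _ _ E).obj (r.comp s).fn) hc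
  refine ⟨((r.comp s).toIso P).hom ≫ (level X E (r.comp s).idx).map (hc'.lift s') ≫
    ((r.comp s).toIso c.pt).inv, fun j => ?_⟩
  have h₁ := (Iso.inv_comp_eq _).2 ((r.comp s).toIso_naturality (c.π.app j))
  have h₂ := ((level X E (r.comp s).idx).map_comp _ _).symm.trans
    ((level X E (r.comp s).idx).congr_map (hc'.fac s' j))
  exact Iso.conj_fac h₁ h₂ ((hh j).comp s).level_map

lemma level_hom_ext {P : X.cat k ⥤ E} {f g : (level X E k).obj P ⟶ (level X E k).obj c.pt}
    (hfg : ∀ j, f ≫ (level X E k).map (c.π.app j) = g ≫ (level X E k).map (c.π.app j)) : f = g := by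
  obtain ⟨r, h, hh⟩ := exists_lifts_family (κ := Bool) (F := fun _ => P) (G := fun _ => c.pt)
    fun b => bif b then f else g
  obtain ⟨s, hs⟩ := exists_eq_family (κ := J)
    (g := fun j => h true ≫ Functor.whiskerLeft r.fn (c.π.app j))
    (h := fun j => h false ≫ Functor.whiskerLeft r.fn (c.π.app j)) (fun j => by
      have h₁ := (Iso.eq_inv_comp _).2 (r.toIso_naturality (c.π.app j)).symm
      rw [CategoryTheory.Functor.map_comp, CategoryTheory.Functor.map_comp, (hh _).level_map, (hh _).level_map, h₁]
      simp [hfg])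
  let hc' := isLimitOfPreserves ((Functor.whiskeringLeft _ _ E).obj (r.comp s).fn) hc
  have h₁ : Functor.whiskerLeft s.fn (h true) = Functor.whiskerLeft s.fn (h false) :=
    hc'.hom_ext hs
  have h₂ := ((hh true).comp s).level_map
  have h₃ := ((hh false).comp s).level_map
  rw [h₁, h₃] at h₂
  simpa using h₂.symm

/-- The vertex of an arbitrary cone is defined at some finer level; after restriction of `c` to that
level, existence and uniqueness are the two preceding lemmas. -/
lemma preservesLimit_level : PreservesLimit G (level X E k) := by
  refine preservesLimit_of_preserves_limit_cone hc ?_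
  have (s : Cone (G ⋙ level X E k)) : ∃ m : s.pt ⟶ (level X E k).obj c.pt,
      (∀ j, m ≫ (level X E k).map (c.π.app j) = s.π.app j) ∧
      ∀ m', (∀ j, m' ≫ (level X E k).map (c.π.app j) = s.π.app j) → m' = m := by
    obtain ⟨r, P, ⟨e⟩⟩ := exists_level (κ := Unit) k fun _ => s.pt
    let e := e ()
    have hc' := isLimitOfPreserves ((Functor.whiskeringLeft _ _ E).obj r.fn) hc
    have hn (j) : (level X E k).map (c.π.app j) ≫ (r.toIso (G.obj j)).hom =
       (r.toIso c.pt).hom ≫ (level X E r.idx).map (Functor.whiskerLeft r.fn (c.π.app j)) := r.toIso_naturality (c.π.app j)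
    obtain ⟨g, hg⟩ := exists_level_lift hc' (fun j => e.inv ≫ s.π.app j ≫ (r.toIso (G.obj j)).hom)
      (fun {i j} m => by
        have h₁ : (level X E k).map (G.map m) ≫ (r.toIso (G.obj j)).hom = (r.toIso (G.obj i)).hom ≫
          (level X E r.idx).map (((Functor.whiskeringLeft _ _ E).obj r.fn).map (G.map m)) :=
          r.toIso_naturality (G.map m)
        have h₂ : s.π.app i ≫ (level X E k).map (G.map m) = s.π.app j := s.w m
        rw [← h₂, Category.assoc, Category.assoc, Category.assoc, h₁]
        rfl)
    have hg' (j) : g ≫ (level X E r.idx).map (Functor.whiskerLeft r.fn (c.π.app j)) =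
      e.inv ≫ s.π.app j ≫ (r.toIso (G.obj j)).hom := hg j
    refine ⟨e.hom ≫ g ≫ (r.toIso c.pt).inv, fun j => ?_, fun m' hm' => ?_⟩
    · have h₃ := (Iso.inv_comp_eq _).2 (hn j)
      exact Iso.conj_fac h₃ (hg' j) rfl
    · have : e.inv ≫ m' ≫ (r.toIso c.pt).hom = g := level_hom_ext hc' fun j => by
        refine Eq.trans ?_ (hg' j).symm
        change (e.inv ≫ m' ≫ (r.toIso c.pt).hom) ≫ (level X E r.idx).map (Functor.whiskerLeft r.fn (c.π.app j)) = _
        rw [Category.assoc, Category.assoc, ← hn, reassoc_of% (hm' j)]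
      rw [← this]
      simp
  choose m hm hm' using this
  exact ⟨m, hm, hm'⟩

end Limits

/-! ### The dual statements for colimits. -/

section Colimits

variable [HasColimitsOfShape J E] {k : X.Idx} {G : J ⥤ X.cat k ⥤ E} {c : Cocone G} (hc : IsColimit c)
include hc

lemma exists_level_desc {P : X.cat k ⥤ E} (f : ∀ j, (level X E k).obj (G.obj j) ⟶ (level X E k).obj P)
    (hf : ∀ {i j} (m : i ⟶ j), (level X E k).map (G.map m) ≫ f j = f i) :
    ∃ g : (level X E k).obj c.pt ⟶ (level X E k).obj P,
      ∀ j, (level X E k).map (c.ι.app j) ≫ g = f j := by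
  obtain ⟨r, h, hh⟩ := exists_lifts_family f
  obtain ⟨s, hs⟩ := exists_eq_family (κ := Σ i j : J, i ⟶ j)
    (g := fun m => Functor.whiskerLeft r.fn (G.map m.2.2) ≫ h m.2.1) (h := fun m => h m.1) (fun m => by
      have h₁ := (Iso.eq_inv_comp _).2 (r.toIso_naturality (G.map m.2.2)).symm
      rw [CategoryTheory.Functor.map_comp, (hh _).level_map, (hh _).level_map, ← hf m.2.2, h₁]
      simp)
  let s' : Cocone (G ⋙ (Functor.whiskeringLeft _ _ E).obj (r.comp s).fn) :=
    { pt := (r.comp s).fn ⋙ P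
      ι := { app := fun j => Functor.whiskerLeft s.fn (h j)
             naturality := fun i j m => (hs ⟨i, j, m⟩).trans (Category.comp_id _).symm } }
  let hc' := isColimitOfPreserves ((Functor.whiskeringLeft _ _ E).obj (r.comp s).fn) hc
  refine ⟨((r.comp s).toIso c.pt).hom ≫ (level X E (r.comp s).idx).map (hc'.desc s') ≫
    ((r.comp s).toIso P).inv, fun j => ?_⟩
  have h₁ := (Iso.inv_comp_eq _).2 ((r.comp s).toIso_naturality (c.ι.app j))
  have h₂ := ((level X E (r.comp s).idx).map_comp _ _).symm.trans
    ((level X E (r.comp s).idx).congr_map (hc'.fac s' j))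
  exact Iso.conj_fac' h₁ h₂ ((hh j).comp s).level_map

lemma level_hom_ext' {P : X.cat k ⥤ E} {f g : (level X E k).obj c.pt ⟶ (level X E k).obj P}
    (hfg : ∀ j, (level X E k).map (c.ι.app j) ≫ f = (level X E k).map (c.ι.app j) ≫ g) : f = g := by
  obtain ⟨r, h, hh⟩ := exists_lifts_family (κ := Bool) (F := fun _ => c.pt) (G := fun _ => P)
    fun b => bif b then f else g
  obtain ⟨s, hs⟩ := exists_eq_family (κ := J)
    (g := fun j => Functor.whiskerLeft r.fn (c.ι.app j) ≫ h true)
    (h := fun j => Functor.whiskerLeft r.fn (c.ι.app j) ≫ h false) (fun j => by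
      have h₁ := (Iso.eq_inv_comp _).2 (r.toIso_naturality (c.ι.app j)).symm
      rw [CategoryTheory.Functor.map_comp, CategoryTheory.Functor.map_comp, (hh _).level_map,
        (hh _).level_map, h₁]
      simp [reassoc_of% (hfg j)])
  let hc' := isColimitOfPreserves ((Functor.whiskeringLeft _ _ E).obj (r.comp s).fn) hc
  have h₁ : Functor.whiskerLeft s.fn (h true) = Functor.whiskerLeft s.fn (h false) :=
    hc'.hom_ext hs
  have h₂ := ((hh true).comp s).level_map
  have h₃ := ((hh false).comp s).level_map
  rw [h₁, h₃] at h₂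
  simpa using h₂.symm

lemma preservesColimit_level : PreservesColimit G (level X E k) := by
  refine preservesColimit_of_preserves_colimit_cocone hc ?_
  have (s : Cocone (G ⋙ level X E k)) : ∃ m : (level X E k).obj c.pt ⟶ s.pt,
      (∀ j, (level X E k).map (c.ι.app j) ≫ m = s.ι.app j) ∧
      ∀ m', (∀ j, (level X E k).map (c.ι.app j) ≫ m' = s.ι.app j) → m' = m := by
    obtain ⟨r, P, ⟨e⟩⟩ := exists_level (κ := Unit) k fun _ => s.pt
    let e := e ()
    have hc' := isColimitOfPreserves ((Functor.whiskeringLeft _ _ E).obj r.fn) hc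
    have hn (j) : (level X E k).map (c.ι.app j) ≫ (r.toIso c.pt).hom =
        (r.toIso (G.obj j)).hom ≫ (level X E r.idx).map (Functor.whiskerLeft r.fn (c.ι.app j)) :=
      r.toIso_naturality (c.ι.app j)
    obtain ⟨g, hg⟩ := exists_level_desc hc' (fun j => (r.toIso (G.obj j)).inv ≫ s.ι.app j ≫ e.hom)
      (fun {i j} m => by
        have h₁ : (level X E r.idx).map (((Functor.whiskeringLeft _ _ E).obj r.fn).map (G.map m)) =
            (r.toIso (G.obj i)).inv ≫ (level X E k).map (G.map m) ≫ (r.toIso (G.obj j)).hom :=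
          ((Iso.inv_comp_eq _).2 (r.toIso_naturality (G.map m))).symm
        have h₂ : (level X E k).map (G.map m) ≫ s.ι.app j = s.ι.app i := s.w m
        rw [← h₂]
        refine (congrArg (· ≫ (r.toIso (G.obj j)).inv ≫ s.ι.app j ≫ e.hom) h₁).trans ?_
        simp)
    have hg' (j) : (level X E r.idx).map (Functor.whiskerLeft r.fn (c.ι.app j)) ≫ g =
      (r.toIso (G.obj j)).inv ≫ s.ι.app j ≫ e.hom := hg j
    refine ⟨(r.toIso c.pt).hom ≫ g ≫ e.inv, fun j => ?_, fun m' hm' => ?_⟩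
    · have h₃ := (Iso.inv_comp_eq _).2 (hn j)
      exact Iso.conj_fac' h₃ (hg' j) rfl
    · have : (r.toIso c.pt).inv ≫ m' ≫ e.hom = g := level_hom_ext' hc' fun j => by
        refine Eq.trans ?_ (hg' j).symm
        have h₄ := (Iso.eq_inv_comp _).2 (hn j).symm
        refine (congrArg (· ≫ (r.toIso c.pt).inv ≫ m' ≫ e.hom) h₄).trans ?_
        simp [← hm' j]
      rw [← this]
      simp
  choose m hm hm' using this
  exact ⟨m, hm, hm'⟩

end Colimits

variable (J) in
instance [HasLimitsOfShape J E] (k : X.Idx) : PreservesLimitsOfShape J (level X E k) :=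
  ⟨fun {G} => preservesLimit_level (limit.isLimit G)⟩

variable (J) in
instance [HasColimitsOfShape J E] (k : X.Idx) : PreservesColimitsOfShape J (level X E k) :=
  ⟨fun {G} => preservesColimit_level (colimit.isColimit G)⟩

variable (J) in
instance [HasLimitsOfShape J E] : HasLimitsOfShape J (Fun X E) := ⟨fun G => by
  obtain ⟨k, F, ⟨e⟩⟩ := exists_diagram G
  exact hasLimit_of_iso e⟩

variable (J) in
instance [HasColimitsOfShape J E] : HasColimitsOfShape J (Fun X E) := ⟨fun G => by
  obtain ⟨k, F, ⟨e⟩⟩ := exists_diagram G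
  exact hasColimit_of_iso e.symm⟩

end Diagrams

end Fun

end ProfiniteGroupoid

/-! ### Universality of colimits in the filtered 2-colimit. -/

namespace CategoryTheory.Limits

/-- Two pullbacks of the same cocone are isomorphic; if one is a colimit, then so is the other. -/
lemma nonempty_isColimit_of_isPullback {J : Type*} [Category* J] {D : Type*} [Category* D] {F F' F'' : J ⥤ D}
    {c : Cocone F} {c' : Cocone F'} {d : Cocone F''} (α : F' ⟶ F) (β : F'' ⟶ F) {f : c'.pt ⟶ c.pt}
    (e : d.pt ≅ c'.pt) (hc' : ∀ j, IsPullback (c'.ι.app j) (α.app j) f (c.ι.app j))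
    (hd : ∀ j, IsPullback (d.ι.app j ≫ e.hom) (β.app j) f (c.ι.app j)) (h : IsColimit d) :
    Nonempty (IsColimit c') := by
  let φ (j : J) : F'.obj j ≅ F''.obj j := (hc' j).isoIsPullback c'.pt (F.obj j) (hd j)
  have h₁ (j : J) : (φ j).hom ≫ d.ι.app j ≫ e.hom = c'.ι.app j :=
    (hc' j).isoIsPullback_hom_fst _ _ (hd j)
  have h₂ (j : J) : (φ j).hom ≫ β.app j = α.app j := (hc' j).isoIsPullback_hom_snd _ _ (hd j)
  let γ : F' ≅ F'' := NatIso.ofComponents φ fun {i j} m => by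
    refine (hd j).hom_ext ?_ ?_
    · have h₃ : F''.map m ≫ d.ι.app j ≫ e.hom = d.ι.app i ≫ e.hom := by
        rw [← Category.assoc, d.w]
      exact (Category.assoc _ _ _).trans ((congrArg _ (h₁ j)).trans ((c'.w m).trans ((h₁ i).symm.trans
        ((congrArg _ h₃).symm.trans (Category.assoc _ _ _).symm))))
    · rw [Category.assoc, Category.assoc, h₂, β.naturality, reassoc_of% (h₂ i), α.naturality]
  exact ⟨((IsColimit.precomposeHomEquiv γ d).symm h).ofIsoColimit
    (Cocone.ext e fun j => (Category.assoc _ _ _).trans (h₁ j))⟩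

end CategoryTheory.Limits

namespace ProfiniteGroupoid.Fun

variable {X : ProfiniteGroupoid.{u}} {E : Type u} [Category.{u} E]
variable {J : Type} [SmallCategory J] [FinCategory J] [HasColimitsOfShape J E] [HasPullbacks E]

/-- The morphism `f` is represented at a finer level, where the pulled back cocone is a colimit by
hypothesis. The functor `level` preserves this colimit and the pullbacks that define it, and two
pullbacks of one cocone are isomorphic. -/
theorem isUniversalColimit_level (hE : ∀ (k : X.Idx) {F : J ⥤ X.cat k ⥤ E} {c : Cocone F}, IsColimit c →
    IsUniversalColimit c) {k : X.Idx} {G : J ⥤ X.cat k ⥤ E} {c : Cocone G} (hc : IsColimit c) :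
    IsUniversalColimit ((level X E k).mapCocone c) := by
  intro F' c' α f hα he hp
  obtain ⟨r, P, ⟨e⟩⟩ := exists_level (κ := Unit) k fun _ => c'.pt
  let P := P ()
  let e : c'.pt ≅ (level X E r.idx).obj P := e ()
  obtain ⟨s, h, hh⟩ := Ref.exists_lifts (e.inv ≫ f ≫ (r.toIso c.pt).hom)
  let t := r.comp s
  let e' : c'.pt ≅ (level X E t.idx).obj (s.fn ⋙ P) := e ≪≫ s.toIso P
  have ht := r.toIso_comp s c.pt
  have hf : f ≫ (t.toIso c.pt).hom = e'.hom ≫ (level X E t.idx).map h :=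
    (congrArg (f ≫ ·) ht).trans (comp_square (by simp) hh)
  have hn {F G : X.cat k ⥤ E} (a : F ⟶ G) : (level X E t.idx).map (Functor.whiskerLeft t.fn a) ≫ (t.toIso G).inv =
     (t.toIso F).inv ≫ (level X E k).map a := by
    rw [Iso.comp_inv_eq, Category.assoc, Iso.eq_inv_comp]
    exact (t.toIso_naturality a).symm
  let c₁ := ((Functor.whiskeringLeft _ _ E).obj t.fn).mapCocone c
  have hc₁ : IsColimit c₁ := isColimitOfPreserves ((Functor.whiskeringLeft _ _ E).obj t.fn) hc
  let h' : s.fn ⋙ P ⟶ c₁.pt := h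
  obtain ⟨hd⟩ := (hE t.idx hc₁).pullback h'
  let β : c₁.pullbackDiagram h' ⋙ level X E t.idx ⟶ G ⋙ level X E k :=
    { app := fun j => (level X E t.idx).map (pullback.snd h' (c₁.ι.app j)) ≫ (t.toIso (G.obj j)).inv
      naturality := fun i j m => by
        have h₁ : (c₁.pullbackDiagram h').map m ≫ pullback.snd h' (c₁.ι.app j) =
          pullback.snd h' (c₁.ι.app i) ≫ Functor.whiskerLeft t.fn (G.map m) := pullback.lift_snd _ _ _
        have h₂ := ((level X E t.idx).map_comp _ _).symm.trans (((level X E t.idx).congr_map h₁).trans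
          ((level X E t.idx).map_comp _ _))
        exact comp_square h₂ (hn (G.map m)) }
  refine nonempty_isColimit_of_isPullback α β e'.symm hp (fun j => ?_)
    (isColimitOfPreserves (level X E t.idx) hd)
  refine ((IsPullback.of_hasPullback h' (c₁.ι.app j)).map (level X E t.idx)).of_iso
    (Iso.refl _) e'.symm (t.toIso (G.obj j)).symm (t.toIso c.pt).symm ?_ ?_ ?_ ?_
  · exact (Category.id_comp _).symm
  · exact (Category.id_comp _).symm
  · have := (Iso.eq_inv_comp e').2 hf.symm
    exact (Iso.comp_inv_eq _).2 (this.trans (Category.assoc _ _ _).symm)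
  · exact hn (c.ι.app j)

theorem isUniversalColimit (hE : ∀ (k : X.Idx) {F : J ⥤ X.cat k ⥤ E} {c : Cocone F}, IsColimit c →
    IsUniversalColimit c) {F : J ⥤ Fun X E} {c : Cocone F} (hc : IsColimit c) :
    IsUniversalColimit c := by
  obtain ⟨k, G, ⟨e⟩⟩ := exists_diagram F
  have h := (isUniversalColimit_level hE (colimit.isColimit G)).precompose_isIso e.inv
  exact h.of_iso (h.isColimit.uniqueUpToIso hc)

end ProfiniteGroupoid.Fun

/-! ### Functors with values in finite sets. -/

namespace FintypeCat.Skeleton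

section

variable {A : Type u} [Category.{u} A]

/-- The functor to finite sets isomorphic to a functor with finite values. -/
noncomputable def ofFinite (G : A ⥤ Type u) [∀ x, Finite (G.obj x)] : A ⥤ FintypeCat.Skeleton.{u} where
  obj x := FintypeCat.Skeleton.mk (Nat.card (G.obj x))
  map {x y} m := ofFun fun a => ULift.up (Finite.equivFin _ (G.map m ((Finite.equivFin _).symm a.down)))
  map_id x := hom_ext fun a => by
    rw [G.map_id]
    exact congrArg ULift.up (Equiv.apply_symm_apply _ _)
  map_comp m n := hom_ext fun a => by simp

/-- The elements of the values of `ofFinite G`. -/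
noncomputable def ofFiniteEquiv (G : A ⥤ Type u) [∀ x, Finite (G.obj x)] (x : A) :
    Elem ((ofFinite G).obj x) ≃ G.obj x :=
  Equiv.ulift.trans (Finite.equivFin _).symm

lemma ofFiniteEquiv_naturality (G : A ⥤ Type u) [∀ x, Finite (G.obj x)] {x y : A} (m : x ⟶ y)
    (a : Elem ((ofFinite G).obj x)) : ofFiniteEquiv G y (ap ((ofFinite G).map m) a) =
      G.map m (ofFiniteEquiv G x a) :=
  Equiv.symm_apply_apply _ _

lemma isCoprod_of_bijective {ι : Type*} {y : ι → (A ⥤ FintypeCat.Skeleton.{u})}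
    {p : A ⥤ FintypeCat.Skeleton.{u}} (i : ∀ k, y k ⟶ p)
    (h : ∀ x, Function.Bijective fun s : Σ k, Elem ((y k).obj x) => ap ((i s.1).app x) s.2) :
    IsCoprod i := by
  choose σ hσ using fun x => (h x).2
  refine .of_exists (fun {z} g => ⟨⟨fun x => ofFun fun b => ap ((g (σ x b).1).app x) (σ x b).2,
    fun x x' m => hom_ext fun b => ?_⟩, fun k => ?_⟩) fun {z f g} hfg => ?_
  · have h₁ : σ x' (ap (p.map m) b) = ⟨(σ x b).1, ap ((y _).map m) (σ x b).2⟩ := by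
      apply (h x').1
      rw [hσ]
      have := congrFun ((i (σ x b).1).naturality m) (σ x b).2
      exact (congrArg (ap (p.map m)) (hσ x b)).symm.trans this.symm
    simp only [ap_comp, ap_ofFun]
    rw [h₁]
    exact congrFun ((g (σ x b).1).naturality m) (σ x b).2
  · ext x : 2
    refine hom_ext fun a => ?_
    have h₁ : σ x (ap ((i k).app x) a) = ⟨k, a⟩ := (h x).1 (hσ _ _)
    change ap ((g (σ x (ap ((i k).app x) a)).1).app x) (σ x (ap ((i k).app x) a)).2 = _
    rw [h₁]
  · ext x : 2
    refine hom_ext fun b => ?_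
    rw [← hσ x b]
    exact congrFun (NatTrans.congr_app (hfg (σ x b).1) x) (σ x b).2

end

section

variable {C : Type*} [Category* C] (G : C ⥤ FintypeCat.Skeleton.{u})

lemma exists_of_isPullback [PreservesLimitsOfShape WalkingCospan G] {p a b x : C} {p₁ : p ⟶ a} {p₂ : p ⟶ b} {f : a ⟶ x} {g : b ⟶ x}
    (h : IsPullback p₁ p₂ f g) {u : Elem (G.obj a)} {v : Elem (G.obj b)}
    (huv : ap (G.map f) u = ap (G.map g) v) : ∃ w, ap (G.map p₁) w = u ∧ ap (G.map p₂) w = v :=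
  Types.exists_of_isPullback (h.map (G ⋙ toType)) u v huv

lemma ext_of_isPullback [PreservesLimitsOfShape WalkingCospan G] {p a b x : C} {p₁ : p ⟶ a} {p₂ : p ⟶ b} {f : a ⟶ x} {g : b ⟶ x}
    (h : IsPullback p₁ p₂ f g) {w w' : Elem (G.obj p)} (h₁ : ap (G.map p₁) w = ap (G.map p₁) w')
    (h₂ : ap (G.map p₂) w = ap (G.map p₂) w') : w = w' :=
  Types.ext_of_isPullback (h.map (G ⋙ toType)) h₁ h₂

lemma exists_unique_of_isTerminal [PreservesFiniteLimits G] {t : C} (ht : IsTerminal t) :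
    ∃ a : Elem (G.obj t), ∀ b, b = a := by
  have h := IsTerminal.isTerminalObj (G ⋙ toType) t ht
  have e := (h.uniqueUpToIso Types.isTerminalPUnit).toEquiv
  exact ⟨e.symm ⟨⟩, fun b => e.injective rfl⟩

end

end FintypeCat.Skeleton

section

variable {C : Type u} [Category.{u} C]

/-- A morphism which is sent to surjections by a jointly conservative family of exact functors is a
regular epimorphism. -/
lemma isRegularEpi_of_jointlyReflectIsomorphisms [HasPullbacks C] [HasCoequalizers C] {I : Type*} {G : I → C ⥤ FintypeCat.Skeleton.{u}}
    (hG : JointlyReflectIsomorphisms fun i => G i ⋙ toType)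
    [∀ i, PreservesColimitsOfShape WalkingParallelPair (G i)]
    [∀ i, PreservesLimitsOfShape WalkingCospan (G i)] {x y : C} (f : y ⟶ x)
    (h : ∀ i, Function.Surjective (ap ((G i).map f))) : IsRegularEpi f := by
  let c := coequalizer.π (pullback.fst f f) (pullback.snd f f)
  let m := coequalizer.desc f pullback.condition
  have hm : c ≫ m = f := coequalizer.π_desc _ _
  have hc : pullback.fst f f ≫ c = pullback.snd f f ≫ c := coequalizer.condition _ _
  have : IsIso m := by
    have (i : I) : IsIso ((G i ⋙ toType).map m) := by
      refine (CategoryTheory.isIso_iff_bijective _).2 ⟨fun u v huv => ?_, fun u => ?_⟩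
      · have hs : Function.Surjective (ap ((G i).map c)) := by
          have := isRegularEpi_of_isColimit (isColimitOfPreserves (G i ⋙ toType)
            (coequalizerIsCoequalizer (pullback.fst f f) (pullback.snd f f)))
          exact (epi_iff_surjective ((G i ⋙ toType).map c)).1 inferInstance
        obtain ⟨u, rfl⟩ := hs u
        obtain ⟨v, rfl⟩ := hs v
        have huv' : ap ((G i).map f) u = ap ((G i).map f) v := by
          rw [← hm, Functor.map_comp]
          exact huv
        obtain ⟨t, rfl, rfl⟩ := exists_of_isPullback (G i) (IsPullback.of_hasPullback f f) huv'
        have := (G i).congr_map hc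
        rw [Functor.map_comp, Functor.map_comp] at this
        exact congrFun this t
      · obtain ⟨t, rfl⟩ := h i u
        refine ⟨ap ((G i).map c) t, ?_⟩
        have := (G i).congr_map hm
        rw [Functor.map_comp] at this
        exact congrFun this t
    exact hG.isIso m
  exact ⟨⟨{ W := _, left := pullback.fst f f, right := pullback.snd f f, w := pullback.condition
            isColimit := (coequalizerIsCoequalizer (pullback.fst f f) (pullback.snd f f)).ofIsoColimit
              (Cofork.ext (asIso m) hm) }⟩⟩

lemma isRegularEpi_of_arrowIso {C : Type*} [Category* C] {x y x' y' : C} {f : y ⟶ x} {g : y' ⟶ x'} (e : y ≅ y') (e' : x ≅ x')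
    (w : e.hom ≫ g = f ≫ e'.hom) [IsRegularEpi f] : IsRegularEpi g :=
  ⟨⟨RegularEpi.ofArrowIso (Arrow.isoMk (f := .mk f) (g := .mk g) e e' w) (IsRegularEpi.getStruct f)⟩⟩

instance : FinitaryExtensive FintypeCat.Skeleton.{u} :=
  finitaryExtensive_of_preserves_and_reflects_isomorphism toType

variable (C) in
lemma jointlyReflectIsomorphisms_evaluation : JointlyReflectIsomorphisms
    (fun x : C => (evaluation C FintypeCat.Skeleton.{u}).obj x ⋙ toType) := ⟨fun f hf =>
  have (x : C) : IsIso (f.app x) := have : IsIso (toType.map (f.app x)) := hf x; isIso_of_reflects_iso (f.app x) toType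
  NatIso.isIso_of_isIso_app f⟩

lemma isUniversalColimit_functor {J : Type} [SmallCategory J] [FinCategory J]
    {F : J ⥤ C ⥤ FintypeCat.Skeleton.{u}} {c : Cocone F} (hc : IsColimit c) : IsUniversalColimit c :=
  isUniversalColimit_of_jointlyReflectIsomorphisms (jointlyReflectIsomorphisms_evaluation C) hc

end

namespace ProfiniteGroupoid.Fun

variable {X : ProfiniteGroupoid.{u}}

instance {E : Type u} [Category.{u} E] [HasFiniteLimits E] : HasFiniteLimits (Fun X E) := ⟨fun _ _ _ => inferInstance⟩

instance {E : Type u} [Category.{u} E] [HasFiniteColimits E] : HasFiniteColimits (Fun X E) := ⟨fun _ _ _ => inferInstance⟩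

instance {E : Type u} [Category.{u} E] [HasFiniteLimits E] (k : X.Idx) : PreservesFiniteLimits (level X E k) := ⟨fun _ _ _ => inferInstance⟩

instance {E : Type u} [Category.{u} E] [HasFiniteColimits E] (k : X.Idx) : PreservesFiniteColimits (level X E k) := ⟨fun _ _ _ => inferInstance⟩

lemma isUniversalColimit_skeleton {J : Type} [SmallCategory J] [FinCategory J]
    {F : J ⥤ Fun X FintypeCat.Skeleton.{u}} {c : Cocone F} (hc : IsColimit c) : IsUniversalColimit c :=
  isUniversalColimit (fun _ _ _ => isUniversalColimit_functor) hc

/-- The initial object is the coproduct of two copies of itself, with identities as inclusions;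
universality of this colimit is strictness. -/
instance : HasStrictInitialObjects (Fun X FintypeCat.Skeleton.{u}) :=
  hasStrictInitial_of_isUniversal (isUniversalColimit_skeleton
    (BinaryCofan.IsColimit.mk _ (fun f _ => f) (fun f _ => Category.id_comp f)
      (fun f i => (Category.id_comp f).trans (initialIsInitial.hom_ext f i)) (fun _ _ _ h _ => (Category.id_comp _).symm.trans h)))

lemma isPullback_initial (p q : Fun X FintypeCat.Skeleton.{u}) :
    IsPullback (initial.to p) (initial.to q) (coprod.inl : p ⟶ p ⨿ q) coprod.inr := by
  obtain ⟨k₀⟩ : Nonempty X.Idx := IsCofiltered.nonempty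
  obtain ⟨r, P, ⟨e⟩⟩ := exists_level (κ := Bool) k₀ fun b => bif b then p else q
  have h := (FinitaryExtensive.isPullback_initial_to_binaryCofan
    (coprodIsCoprod (P true) (P false))).map (level X _ r.idx)
  have hi := (initialIsInitial.isInitialObj (level X FintypeCat.Skeleton.{u} r.idx))
  refine h.of_iso (hi.uniqueUpToIso initialIsInitial) (e true).symm (e false).symm
    ((PreservesColimitPair.iso (level X _ r.idx) (P true) (P false)).symm ≪≫ coprod.mapIso (e true).symm (e false).symm)
    (hi.hom_ext _ _) (hi.hom_ext _ _) ?_ ?_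
  · have h₁ : (level X _ r.idx).map coprod.inl ≫ (PreservesColimitPair.iso (level X _ r.idx) (P true) (P false)).inv = coprod.inl :=
      (Iso.comp_inv_eq _).2 (coprodComparison_inl _).symm
    refine (Category.assoc _ _ _).symm.trans ((congrArg (· ≫ _) h₁).trans ?_)
    exact coprod.inl_map _ _
  · have h₁ : (level X _ r.idx).map coprod.inr ≫ (PreservesColimitPair.iso (level X _ r.idx) (P true) (P false)).inv = coprod.inr :=
      (Iso.comp_inv_eq _).2 (coprodComparison_inr _).symm
    refine (Category.assoc _ _ _).symm.trans ((congrArg (· ≫ _) h₁).trans ?_)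
    exact coprod.inr_map _ _

end ProfiniteGroupoid.Fun

section

variable {C : Type u} [Category.{u} C] [HasFiniteLimits C]

lemma IsSplitting.map {D : Type u} [Category.{u} D] [HasFiniteLimits D] (G : C ⥤ D)
    [PreservesFiniteLimits G] [PreservesFiniteCoproducts G] {ι : Type} [Finite ι] {p x : C}
    {e : ι → (p ⟶ x)} (he : IsSplitting e) : IsSplitting fun s => G.map (e s) :=
  (IsCoprod.map G he).of_iso (prodComparison G x p) fun s => by
    apply Limits.prod.hom_ext
    · simp only [Category.assoc, prodComparison_fst, ← G.map_comp, prod.lift_fst]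
    · simp only [Category.assoc, prodComparison_snd, ← G.map_comp, prod.lift_snd, G.map_id]

lemma IsSplitting.exists_iso [HasFiniteCoproducts C] {ι : Type} [Finite ι] {p x : C}
    {e : ι → (p ⟶ x)} (he : IsSplitting e) :
    ∃ φ : x ⨯ p ≅ ∐ fun _ : ι => p, φ.hom ≫ Limits.Sigma.desc (fun _ => 𝟙 p) = prod.snd := by
  let m := IsCoprod.desc he (Limits.Sigma.ι fun _ : ι => p)
  have : IsIso m := IsCoprod.isIso he (IsCoprod.sigma _) m (IsCoprod.fac he _)
  refine ⟨asIso m, IsCoprod.hom_ext he fun s => ?_⟩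
  rw [prod.lift_snd]
  exact (IsCoprod.fac_assoc he _ s _).trans (Limits.Sigma.ι_desc _ _)

end

namespace FintypeCat.Skeleton

variable {C : Type*} [Category* C] (G : C ⥤ FintypeCat.Skeleton.{u})

lemma exists_prod [HasFiniteLimits C] [PreservesFiniteLimits G] {x y : C} (a : Elem (G.obj x)) (b : Elem (G.obj y)) :
    ∃ c, ap (G.map (prod.fst : x ⨯ y ⟶ x)) c = a ∧ ap (G.map (prod.snd : x ⨯ y ⟶ y)) c = b := by
  obtain ⟨t, ht⟩ := exists_unique_of_isTerminal G (terminalIsTerminal (C := C))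
  exact exists_of_isPullback G (IsPullback.of_is_product' (prodIsProd x y) terminalIsTerminal)
    ((ht _).trans (ht _).symm)

lemma prod_ext [HasFiniteLimits C] [PreservesFiniteLimits G] {x y : C} {c d : Elem (G.obj (x ⨯ y))}
    (h₁ : ap (G.map (prod.fst : x ⨯ y ⟶ x)) c = ap (G.map (prod.fst : x ⨯ y ⟶ x)) d)
    (h₂ : ap (G.map (prod.snd : x ⨯ y ⟶ y)) c = ap (G.map (prod.snd : x ⨯ y ⟶ y)) d) : c = d :=
  ext_of_isPullback G (IsPullback.of_is_product' (prodIsProd x y) terminalIsTerminal) h₁ h₂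

lemma ap_map_comp {x y z : C} (f : x ⟶ y) (g : y ⟶ z) (a : Elem (G.obj x)) :
    ap (G.map (f ≫ g)) a = ap (G.map g) (ap (G.map f) a) := by
  rw [G.map_comp, ap_comp]

lemma ap_map_eq {x y z : C} {f : x ⟶ y} {g : y ⟶ z} {h : x ⟶ z} (w : f ≫ g = h)
    (a : Elem (G.obj x)) : ap (G.map g) (ap (G.map f) a) = ap (G.map h) a := by
  rw [← w, ap_map_comp]

section Yoneda

variable {A : Type u} [Category.{u} A]

lemma ap_naturality {F F' : A ⥤ FintypeCat.Skeleton.{u}} (η : F ⟶ F') {x y : A} (m : x ⟶ y)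
    (a : Elem (F.obj x)) : ap (η.app y) (ap (F.map m) a) = ap (F'.map m) (ap (η.app x) a) :=
  congrFun (η.naturality m) a

variable [h : ∀ x y : A, Finite (x ⟶ y)]

/-- The functor represented by `x`. -/
noncomputable def hom (x : A) : A ⥤ FintypeCat.Skeleton.{u} := ofFinite (coyoneda.obj (.op x))

/-- The elements of the values of the functor represented by `x`. -/
noncomputable def homEquiv (x y : A) : Elem ((hom x).obj y) ≃ (x ⟶ y) :=
  ofFiniteEquiv (coyoneda.obj (.op x)) y

lemma ap_hom_map (x : A) {y z : A} (m : y ⟶ z) (f : x ⟶ y) :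
    ap ((hom x).map m) ((homEquiv x y).symm f) = (homEquiv x z).symm (f ≫ m) := by
  apply (homEquiv x z).injective
  exact (ofFiniteEquiv_naturality (coyoneda.obj (.op x)) m _).trans
    ((congrArg (· ≫ m) ((homEquiv x y).apply_symm_apply f)).trans
      ((homEquiv x z).apply_symm_apply _).symm)

/-- The natural transformation given by an element. -/
noncomputable def homDesc (F : A ⥤ FintypeCat.Skeleton.{u}) {x : A} (a : Elem (F.obj x)) : hom x ⟶ F where
  app y := ofFun fun b => ap (F.map (homEquiv x y b)) a
  naturality y z m := hom_ext fun b => by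
    obtain ⟨f, rfl⟩ := (homEquiv x y).symm.surjective b
    rw [ap_comp, ap_comp, ap_hom_map, ap_ofFun, ap_ofFun, Equiv.apply_symm_apply,
      Equiv.apply_symm_apply, ap_map_comp]

@[simp]
lemma ap_homDesc (F : A ⥤ FintypeCat.Skeleton.{u}) {x : A} (a : Elem (F.obj x)) {y : A} (f : x ⟶ y) :
    ap ((homDesc F a).app y) ((homEquiv x y).symm f) = ap (F.map f) a :=
  congrArg (fun m => ap (F.map m) a) ((homEquiv x y).apply_symm_apply f)

lemma homDesc_ext {F : A ⥤ FintypeCat.Skeleton.{u}} {x : A} {η θ : hom x ⟶ F}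
    (h : ap (η.app x) ((homEquiv x x).symm (𝟙 x)) = ap (θ.app x) ((homEquiv x x).symm (𝟙 x))) : η = θ := by
  ext y : 2
  refine hom_ext fun b => ?_
  obtain ⟨f, rfl⟩ := (homEquiv x y).symm.surjective b
  rw [← Category.id_comp f, ← ap_hom_map, ap_naturality, ap_naturality, h]

/-- Over an element `f : x ⟶ y` of the representable functor, `F.map f` is a bijection between the
fibers of `F` at `x` and at `y`. So the representable functor at `x` trivializes `F`, with the
elements of `F.obj x` as sections. -/
lemma isSplitting_homDesc (hA : IsGroupoid A) (F : A ⥤ FintypeCat.Skeleton.{u}) (x : A) :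
    IsSplitting fun i : Fin (F.obj x).len => homDesc F (ULift.up i : Elem (F.obj x)) := by
  refine isCoprod_of_bijective _ fun y => ?_
  let G := (evaluation A FintypeCat.Skeleton.{u}).obj y
  have h₁ (a : Elem (F.obj x)) (f : x ⟶ y) : ap (G.map (prod.fst : F ⨯ hom x ⟶ F))
      (ap ((prod.lift (homDesc F a) (𝟙 (hom x))).app y) ((homEquiv x y).symm f)) = ap (F.map f) a :=
    (ap_map_eq G (prod.lift_fst _ _) _).trans (ap_homDesc F a f)
  have h₂ (a : Elem (F.obj x)) (b : Elem ((hom x).obj y)) : ap (G.map (prod.snd : F ⨯ hom x ⟶ hom x))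
      (ap ((prod.lift (homDesc F a) (𝟙 (hom x))).app y) b) = b :=
    (ap_map_eq G (prod.lift_snd (homDesc F a) (𝟙 (hom x))) _).trans (congrFun (G.map_id (hom x)) b)
  refine ⟨?_, fun c => ?_⟩
  · rintro ⟨i, b⟩ ⟨j, c⟩ h
    obtain rfl : b = c := (h₂ _ b).symm.trans ((congrArg _ h).trans (h₂ _ c))
    obtain ⟨f, rfl⟩ := (homEquiv x y).symm.surjective b
    have := (h₁ _ f).symm.trans ((congrArg _ h).trans (h₁ _ f))
    have hf := hA.all_isIso f
    have := (bijective_of_isIso (F.map f)).1 this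
    obtain rfl := congrArg ULift.down this
    rfl
  · obtain ⟨f, hf⟩ := (homEquiv x y).symm.surjective (ap (G.map (prod.snd : F ⨯ hom x ⟶ hom x)) c)
    have := hA.all_isIso f
    obtain ⟨⟨i⟩, hi⟩ := (bijective_of_isIso (F.map f)).2 (ap (G.map (prod.fst : F ⨯ hom x ⟶ F)) c)
    refine ⟨⟨i, (homEquiv x y).symm f⟩, prod_ext G ((h₁ _ f).trans hi) ((h₂ _ _).trans hf)⟩

end Yoneda

end FintypeCat.Skeleton

lemma IsFiniteGroupoid.finite_hom {A : Type u} [Category.{u} A] (hA : IsFiniteGroupoid A) (x y : A) :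
    Finite (x ⟶ y) := by
  have := hA.isGroupoid
  have := hA.finite_aut x
  obtain h | ⟨⟨f⟩⟩ := isEmpty_or_nonempty (x ⟶ y)
  · infer_instance
  · refine Finite.of_injective (β := Aut x) (fun g => (asIso g) ≪≫ (asIso f).symm) fun g g' h => ?_
    have := congrArg Iso.hom h
    simpa using this

/-- Representatives of the isomorphism classes of a finite groupoid. -/
lemma IsFiniteGroupoid.exists_representatives {A : Type u} [Category.{u} A] (hA : IsFiniteGroupoid A) :
    ∃ (n : ℕ) (r : Fin n → A), ∀ x, ∃ i, Nonempty (r i ⟶ x) := by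
  have := hA.finite_isoClasses
  refine ⟨_, fun i => ((Finite.equivFin (Quotient (isIsomorphicSetoid A))).symm i).out, fun x =>
    ⟨Finite.equivFin _ ⟦x⟧, ?_⟩⟩
  dsimp only
  rw [Equiv.symm_apply_apply]
  obtain ⟨e⟩ := Quotient.mk_out (s := isIsomorphicSetoid A) x
  exact ⟨e.hom⟩

/-! ### The category of functors to finite sets is Galois, and precomposition is exact. -/

namespace ProfiniteGroupoid

open Fun

variable (X : ProfiniteGroupoid.{u})

instance isGroupoid_cat (k : X.Idx) : IsGroupoid (X.cat k) := (X.finite ⟨k⟩).isGroupoid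

instance finite_hom (k : X.Idx) (x y : X.cat k) : Finite (x ⟶ y) := (X.finite ⟨k⟩).finite_hom x y

/-- Every object receives a map from some `r i`, so the coproduct of these representables is
pointwise nonempty and its map to the terminal object is a regular epimorphism. `level` preserves
this, and Beck's theorem applies. -/
lemma isEffectiveDescent_terminal {n : ℕ} {k : X.Idx} {r : Fin n → X.cat k}
    (hr : ∀ x, ∃ i, Nonempty (r i ⟶ x)) :
    IsEffectiveDescent (terminal.from (∐ fun i => (level X FintypeCat.Skeleton.{u} k).obj (hom (r i)))) := by
  let t := terminal.from (∐ fun i => hom (r i))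
  have ht : IsRegularEpi t := by
    refine isRegularEpi_of_jointlyReflectIsomorphisms
      (jointlyReflectIsomorphisms_evaluation (X.cat k)) t fun x b => ?_
    let G := (evaluation (X.cat k) FintypeCat.Skeleton.{u}).obj x
    obtain ⟨a, ha⟩ := exists_unique_of_isTerminal G terminalIsTerminal
    obtain ⟨i, ⟨f⟩⟩ := hr x
    exact ⟨ap (G.map (Limits.Sigma.ι (fun i => hom (r i)) i)) ((homEquiv _ _).symm f),
      (ha _).trans (ha _).symm⟩
  let L := level X FintypeCat.Skeleton.{u} k
  have h₁ : IsRegularEpi (L.map t) :=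
    isRegularEpi_of_isColimit (isColimitOfPreserves L (IsRegularEpi.isColimit t))
  have h₂ := isRegularEpi_of_arrowIso (PreservesCoproduct.iso L fun i => hom (r i)) (PreservesTerminal.iso L)
    (f := L.map t) (g := terminal.from _) (terminal.hom_ext _ _)
  exact isEffectiveDescent_of_isRegularEpi isUniversalColimit_skeleton _

instance isGaloisCategory : IsGaloisCategory (Fun X FintypeCat.Skeleton.{u}) where
  disjoint := isPullback_initial
  distributive f := ⟨fun _ => preservesColimitsOfShape_overPullback isUniversalColimit_skeleton f⟩
  locally_split p := by
    obtain ⟨k₀⟩ : Nonempty X.Idx := IsCofiltered.nonempty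
    obtain ⟨s, P, ⟨e⟩⟩ := exists_level (κ := Unit) k₀ fun _ => p
    let k := s.idx
    -- The splitting cover consists of the representables at representatives of the isomorphism
    -- classes, on a level `k` at which `p` is defined.
    obtain ⟨n, r, hr⟩ := (X.finite ⟨k⟩).exists_representatives
    refine ⟨n, fun i => (level X _ k).obj (hom (r i)), fun i => ((P ()).obj (r i)).len,
      X.isEffectiveDescent_terminal hr, fun i => ?_⟩
    have := (isSplitting_homDesc (X.isGroupoid_cat k) (P ()) (r i)).map (level X _ k)
    obtain ⟨φ, hφ⟩ := this.exists_iso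
    refine ⟨prod.mapIso (e ()) (Iso.refl _) ≪≫ φ, ?_⟩
    refine (Category.assoc _ _ _).trans ((congrArg _ hφ).trans ?_)
    exact (prod.map_snd _ _).trans (Category.comp_id _)

end ProfiniteGroupoid

namespace ProfiniteGroupoid

open Fun

variable {X Y : ProfiniteGroupoid.{u}} {E : Type u} [Category.{u} E]

variable (E) in
/-- Precomposition with an object of `Fun X H`. -/
noncomputable def Fun.pre {H : Type u} [Category.{u} H] (p : Fun X H) : (H ⥤ E) ⥤ Fun X E :=
  (Functor.whiskeringLeft _ _ E).obj p.fib ⋙ level X E p.idx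

/-- Precomposition with a morphism of profinite groupoids, on functors on a given level. -/
noncomputable def levelCompEv (f : Hom X Y) (j : Y.Idx) :
    level Y E j ⋙ f.ev E ≅ (f.obj j).pre E :=
  NatIso.ofComponents (fun _ => Iso.refl _) fun α => Hom.aux_sq (f.ev_ι_vert α)

variable (J : Type) [SmallCategory J] [FinCategory J]

/-- A finite diagram is defined at some level, and on a level `f.ev E` is whiskering with `(f.obj
j).fib` followed by `level`. Both preserve the limit. -/
instance preservesLimitsOfShape_ev (f : Hom X Y) [HasLimitsOfShape J E] :
    PreservesLimitsOfShape J (f.ev E) where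
  preservesLimit {K} := by
    obtain ⟨j, F, ⟨e⟩⟩ := exists_diagram K
    have : PreservesLimit (F ⋙ level Y E j) (f.ev E) :=
      have : PreservesLimitsOfShape J ((f.obj j).pre E) := inferInstanceAs
        (PreservesLimitsOfShape J ((Functor.whiskeringLeft _ _ E).obj (f.obj j).fib ⋙ level X E (f.obj j).idx))
      have := preservesLimitsOfShape_of_natIso (J := J) (levelCompEv (E := E) f j).symm
      preservesLimit_of_preserves_limit_cone (isLimitOfPreserves (level Y E j) (limit.isLimit F))
        (isLimitOfPreserves (level Y E j ⋙ f.ev E) (limit.isLimit F))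
    exact preservesLimit_of_iso_diagram _ e

instance preservesColimitsOfShape_ev (f : Hom X Y) [HasColimitsOfShape J E] :
    PreservesColimitsOfShape J (f.ev E) where
  preservesColimit {K} := by
    obtain ⟨j, F, ⟨e⟩⟩ := exists_diagram K
    have : PreservesColimit (F ⋙ level Y E j) (f.ev E) :=
      have : PreservesColimitsOfShape J ((f.obj j).pre E) := inferInstanceAs
        (PreservesColimitsOfShape J ((Functor.whiskeringLeft _ _ E).obj (f.obj j).fib ⋙ level X E (f.obj j).idx))
      have := preservesColimitsOfShape_of_natIso (J := J) (levelCompEv (E := E) f j).symm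
      preservesColimit_of_preserves_colimit_cocone (isColimitOfPreserves (level Y E j) (colimit.isColimit F))
        (isColimitOfPreserves (level Y E j ⋙ f.ev E) (colimit.isColimit F))
    exact preservesColimit_of_iso_diagram _ e

theorem sendsToGalois : SendsToGalois.{u} where
  obj X := isGaloisCategory X
  map f :=
    have : PreservesFiniteLimits (Hom.ev f FintypeCat.Skeleton.{u}) :=
      ⟨fun J _ _ => preservesLimitsOfShape_ev J f⟩
    have : PreservesFiniteCoproducts (Hom.ev f FintypeCat.Skeleton.{u}) :=
      ⟨fun n => preservesColimitsOfShape_ev (Discrete (Fin n)) f⟩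
    have : PreservesColimitsOfShape WalkingParallelPair (Hom.ev f FintypeCat.Skeleton.{u}) :=
      preservesColimitsOfShape_ev _ f
    IsGaloisFunctor.of_preserves (Hom.ev f FintypeCat.Skeleton.{u})

end ProfiniteGroupoid

/-! ### Exact functors on functors to finite sets, determined on representables. -/

namespace FintypeCat.Skeleton

section

variable {C : Type u} [Category.{u} C] (G : C ⥤ FintypeCat.Skeleton.{u}) [PreservesFiniteCoproducts G]

lemma bijective_of_isCoprod {ι : Type} [Finite ι] {x : ι → C} {p : C} {i : ∀ k, x k ⟶ p}
    (h : IsCoprod i) : Function.Bijective fun s : Σ k, Elem (G.obj (x k)) => ap (G.map (i s.1)) s.2 := by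
  obtain ⟨h⟩ := h
  have h' := isColimitCofanMkObjOfIsColimit (G ⋙ toType) _ _ h
  let e := h'.coconePointUniqueUpToIso (Types.coproductColimitCocone fun k => (G ⋙ toType).obj (x k)).isColimit
  have he (k : ι) (a : Elem (G.obj (x k))) : e.toEquiv (ap (G.map (i k)) a) = ⟨k, a⟩ :=
    ConcreteCategory.congr_hom (h'.comp_coconePointUniqueUpToIso_hom (Types.coproductColimitCocone fun k =>
      (G ⋙ toType).obj (x k)).isColimit ⟨k⟩) a
  refine ⟨fun s t hst => ?_, fun a => ⟨e.toEquiv a, e.toEquiv.injective (he _ _)⟩⟩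
  exact (he _ _).symm.trans ((congrArg _ hst).trans (he _ _))

end

variable {A : Type u} [Category.{u} A] [∀ x y : A, Finite (x ⟶ y)]

lemma homDesc_comp {F F' : A ⥤ FintypeCat.Skeleton.{u}} {x : A} (a : Elem (F.obj x)) (f : F ⟶ F') :
    homDesc F a ≫ f = homDesc F' (ap (f.app x) a) :=
  homDesc_ext (by
    rw [ap_homDesc, NatTrans.comp_app, ap_comp, ap_homDesc, ap_naturality])

variable (A) in
/-- The Yoneda embedding, with values in functors to finite sets. -/
noncomputable def homFunctor : Aᵒᵖ ⥤ A ⥤ FintypeCat.Skeleton.{u} where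
  obj x := hom x.unop
  map {x y} m := homDesc _ ((homEquiv y.unop x.unop).symm m.unop)
  map_id x := homDesc_ext (by rw [ap_homDesc, ap_hom_map]; simp [ap_id])
  map_comp {x y z} m n := by
    rw [homDesc_comp, ap_homDesc, ap_hom_map]
    rfl

lemma homDesc_id (x : A) : homDesc (hom x) ((homEquiv x x).symm (𝟙 x)) = 𝟙 (hom x) :=
  (homFunctor A).map_id (.op x)

section Cover

variable {n : ℕ} (r : Fin n → A)

/-- The canonical morphism to `F` from a coproduct of representable functors. -/
noncomputable def cover (F : A ⥤ FintypeCat.Skeleton.{u}) :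
    (∐ fun s : Σ i, Fin (F.obj (r i)).len => hom (r s.1)) ⟶ F :=
  Limits.Sigma.desc fun s => homDesc F (ULift.up s.2 : Elem (F.obj (r s.1)))

lemma ι_cover (F : A ⥤ FintypeCat.Skeleton.{u}) {i : Fin n} (a : Elem (F.obj (r i))) :
    Limits.Sigma.ι (fun s : Σ i, Fin (F.obj (r i)).len => hom (r s.1)) ⟨i, a.down⟩ ≫ cover r F =
      homDesc F a :=
  Limits.Sigma.ι_desc _ _

variable {r} (hr : ∀ x, ∃ i, Nonempty (r i ⟶ x)) (hA : IsGroupoid A)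
include hr hA

/-- An element of `F.obj x` is transported back along an isomorphism `r i ⟶ x` to an element of
`F.obj (r i)`, which indexes a summand of the cover. -/
lemma isRegularEpi_cover (F : A ⥤ FintypeCat.Skeleton.{u}) : IsRegularEpi (cover r F) := by
  refine isRegularEpi_of_jointlyReflectIsomorphisms
    (jointlyReflectIsomorphisms_evaluation A) _ fun x b => ?_
  let G := (evaluation A FintypeCat.Skeleton.{u}).obj x
  obtain ⟨i, ⟨f⟩⟩ := hr x
  have := hA.all_isIso f
  obtain ⟨a, rfl⟩ := (bijective_of_isIso (F.map f)).2 b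
  refine ⟨ap (G.map (Limits.Sigma.ι (fun s : Σ i, Fin (F.obj (r i)).len => hom (r s.1)) ⟨i, a.down⟩))
    ((homEquiv (r i) x).symm f), ?_⟩
  refine (ap_map_eq G (ι_cover r F a) _).trans ?_
  exact ap_homDesc F a f

variable {D : Type u} [Category.{u} D] (G : (A ⥤ FintypeCat.Skeleton.{u}) ⥤ D) [PreservesFiniteCoproducts G]
  (hG : ∀ {F F' : A ⥤ FintypeCat.Skeleton.{u}} (f : F ⟶ F'), IsRegularEpi f → IsRegularEpi (G.map f))
include hG

lemma map_hom_ext {F : A ⥤ FintypeCat.Skeleton.{u}} {z : D} {u v : G.obj F ⟶ z}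
    (h : ∀ i (a : Elem (F.obj (r i))), G.map (homDesc F a) ≫ u = G.map (homDesc F a) ≫ v) : u = v := by
  have := hG _ (isRegularEpi_cover hr hA F)
  rw [← cancel_epi (G.map (cover r F))]
  refine (IsCoprod.map G (IsCoprod.sigma _)).hom_ext fun s => ?_
  rw [← G.map_comp_assoc, ← G.map_comp_assoc]
  have := ι_cover r F (ULift.up s.2 : Elem (F.obj (r s.1)))
  exact (congrArg (fun t => G.map t ≫ u) this).trans ((h _ _).trans
    (congrArg (fun t => G.map t ≫ v) this).symm)

/-- A natural transformation between exact functors is determined by its values at representable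
functors. -/
theorem exists_natTrans [PreservesLimitsOfShape WalkingCospan G] (G' : (A ⥤ FintypeCat.Skeleton.{u}) ⥤ D)
    (η : ∀ i, G.obj (hom (r i)) ⟶ G'.obj (hom (r i)))
    (hη : ∀ {i j} (m : r i ⟶ r j), G.map ((homFunctor A).map m.op) ≫ η i =
      η j ≫ G'.map ((homFunctor A).map m.op)) :
    ∃ θ : G ⟶ G', ∀ i, θ.app (hom (r i)) = η i := by
  have key (F : A ⥤ FintypeCat.Skeleton.{u}) : ∃ t : G.obj F ⟶ G'.obj F,
      ∀ i (a : Elem (F.obj (r i))), G.map (homDesc F a) ≫ t = η i ≫ G'.map (homDesc F a) := by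
    have hc := IsCoprod.map G (IsCoprod.sigma fun s : Σ i, Fin (F.obj (r i)).len => hom (r s.1))
    let t := hc.desc fun s => η s.1 ≫ G'.map (homDesc F (ULift.up s.2 : Elem (F.obj (r s.1))))
    -- By pointwise decomposition of the coproduct, `c` is a summand together with an arrow between
    -- representatives; the hypothesis `hη` for this arrow gives the naturality.
    have ht {j} (c) : G.map (homDesc _ c) ≫ t = η j ≫ G'.map (homDesc _ c ≫ cover r F) := by
      obtain ⟨⟨s, b⟩, rfl⟩ := (bijective_of_isCoprod ((evaluation A FintypeCat.Skeleton.{u}).obj (r j))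
        (IsCoprod.sigma fun s : Σ i, Fin (F.obj (r i)).len => hom (r s.1))).2 c
      obtain ⟨m, rfl⟩ := (homEquiv (r s.1) (r j)).symm.surjective b
      have h₁ := homDesc_comp ((homEquiv (r s.1) (r j)).symm m)
        (Limits.Sigma.ι (fun s : Σ i, Fin (F.obj (r i)).len => hom (r s.1)) s)
      have h₂ : _ ≫ cover r F = _ := ι_cover r F (ULift.up s.2 : Elem (F.obj (r s.1)))
      refine (congrArg (fun z => G.map z ≫ t) h₁.symm).trans (Eq.trans ?_
        (congrArg (fun z => η j ≫ G'.map (z ≫ cover r F)) h₁))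
      rw [Category.assoc]
      refine Eq.trans ?_ (congrArg (fun z => η j ≫ G'.map (_ ≫ z)) h₂.symm)
      rw [G.map_comp, Category.assoc]
      refine (congrArg _ (hc.fac _ s)).trans ?_
      rw [G'.map_comp]
      have h₃ := hη m
      exact (Category.assoc _ _ _).symm.trans ((congrArg (· ≫ _) h₃).trans (Category.assoc _ _ _))
    have h₁ : G.map (pullback.fst (cover r F) (cover r F)) ≫ t =
        G.map (pullback.snd (cover r F) (cover r F)) ≫ t := by
      refine map_hom_ext hr hA G hG fun i a => ?_
      rw [← G.map_comp_assoc, ← G.map_comp_assoc, homDesc_comp, homDesc_comp, ht, ht, ← homDesc_comp,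
        ← homDesc_comp, Category.assoc, Category.assoc, pullback.condition]
    have hp := (IsPullback.of_hasPullback (cover r F) (cover r F)).map G
    -- The image of the cover is the coequalizer of some pair, not necessarily of its kernel pair.
    -- That pair factors through the image under `G` of the kernel pair, which `t` equalizes.
    obtain ⟨⟨s⟩⟩ := hG _ (isRegularEpi_cover hr hA F)
    have h₂ : s.left ≫ t = s.right ≫ t := by
      rw [← hp.lift_fst _ _ s.w, Category.assoc, h₁, hp.lift_snd_assoc]
    refine ⟨Cofork.IsColimit.desc s.isColimit t h₂, fun i a => ?_⟩
    rw [← ι_cover r F a, G.map_comp, Category.assoc]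
    refine (congrArg _ (Cofork.IsColimit.π_desc' s.isColimit t h₂)).trans ?_
    rw [ι_cover]
    exact hc.fac _ _
  choose t ht using key
  refine ⟨⟨t, fun F F' f => map_hom_ext hr hA G hG fun i a => ?_⟩, fun i => ?_⟩
  · rw [← G.map_comp_assoc, homDesc_comp, ht, ← homDesc_comp, G'.map_comp, reassoc_of% ht]
  · have := ht _ i ((homEquiv (r i) (r i)).symm (𝟙 (r i)))
    rw [homDesc_id] at this
    simpa using this

end Cover

/-- A natural family of maps between the functors represented by representatives of the isomorphism
classes of a groupoid comes from a natural transformation. -/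
lemma exists_whiskerRight_eq (hA : IsGroupoid A) {n : ℕ} {r : Fin n → A} (hr : ∀ x, ∃ i, Nonempty (r i ⟶ x)) {B : Type*} [Category* B]
    {P Q : B ⥤ A} (h : ∀ i, P ⋙ hom (r i) ⟶ Q ⋙ hom (r i))
    (hh : ∀ {i j} (m : r i ⟶ r j), Functor.whiskerLeft P ((homFunctor A).map m.op) ≫ h i =
      h j ≫ Functor.whiskerLeft Q ((homFunctor A).map m.op)) :
    ∃ g : P ⟶ Q, ∀ i, Functor.whiskerRight g (hom (r i)) = h i := by
  -- The given maps are read as an operation on arrows out of the representatives, natural in the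
  -- representative and in `x`.
  let φ {x : B} {i} (u : r i ⟶ P.obj x) : r i ⟶ Q.obj x :=
    homEquiv _ _ (ap ((h i).app x) ((homEquiv _ _).symm u))
  have hφ₁ {x : B} {i j} (m : r i ⟶ r j) (u : r j ⟶ P.obj x) : φ (m ≫ u) = m ≫ φ u := by
    have h₁ := congrFun (NatTrans.congr_app (hh m) x) ((homEquiv _ _).symm u)
    apply (homEquiv _ _).symm.injective
    refine ((homEquiv _ _).symm_apply_apply _).trans ?_
    have h₂ := ap_homDesc (hom (r i)) ((homEquiv _ _).symm m) u
    rw [ap_hom_map] at h₂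
    refine (congrArg (ap ((h i).app x)) h₂.symm).trans (Eq.trans h₁ ?_)
    obtain ⟨v, hv⟩ := (homEquiv _ _).symm.surjective (ap ((h j).app x) ((homEquiv _ _).symm u))
    have h₃ := ap_homDesc (hom (r i)) ((homEquiv _ _).symm m) v
    rw [ap_hom_map] at h₃
    have hv' : φ u = v := (congrArg (homEquiv _ _) hv.symm).trans ((homEquiv _ _).apply_symm_apply v)
    rw [hv']
    refine Eq.trans ?_ h₃
    exact congrArg (ap (((homFunctor A).map m.op).app (Q.obj x))) hv.symm
  have hφ₂ {x y : B} {i} (u : r i ⟶ P.obj x) (m : x ⟶ y) : φ (u ≫ P.map m) = φ u ≫ Q.map m := by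
    have h₁ := congrFun ((h i).naturality m) ((homEquiv _ _).symm u)
    apply (homEquiv _ _).symm.injective
    refine ((homEquiv _ _).symm_apply_apply _).trans ?_
    refine (congrArg (ap ((h i).app y)) (ap_hom_map (r i) (P.map m) u).symm).trans (Eq.trans h₁ ?_)
    refine Eq.trans ?_ (ap_hom_map (r i) (Q.map m) (φ u))
    exact congrArg (ap ((hom (r i)).map (Q.map m))) ((homEquiv _ _).symm_apply_apply _).symm
  choose k u using hr
  have u (x : A) : r (k x) ⟶ x := (u x).some
  have hu (x : A) : IsIso (u x) := hA.all_isIso _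
  -- As in the Yoneda lemma, but evaluated at a chosen isomorphism from a representative instead of
  -- at an identity; `hg` shows that the choice is immaterial.
  let g (x : B) : P.obj x ⟶ Q.obj x := inv (u (P.obj x)) ≫ φ (u (P.obj x))
  have hg {x : B} {i} (v : r i ⟶ P.obj x) : φ v = v ≫ g x := by
    have := hφ₁ (v ≫ inv (u (P.obj x))) (u (P.obj x))
    simpa [g] using this
  refine ⟨⟨g, fun x y m => ?_⟩, fun i => ?_⟩
  · rw [← cancel_epi (u (P.obj x))]
    exact (Category.assoc _ _ _).symm.trans ((hg _).symm.trans ((hφ₂ _ _).trans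
      ((congrArg (· ≫ Q.map m) (hg _)).trans (Category.assoc _ _ _))))
  · ext x : 2
    refine hom_ext fun b => ?_
    obtain ⟨v, rfl⟩ := (homEquiv _ _).symm.surjective b
    refine (ap_hom_map (r i) (g x) v).trans ?_
    rw [← hg]
    exact (homEquiv _ _).symm_apply_apply _

end FintypeCat.Skeleton

lemma CategoryTheory.cube_eq {C : Type*} [Category* C] {a a' b b' c c' d d' : C} {f : a ⟶ b} {f' : a' ⟶ b'}
    {g : c ⟶ d} {g' : c' ⟶ d'} {p : a ⟶ a'} {q : b ⟶ b'} {r : c ⟶ c'} {s : d ⟶ d'} {h : b ⟶ d} {k : a ⟶ c}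
    {h' : b' ⟶ d'} {k' : a' ⟶ c'} [Epi p] (h₁ : f ≫ q = p ≫ f') (h₂ : g ≫ s = r ≫ g')
    (h₃ : f ≫ h = k ≫ g) (h₄ : h ≫ s = q ≫ h') (h₅ : k ≫ r = p ≫ k') : f' ≫ h' = k' ≫ g' := by
  rw [← cancel_epi p, ← reassoc_of% h₁, ← h₄, reassoc_of% h₃, h₂, reassoc_of% h₅]

/-! ### Full faithfulness of precomposition for a finite groupoid. -/

namespace ProfiniteGroupoid.Fun

variable {X : ProfiniteGroupoid.{u}} {E : Type u} [Category.{u} E] {H : Type u} [Category.{u} H]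

instance (J : Type) [SmallCategory J] [FinCategory J] [HasLimitsOfShape J E] (p : Fun X H) :
    PreservesLimitsOfShape J (p.pre E) :=
  inferInstanceAs (PreservesLimitsOfShape J ((Functor.whiskeringLeft _ _ E).obj p.fib ⋙ level X E p.idx))

instance (J : Type) [SmallCategory J] [FinCategory J] [HasColimitsOfShape J E] (p : Fun X H) :
    PreservesColimitsOfShape J (p.pre E) :=
  inferInstanceAs (PreservesColimitsOfShape J ((Functor.whiskeringLeft _ _ E).obj p.fib ⋙ level X E p.idx))

instance [HasFiniteColimits E] (p : Fun X H) : PreservesFiniteCoproducts (p.pre E) :=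
  ⟨fun _ => inferInstance⟩

variable (X E H) in
/-- Precomposition with objects of `Fun X H`, as a functor. -/
noncomputable def preFunctor : Fun X H ⥤ (H ⥤ E) ⥤ Fun X E where
  obj p := p.pre E
  map m :=
    { app := fun A => (map A).map m
      naturality := fun _ _ α => ((map₂ α).naturality m).symm }
  map_id p := NatTrans.ext (funext fun A => (map A).map_id p)
  map_comp m n := NatTrans.ext (funext fun A => (map A).map_comp m n)

lemma map_level_map {k : X.Idx} {P Q : X.cat k ⥤ H} (h : P ⟶ Q) (A : H ⥤ E) :
    (map A).map ((level X H k).map h) = (level X E k).map (Functor.whiskerRight h A) :=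
  (map_ι A (El.vert h)).trans (congrArg (ι X E).map (El.map_vert h A))

lemma map_toIso {k : X.Idx} (r : Ref X k) (P : X.cat k ⥤ H) (A : H ⥤ E) :
    (map A).map (r.toIso P).hom = (r.toIso (P ⋙ A)).hom :=
  map_ι A (r.el P)

lemma map_lifts {k : X.Idx} {r : Ref X k} {P Q : X.cat k ⥤ H} {m : (level X H k).obj P ⟶ (level X H k).obj Q}
    {h : r.fn ⋙ P ⟶ r.fn ⋙ Q} (hm : r.Lifts m h) (A : H ⥤ E) :
    Ref.Lifts r (F := P ⋙ A) (G := Q ⋙ A) ((map A).map m) (Functor.whiskerRight h A) := by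
  have h₁ := ((map A).map_comp _ _).symm.trans (((map A).congr_map hm).trans ((map A).map_comp _ _))
  have h₂ := map_level_map h A
  have h₃ := map_toIso r P A
  have h₄ := map_toIso r Q A
  exact (congrArg ((map A).map m ≫ ·) h₄.symm).trans (h₁.trans (congrArg₂ (· ≫ ·) h₃ h₂))

variable (hH : IsFiniteGroupoid H)
include hH

/-- Testing against the finitely many representables at representatives is enough: at a common finer
index, evaluation at an arrow `u` from a representative shows that the components agree after
composition with the isomorphism `u`. -/
lemma pre_ext_level {k : X.Idx} {P Q : X.cat k ⥤ H} {m m' : (level X H k).obj P ⟶ (level X H k).obj Q}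
    (h : ∀ A : H ⥤ FintypeCat.Skeleton.{u}, (map A).map m = (map A).map m') : m = m' := by
  have := hH.finite_hom
  have := hH.isGroupoid
  obtain ⟨n, r, hr⟩ := hH.exists_representatives
  obtain ⟨s, g, hg⟩ := exists_lifts_family (κ := Bool) (F := fun _ => P) (G := fun _ => Q)
    fun b => bif b then m else m'
  have h₁ (i : Fin n) : (level X _ s.idx).map (Functor.whiskerRight (g true) (hom (r i))) =
      (level X _ s.idx).map (Functor.whiskerRight (g false) (hom (r i))) := by
    have h₁ := map_lifts (hg true) (hom (r i))
    have h₂ := map_lifts (hg false) (hom (r i))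
    exact (cancel_epi (s.toIso (P ⋙ hom (r i))).hom).1 (h₁.symm.trans ((congrArg (· ≫ _) (h (hom (r i)))).trans h₂))
  obtain ⟨t, ht⟩ := exists_eq_family h₁
  have h₂ : Functor.whiskerLeft t.fn (g true) = Functor.whiskerLeft t.fn (g false) := by
    ext x
    obtain ⟨i, ⟨u⟩⟩ := hr ((t.fn ⋙ s.fn ⋙ P).obj x)
    rw [← cancel_epi u]
    have h₃ := congrFun (NatTrans.congr_app (ht i) x) ((homEquiv _ _).symm u)
    have h₄ := ap_hom_map (r i) ((g true).app (t.fn.obj x)) u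
    have h₅ := ap_hom_map (r i) ((g false).app (t.fn.obj x)) u
    exact (homEquiv _ _).symm.injective (h₄.symm.trans (h₃.trans h₅))
  have h₃ := (hg true).comp t
  have h₄ := (hg false).comp t
  exact (cancel_mono ((s.comp t).toIso Q).hom).1 (h₃.trans ((congrArg (fun z => _ ≫ (level X H (s.comp t).idx).map z) h₂).trans h₄.symm))

/-- Only finitely many representables and arrows between them matter, so the components of `τ` at
them and their naturality are realized at one index, where Yoneda yields a natural transformation.
Agreement with `τ` at an arbitrary `A` follows because representables cover `A`. -/
lemma exists_pre_map_eq_level {k : X.Idx} {P Q : X.cat k ⥤ H}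
    (τ : ((level X H k).obj P).pre FintypeCat.Skeleton.{u} ⟶ ((level X H k).obj Q).pre FintypeCat.Skeleton.{u}) :
    ∃ m : (level X H k).obj P ⟶ (level X H k).obj Q, ∀ A, (map A).map m = τ.app A := by
  have := hH.finite_hom
  have hH' := hH.isGroupoid
  obtain ⟨n, r, hr⟩ := hH.exists_representatives
  obtain ⟨s, g, hg⟩ := exists_lifts_family (F := fun i => P ⋙ hom (r i)) (G := fun i => Q ⋙ hom (r i))
    fun i => τ.app (hom (r i))
  have h₁ (w : Σ (i : Fin n) (j : Fin n), (r i ⟶ r j)) :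
      (level X _ s.idx).map (Functor.whiskerLeft s.fn (Functor.whiskerLeft P ((homFunctor H).map w.2.2.op)) ≫ g w.1) =
      (level X _ s.idx).map (g w.2.1 ≫ Functor.whiskerLeft s.fn (Functor.whiskerLeft Q ((homFunctor H).map w.2.2.op))) := by
    obtain ⟨i, j, m⟩ := w
    have h₁ := s.toIso_naturality (E := FintypeCat.Skeleton.{u}) (Functor.whiskerLeft P ((homFunctor H).map m.op))
    have h₂ := s.toIso_naturality (E := FintypeCat.Skeleton.{u}) (Functor.whiskerLeft Q ((homFunctor H).map m.op))
    have h₃ := τ.naturality ((homFunctor H).map m.op)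
    exact ((level X _ s.idx).map_comp _ _).trans
      ((cube_eq h₁ h₂ h₃ (hg i) (hg j)).trans ((level X _ s.idx).map_comp _ _).symm)
  obtain ⟨t, ht⟩ := exists_eq_family h₁
  obtain ⟨f, hf⟩ := exists_whiskerRight_eq hH' hr (P := t.fn ⋙ s.fn ⋙ P) (Q := t.fn ⋙ s.fn ⋙ Q)
    (fun i => Functor.whiskerLeft t.fn (g i)) fun {i j} m => ht ⟨i, j, m⟩
  let m : (level X H k).obj P ⟶ (level X H k).obj Q := ((s.comp t).toIso P).hom ≫ (level X H _).map f ≫ ((s.comp t).toIso Q).inv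
  have hm : (s.comp t).Lifts m f := by
    exact (Category.assoc _ _ _).trans (congrArg _ ((Category.assoc _ _ _).trans
      ((congrArg _ (Iso.inv_hom_id _)).trans (Category.comp_id _))))
  have h₂ (i : Fin n) : (map (hom (r i))).map m = τ.app (hom (r i)) := by
    have h₁ := map_lifts hm (hom (r i))
    have h₂ := (hg i).comp t
    have h₃ := hf i
    exact (cancel_mono ((s.comp t).toIso (Q ⋙ hom (r i))).hom).1 (h₁.trans
      ((congrArg (fun z => _ ≫ (level X _ (s.comp t).idx).map z) h₃).trans h₂.symm))
  refine ⟨m, fun A => ?_⟩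
  refine map_hom_ext hr hH' (pre FintypeCat.Skeleton.{u} ((level X H k).obj P)) (fun f hf => ?_) fun i a => ?_
  · exact isRegularEpi_of_isColimit (isColimitOfPreserves
      (pre FintypeCat.Skeleton.{u} ((level X H k).obj P)) (IsRegularEpi.isColimit f))
  · refine ((map₂ (homDesc A a)).naturality m).symm.trans (Eq.trans ?_ (τ.naturality (homDesc A a)).symm)
    exact congrArg (· ≫ _) (h₂ i)

theorem preFunctor_faithful : (preFunctor X FintypeCat.Skeleton.{u} H).Faithful := ⟨fun {p q m m'} hm => by
  obtain ⟨k₀⟩ : Nonempty X.Idx := IsCofiltered.nonempty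
  obtain ⟨r, P, ⟨e⟩⟩ := exists_level (κ := Bool) k₀ fun b => bif b then p else q
  have := pre_ext_level hH (m := (e true).inv ≫ m ≫ (e false).hom) (m' := (e true).inv ≫ m' ≫ (e false).hom)
    fun A => by
      have h := NatTrans.congr_app hm A
      exact ((map A).map_comp _ _).trans ((congrArg _ (((map A).map_comp _ _).trans ((congrArg (· ≫ _) h).trans
        ((map A).map_comp _ _).symm))).trans ((map A).map_comp _ _).symm)
  exact (cancel_mono (e false).hom).1 ((cancel_epi (e true).inv).1 this)⟩

theorem preFunctor_full : (preFunctor X FintypeCat.Skeleton.{u} H).Full := ⟨fun {p q} τ => by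
  obtain ⟨k₀⟩ : Nonempty X.Idx := IsCofiltered.nonempty
  obtain ⟨r, P, ⟨e⟩⟩ := exists_level (κ := Bool) k₀ fun b => bif b then p else q
  let L := preFunctor X FintypeCat.Skeleton.{u} H
  let e₁ : p ≅ (level X H r.idx).obj (P true) := e true
  let e₂ : q ≅ (level X H r.idx).obj (P false) := e false
  obtain ⟨m, hm⟩ := exists_pre_map_eq_level hH (L.map e₁.inv ≫ τ ≫ L.map e₂.hom)
  have hm' : L.map m = L.map e₁.inv ≫ τ ≫ L.map e₂.hom := NatTrans.ext (funext hm)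
  exact ⟨e₁.hom ≫ m ≫ e₂.inv, by rw [L.map_comp, L.map_comp, hm']; simp [← L.map_comp_assoc, ← L.map_comp]; exact Category.comp_id τ⟩⟩

end ProfiniteGroupoid.Fun

/-! ### Representing exact functors by objects of the colimit. -/

section

variable {C : Type u} [Category.{u} C] [HasFiniteLimits C]

lemma IsSplitting.of_isCoprod_map {D : Type u} [Category.{u} D] [HasFiniteLimits D] (G : C ⥤ D)
    [PreservesFiniteLimits G] {ι : Type} [Finite ι] {p x : C}
    {e : ι → (p ⟶ x)} (he : IsCoprod fun s => G.map (prod.lift (e s) (𝟙 p))) : IsSplitting fun s => G.map (e s) :=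
  he.of_iso (prodComparison G x p) fun s => by
    apply Limits.prod.hom_ext
    · simp only [Category.assoc, prodComparison_fst, ← G.map_comp, prod.lift_fst]
    · simp only [Category.assoc, prodComparison_snd, ← G.map_comp, prod.lift_snd, G.map_id]

lemma IsSplitting.isCoprod_map {D : Type u} [Category.{u} D] [HasFiniteLimits D] (G : C ⥤ D)
    [PreservesFiniteLimits G] {ι : Type} [Finite ι] {p x : C}
    {e : ι → (p ⟶ x)} (he : IsSplitting fun s => G.map (e s)) : IsCoprod fun s => G.map (prod.lift (e s) (𝟙 p)) :=
  IsCoprod.of_iso he (inv (prodComparison G x p)) fun s => by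
    rw [IsIso.comp_inv_eq]
    apply Limits.prod.hom_ext
    · simp only [Category.assoc, prodComparison_fst, ← G.map_comp, prod.lift_fst]
    · simp only [Category.assoc, prodComparison_snd, ← G.map_comp, prod.lift_snd, G.map_id]

lemma IsSplitting.of_iso {ι : Type} {p x p' x' : C} {e : ι → (p ⟶ x)} (he : IsSplitting e)
    (a : p' ≅ p) (b : x ≅ x') {e' : ι → (p' ⟶ x')} (h : ∀ s, e' s ≫ b.inv = a.hom ≫ e s) : IsSplitting e' := by
  have h₁ := IsCoprod.of_injective he (g := id) Function.injective_id (fun _ => a.hom)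
    (fun l hl => (hl l rfl).elim)
  refine h₁.of_iso (prod.map b.hom a.inv) fun s => ?_
  apply Limits.prod.hom_ext
  · simp [← reassoc_of% (h s)]
  · simp only [id_eq, Category.assoc, prod.map_snd, prod.lift_snd_assoc, prod.lift_snd,
      Category.id_comp, Iso.hom_inv_id]

lemma IsSplitting.bijective_map {ι : Type} [Finite ι] {p x : C} {e : ι → (p ⟶ x)} (he : IsSplitting e)
    (G : C ⥤ FintypeCat.Skeleton.{u}) [PreservesFiniteLimits G] [PreservesFiniteCoproducts G] (a : Elem (G.obj p)) :
    Function.Bijective fun s => ap (G.map (e s)) a := by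
  have hG := bijective_of_isCoprod G he
  refine ⟨fun s s' h => ?_, fun b => ?_⟩
  · have h₁ : ap (G.map (prod.lift (e s) (𝟙 p))) a = ap (G.map (prod.lift (e s') (𝟙 p))) a := by
      refine FintypeCat.Skeleton.prod_ext G ?_ ?_
      · rw [ap_map_eq G (prod.lift_fst _ _), ap_map_eq G (prod.lift_fst _ _)]
        exact h
      · rw [ap_map_eq G (prod.lift_snd _ _), ap_map_eq G (prod.lift_snd _ _)]
    exact congrArg Sigma.fst (hG.1 (a₁ := ⟨s, a⟩) (a₂ := ⟨s', a⟩) h₁)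
  · obtain ⟨c, rfl, h₂⟩ := FintypeCat.Skeleton.exists_prod G b a
    obtain ⟨⟨s, a'⟩, rfl⟩ := hG.2 c
    rw [ap_map_eq G (prod.lift_snd _ _), G.map_id, ap_id] at h₂
    exact ⟨s, by rw [ap_map_eq G (prod.lift_fst _ _), ← h₂]⟩

end

namespace FintypeCat.Skeleton

variable {A : Type u} [Category.{u} A]

/-- The support of a finite family of functors. -/
lemma exists_support {n : ℕ} (D : Fin n → (A ⥤ FintypeCat.Skeleton.{u})) :
    ∃ I : A ⥤ FintypeCat.Skeleton.{u}, (∀ i, Nonempty (D i ⟶ I)) ∧ Mono (terminal.from I) ∧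
      ∀ x, Elem (I.obj x) → ∃ i, Nonempty (Elem ((D i).obj x)) := by
  let S : A ⥤ Type u :=
    { obj := fun x => {_u : PUnit.{u + 1} // ∃ i, Nonempty (Elem ((D i).obj x))}
      map := fun m => TypeCat.ofHom fun u => ⟨u.1, u.2.imp fun i => Nonempty.map (ap ((D i).map m))⟩ }
  have (x : A) : Finite (S.obj x) := inferInstanceAs (Finite {_u : PUnit.{u + 1} // ∃ i, Nonempty (Elem ((D i).obj x))})
  have hS (x : A) (a b : Elem ((ofFinite S).obj x)) : a = b :=
    (ofFiniteEquiv S x).injective (Subtype.ext rfl)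
  refine ⟨ofFinite S, fun i => ⟨⟨fun x => ofFun fun a => (ofFiniteEquiv S x).symm ⟨⟨⟩, i, ⟨a⟩⟩,
    fun x y m => hom_ext fun a => hS _ _ _⟩⟩, ⟨fun f g _ => ?_⟩, fun x a => (ofFiniteEquiv S x a).2⟩
  ext x : 2
  exact hom_ext fun a => hS _ _ _

variable [∀ x y : A, Finite (x ⟶ y)]

/-- The opposite of the full subcategory on a finite family of objects. -/
structure Rep {A : Type u} {n : ℕ} (r : Fin n → A) : Type u where
  down : Fin n

instance {n : ℕ} (r : Fin n → A) : SmallCategory (Rep r) where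
  Hom i j := r j.down ⟶ r i.down
  id i := 𝟙 (r i.down)
  comp f g := CategoryStruct.comp (obj := A) g f
  id_comp f := Category.comp_id f
  comp_id f := Category.id_comp f
  assoc f g h := (Category.assoc h g f).symm

noncomputable instance {n : ℕ} (r : Fin n → A) : FinCategory (Rep r) where
  fintypeObj := Fintype.ofEquiv (Fin n) ⟨Rep.mk, Rep.down, fun _ => rfl, fun _ => rfl⟩
  fintypeHom i j := have : Finite (i ⟶ j) := inferInstanceAs (Finite (r j.down ⟶ r i.down)); Fintype.ofFinite _

/-- The functors represented by a finite family of objects. -/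
noncomputable def repFunctor {n : ℕ} (r : Fin n → A) : Rep r ⥤ A ⥤ FintypeCat.Skeleton.{u} where
  obj i := hom (r i.down)
  map {i j} m := (homFunctor A).map (Quiver.Hom.op (show r j.down ⟶ r i.down from m))
  map_id _ := (homFunctor A).map_id _
  map_comp _ _ := (homFunctor A).map_comp _ _

section

variable {n : ℕ} {r : Fin n → A} (hr : ∀ x, ∃ i, Nonempty (r i ⟶ x)) (hA : IsGroupoid A)
include hr hA
variable {D : Type u} [Category.{u} D] {G : (A ⥤ FintypeCat.Skeleton.{u}) ⥤ D} [PreservesFiniteCoproducts G]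
  (hG : ∀ {F F' : A ⥤ FintypeCat.Skeleton.{u}} (f : F ⟶ F'), IsRegularEpi f → IsRegularEpi (G.map f))

include hG in
lemma natTrans_ext {G' : (A ⥤ FintypeCat.Skeleton.{u}) ⥤ D} {θ θ' : G ⟶ G'}
    (h : ∀ i, θ.app (hom (r i)) = θ'.app (hom (r i))) : θ = θ' := by
  ext F
  exact map_hom_ext hr hA G hG fun i a => by rw [θ.naturality, θ'.naturality, h]

variable {G' : (A ⥤ FintypeCat.Skeleton.{u}) ⥤ D} [PreservesFiniteCoproducts G']
  (hG' : ∀ {F F' : A ⥤ FintypeCat.Skeleton.{u}} (f : F ⟶ F'), IsRegularEpi f → IsRegularEpi (G'.map f))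
  [PreservesLimitsOfShape WalkingCospan G] [PreservesLimitsOfShape WalkingCospan G']

include hG hG' in
theorem nonempty_iso (η : repFunctor r ⋙ G ≅ repFunctor r ⋙ G') : Nonempty (G ≅ G') := by
  obtain ⟨θ, h₁⟩ := exists_natTrans hr hA G hG G' (fun i => η.hom.app ⟨i⟩)
    fun {i j} m => η.hom.naturality (X := ⟨j⟩) (Y := ⟨i⟩) m
  obtain ⟨θ', h₂⟩ := exists_natTrans hr hA G' hG' G (fun i => η.inv.app ⟨i⟩)
    fun {i j} m => η.inv.naturality (X := ⟨j⟩) (Y := ⟨i⟩) m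
  exact ⟨⟨θ, θ', natTrans_ext hr hA hG fun i => by
    rw [NatTrans.comp_app, h₁, h₂]
    exact η.hom_inv_id_app (⟨i⟩ : Rep r), natTrans_ext hr hA hG' fun i => by
    rw [NatTrans.comp_app, h₁, h₂]
    exact η.inv_hom_id_app (⟨i⟩ : Rep r)⟩⟩

end

/-- A family of functors to finite sets on which the full subcategory on `r` acts simply transitively
is represented by a functor. -/
lemma exists_representing {n : ℕ} {r : Fin n → A} {B : Type u} [Category.{u} B] (D : Rep r ⥤ B ⥤ FintypeCat.Skeleton.{u})
    (h₁ : ∀ x, ∃ i, Nonempty (Elem ((D.obj i).obj x)))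
    (h₂ : ∀ (i j : Rep r) (x) (b : Elem ((D.obj j).obj x)), Function.Bijective fun m : j ⟶ i => ap ((D.map m).app x) b) :
    ∃ p : B ⥤ A, Nonempty (repFunctor r ⋙ (Functor.whiskeringLeft _ _ FintypeCat.Skeleton.{u}).obj p ≅ D) := by
  -- A base point is chosen in some member of the family at each `x`; the index of that member
  -- prescribes the object `p.obj x`.
  choose i b using h₁
  have b (x : B) : Elem ((D.obj (i x)).obj x) := (b x).some
  have hD {i j k : Rep r} (m : i ⟶ j) (m' : j ⟶ k) (x : B) (b : Elem ((D.obj i).obj x)) :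
      ap ((D.map (m ≫ m')).app x) b = ap ((D.map m').app x) (ap ((D.map m).app x) b) := by
    rw [D.map_comp, NatTrans.comp_app, ap_comp]
  have hD₁ {i : Rep r} (x : B) (b : Elem ((D.obj i).obj x)) : ap ((D.map (𝟙 i)).app x) b = b := by
    rw [D.map_id, NatTrans.id_app, ap_id]
  -- The arrow `t m` is the unique one that carries the base point of `y` to the transported base
  -- point of `x`; uniqueness gives functoriality.
  choose t ht using fun {x y : B} (m : x ⟶ y) => (h₂ (i x) (i y) y (b y)).2 (ap ((D.obj (i x)).map m) (b x))
  have htu {x y : B} (m : x ⟶ y) (t' : i y ⟶ i x) (h : ap ((D.map t').app y) (b y) = ap ((D.obj (i x)).map m) (b x)) :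
      t m = t' := (h₂ (i x) (i y) y (b y)).1 ((ht m).trans h.symm)
  let p : B ⥤ A :=
    { obj := fun x => r (i x).down
      map := fun m => t m
      map_id := fun x => htu _ (𝟙 (i x)) (by
        rw [hD₁, CategoryTheory.Functor.map_id, ap_id])
      map_comp := fun {x y z} m m' => htu _ (t m' ≫ t m) (by
        rw [hD]
        have h₁ := ht m
        have h₂ := ht m'
        dsimp only at h₁ h₂
        rw [h₂, ap_naturality, h₁, ap_map_comp]) }
  -- Acting on the base point trivializes the torsor, which identifies `D.obj j` with the arrows
  -- from `r j` to `p`.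
  let act {x : B} {j : Rep r} (u : r j.down ⟶ p.obj x) : Elem ((D.obj j).obj x) :=
    ap ((D.map (show i x ⟶ j from u)).app x) (b x)
  have act_comp {x : B} {j j' : Rep r} (m : j ⟶ j') (u : r j.down ⟶ p.obj x) :
      act (j := j') ((show r j'.down ⟶ r j.down from m) ≫ u) = ap ((D.map m).app x) (act u) :=
    hD (show i x ⟶ j from u) m x (b x)
  have act_map {x y : B} {j : Rep r} (m : x ⟶ y) (u : r j.down ⟶ p.obj x) :
      act (u ≫ p.map m) = ap ((D.obj j).map m) (act u) :=
    (hD (t m) (show i x ⟶ j from u) y (b y)).trans ((congrArg _ (ht m)).trans (ap_naturality _ m _))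
  let φ (j : Rep r) : p ⋙ hom (r j.down) ⟶ D.obj j :=
    { app := fun x => ofFun fun u => act (homEquiv (r j.down) (p.obj x) u)
      naturality := fun x y m => hom_ext fun u => by
        obtain ⟨u, rfl⟩ := (homEquiv (r j.down) (p.obj x)).symm.surjective u
        have h₃ : homEquiv _ _ (ap ((hom (r j.down)).map (p.map m)) ((homEquiv _ _).symm u)) = u ≫ p.map m := by
          rw [ap_hom_map, Equiv.apply_symm_apply]
        refine (congrArg act h₃).trans ((act_map m u).trans ?_)
        exact congrArg (fun v => ap ((D.obj j).map m) (act v)) (Equiv.apply_symm_apply _ _).symm }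
  have hφ (j : Rep r) (x : B) : IsIso ((φ j).app x) :=
    isIso_of_bijective _ ((h₂ j (i x) x (b x)).comp (homEquiv (r j.down) (p.obj x)).bijective)
  have (j : Rep r) : IsIso (φ j) := NatIso.isIso_of_isIso_app (φ j)
  refine ⟨p, ⟨NatIso.ofComponents (fun j => (asIso (φ j) : p ⋙ hom (r j.down) ≅ D.obj j)) fun {j j'} m => ?_⟩⟩
  ext x : 2
  refine hom_ext fun u => ?_
  obtain ⟨u, rfl⟩ := (homEquiv (r j.down) (p.obj x)).symm.surjective u
  have h₃ : ap (((repFunctor r).map m).app (p.obj x)) ((homEquiv _ _).symm u) =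
      (homEquiv _ _).symm ((show r j'.down ⟶ r j.down from m) ≫ u) :=
    (ap_homDesc _ _ u).trans (ap_hom_map _ _ _)
  refine (congrArg (fun v => act (homEquiv _ _ v)) h₃).trans ?_
  refine (congrArg act (Equiv.apply_symm_apply _ _)).trans ((act_comp m u).trans ?_)
  exact congrArg (fun v => ap ((D.map m).app x) (act v)) (Equiv.apply_symm_apply _ _).symm

end FintypeCat.Skeleton

namespace ProfiniteGroupoid.Fun

variable {X : ProfiniteGroupoid.{u}} {E : Type u} [Category.{u} E]

/-- An inverse is represented at a finer index, and the two identities that make it an inverse hold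
at still finer ones. -/
lemma exists_isIso_whiskerLeft {k : X.Idx} {F F' : X.cat k ⥤ E} (f : F ⟶ F') (hf : IsIso ((level X E k).map f)) :
    ∃ r : Ref X k, IsIso (Functor.whiskerLeft r.fn f) := by
  obtain ⟨r, h, hr⟩ := Ref.exists_lifts (inv ((level X E k).map f))
  have hn := r.toIso_naturality f
  have h₁ : (level X E r.idx).map (Functor.whiskerLeft r.fn f ≫ h) = (level X E r.idx).map (𝟙 _) := by
    rw [← cancel_epi (r.toIso F).hom, Functor.map_comp, ← reassoc_of% hn, ← hr]
    simp
  have h₂ : (level X E r.idx).map (h ≫ Functor.whiskerLeft r.fn f) = (level X E r.idx).map (𝟙 _) := by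
    rw [← cancel_epi (r.toIso F').hom, Functor.map_comp, ← reassoc_of% hr, ← hn]
    simp
  obtain ⟨s, hs⟩ := Ref.exists_eq_of_level_map_eq h₁
  obtain ⟨t, ht⟩ := Ref.exists_eq_of_level_map_eq (s.level_map_whiskerLeft_eq h₂)
  refine ⟨(r.comp s).comp t, Functor.whiskerLeft t.fn (Functor.whiskerLeft s.fn h), ?_, ht⟩
  exact congrArg (Functor.whiskerLeft t.fn) hs

lemma exists_forall_isIso_whiskerLeft {κ : Type*} [Finite κ] {k : X.Idx} (f : κ → Arrow (X.cat k ⥤ E))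
    (hf : ∀ i, IsIso ((level X E k).map (f i).hom)) : ∃ r : Ref X k, ∀ i, IsIso (Functor.whiskerLeft r.fn (f i).hom) := by
  refine Ref.exists_forall (fun i r => IsIso (Functor.whiskerLeft r.fn (f i).hom)) (fun i r s h => ?_) fun i r => ?_
  · exact inferInstanceAs (IsIso (Functor.whiskerLeft s.fn (Functor.whiskerLeft r.fn (f i).hom)))
  · refine exists_isIso_whiskerLeft (Functor.whiskerLeft r.fn (f i).hom) ?_
    have := hf i
    have h := (Iso.inv_comp_eq _).2 (r.toIso_naturality (f i).hom)
    rw [← h]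
    infer_instance

end ProfiniteGroupoid.Fun

/-- The representables cover the terminal object and their images map to `L.obj I`. So a strong
epimorphism onto `L.obj (⊤_ C)` factors through `L.obj I`, and the monomorphism `L.map
(terminal.from I)` is also a strong epimorphism. -/
lemma isIso_map_terminal_from {A : Type u} [Category.{u} A] [∀ x y : A, Finite (x ⟶ y)] {n : ℕ} {r : Fin n → A}
    (hr : ∀ x, ∃ i, Nonempty (r i ⟶ x)) (hA : IsGroupoid A) {D : Type u} [Category.{u} D]
    (G : (A ⥤ FintypeCat.Skeleton.{u}) ⥤ D) [PreservesFiniteLimits G] [PreservesFiniteCoproducts G]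
    (hG : ∀ {F F' : A ⥤ FintypeCat.Skeleton.{u}} (f : F ⟶ F'), IsRegularEpi f → IsRegularEpi (G.map f))
    {C : Type u} [Category.{u} C] [HasFiniteLimits C] (L : C ⥤ D) [PreservesFiniteLimits L]
    (I : C) [Mono (terminal.from I)] (h : ∀ i, Nonempty (G.obj (hom (r i)) ⟶ L.obj I)) :
    IsIso (L.map (terminal.from I)) := by
  have hc := hG _ (isRegularEpi_cover hr hA (⊤_ _))
  let d : G.obj _ ⟶ L.obj I := (IsCoprod.map G (IsCoprod.sigma
    fun s : Σ i, Fin ((⊤_ (A ⥤ FintypeCat.Skeleton.{u})).obj (r i)).len => hom (r s.1))).desc fun s => (h s.1).some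
  let e : G.obj (⊤_ _) ≅ L.obj (⊤_ _) := (IsTerminal.isTerminalObj G _ terminalIsTerminal).uniqueUpToIso
    (IsTerminal.isTerminalObj L _ terminalIsTerminal)
  have hd : G.map (cover r (⊤_ _)) ≫ e.hom = d ≫ L.map (terminal.from I) :=
    (IsTerminal.isTerminalObj L _ terminalIsTerminal).hom_ext _ _
  have : StrongEpi (G.map (cover r (⊤_ _)) ≫ e.hom) := strongEpi_comp _ _
  rw [hd] at this
  have := strongEpi_of_strongEpi d (L.map (terminal.from I))
  exact isIso_of_mono_of_strongEpi _

namespace ProfiniteGroupoid.Fun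

variable {X : ProfiniteGroupoid.{u}} {H : Type u} [Category.{u} H]

/-- Exact functors `(H ⥤ FinSet) ⥤ Fun X FinSet` are given by precomposition with objects of `Fun X H`. -/
theorem exists_pre_iso (hH : IsFiniteGroupoid H) (G : (H ⥤ FintypeCat.Skeleton.{u}) ⥤ Fun X FintypeCat.Skeleton.{u})
    [PreservesFiniteLimits G] [PreservesFiniteCoproducts G]
    (hG : ∀ {F F' : H ⥤ FintypeCat.Skeleton.{u}} (f : F ⟶ F'), IsRegularEpi f → IsRegularEpi (G.map f)) :
    ∃ p : Fun X H, Nonempty (p.pre FintypeCat.Skeleton.{u} ≅ G) := by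
  have := hH.finite_hom
  have hH' := hH.isGroupoid
  obtain ⟨n, r, hr⟩ := hH.exists_representatives
  -- The full subcategory on the representatives is finite, so the values of `G` at representables
  -- form a finite diagram, defined at some level.
  obtain ⟨k, D, ⟨φ⟩⟩ := exists_diagram (repFunctor r ⋙ G)
  let L := level X FintypeCat.Skeleton.{u} k
  obtain ⟨I, hI₁, hI₂, hI₃⟩ := exists_support fun i : Fin n => D.obj ⟨i⟩
  -- the support is everything
  have h₁ : IsIso (L.map (terminal.from I)) :=
    isIso_map_terminal_from hr hH' G hG L I fun i => ⟨φ.inv.app ⟨i⟩ ≫ L.map (hI₁ i).some⟩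
  -- the action is simply transitive
  let m (i j : Fin n) (s : Fin ((hom (r i)).obj (r j)).len) : (⟨j⟩ : Rep r) ⟶ ⟨i⟩ :=
    homEquiv (r i) (r j) (ULift.up s : Elem ((hom (r i)).obj (r j)))
  have hm (i j : Fin n) : IsSplitting fun s => L.map (D.map (m i j s)) := by
    refine ((isSplitting_homDesc hH' (hom (r i)) (r j)).map G).of_iso (φ.app ⟨j⟩) (φ.app ⟨i⟩).symm fun s => ?_
    have := φ.hom.naturality (m i j s)
    refine this.trans ?_
    exact congrArg (fun z => _ ≫ G.map (homDesc (hom (r i)) z)) ((homEquiv (r i) (r j)).symm_apply_apply _)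
  -- This map compares the action of arrows with pairs of elements; its invertibility is simple
  -- transitivity.
  let ψ (i j : Fin n) : (∐ fun _ : Fin ((hom (r i)).obj (r j)).len => D.obj ⟨j⟩) ⟶ D.obj ⟨i⟩ ⨯ D.obj ⟨j⟩ :=
    Limits.Sigma.desc fun s => prod.lift (D.map (m i j s)) (𝟙 _)
  have h₂ (i j : Fin n) : IsIso (L.map (ψ i j)) :=
    (IsCoprod.map L (IsCoprod.sigma _)).isIso (hm i j).isCoprod_map _ fun s =>
      (L.map_comp _ _).symm.trans (L.congr_map (Limits.Sigma.ι_desc _ _))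
  -- Nonemptiness and simple transitivity are invertibility of finitely many morphisms in the
  -- colimit; at a fine enough index they hold pointwise.
  obtain ⟨t, ht⟩ := exists_forall_isIso_whiskerLeft (κ := Option (Fin n × Fin n))
    (fun o => o.elim (Arrow.mk (terminal.from I)) fun w => Arrow.mk (ψ w.1 w.2))
    (by rintro (_ | w); exacts [h₁, h₂ _ _])
  let W := (Functor.whiskeringLeft _ _ FintypeCat.Skeleton.{u}).obj t.fn
  obtain ⟨p, ⟨θ⟩⟩ := exists_representing (D ⋙ W) (fun x => by
    have : IsIso ((W.map (terminal.from I)).app x) := have : IsIso (W.map (terminal.from I)) := ht none; inferInstance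
    obtain ⟨a, ha⟩ := exists_unique_of_isTerminal ((evaluation _ FintypeCat.Skeleton.{u}).obj (t.fn.obj x))
      (terminalIsTerminal (C := X.cat k ⥤ FintypeCat.Skeleton.{u}))
    obtain ⟨b, hb⟩ := (bijective_of_isIso ((W.map (terminal.from I)).app x)).2 a
    obtain ⟨i, hi⟩ := hI₃ _ b
    exact ⟨⟨i⟩, hi⟩) (fun i j x b => by
    obtain ⟨i⟩ := i
    obtain ⟨j⟩ := j
    have : IsIso (W.map (ψ i j)) := ht (some (i, j))
    have hc : IsSplitting fun s => W.map (D.map (m i j s)) := .of_isCoprod_map W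
      ((IsCoprod.map W (IsCoprod.sigma _)).of_iso (W.map (ψ i j)) fun s =>
        (W.map_comp _ _).symm.trans (W.congr_map (Limits.Sigma.ι_desc _ _)))
    have := hc.bijective_map ((evaluation _ FintypeCat.Skeleton.{u}).obj x) b
    have he : Function.Bijective (m i j) := (homEquiv (r i) (r j)).bijective.comp Equiv.ulift.symm.bijective
    exact (Function.Bijective.of_comp_iff _ he).1 this)
  let q : Fun X H := ⟨t.idx, p⟩
  refine ⟨q, nonempty_iso hr hH' (fun f hf => ?_) hG ?_⟩
  · exact isRegularEpi_of_isColimit (isColimitOfPreserves (pre FintypeCat.Skeleton.{u} q) (IsRegularEpi.isColimit f))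
  · exact Functor.isoWhiskerRight θ (level X _ t.idx) ≪≫ (Functor.isoWhiskerLeft D t.natIso.symm : _) ≪≫ φ

end ProfiniteGroupoid.Fun

/-! ### The equivalence on categories of morphisms. -/

namespace CategoryTheory

variable {C : Type*} [Category* C]

lemma inv_square {A B A' B' : C} (e : A ≅ B) (e' : A' ≅ B') {x : B ⟶ B'}
    {y : A ⟶ A'} (h : e.inv ≫ y = x ≫ e'.inv) : e.hom ≫ x = y ≫ e'.hom := by
  rw [← Iso.comp_inv_eq, Category.assoc, ← h, Iso.hom_inv_id_assoc]

lemma comp_iso_comp_map {D : Type*} [Category* D] (F : C ⥤ D) {a b : C} (y : a ≅ b) {P Q : D} (z : P ≅ F.obj a)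
    (x : Q ⟶ F.obj b) {u : Q ⟶ P} (h : u = x ≫ F.map y.inv ≫ z.inv) : u ≫ z.hom ≫ F.map y.hom = x := by
  simp [h, ← F.map_comp]

lemma eq_of_unit {P Q R S : C} {m m' : P ⟶ Q} {n : Q ⟶ R} (hn : Mono n) {n' : P ⟶ S} {t : R ⟶ S} {v : S ⟶ R}
    (h₁ : m ≫ n ≫ t = n') (h₂ : m' ≫ n = n' ≫ v) (h₃ : t ≫ v = 𝟙 R) : m = m' := by
  rw [← cancel_mono n, h₂, ← h₁, Category.assoc, Category.assoc, h₃, Category.comp_id]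

lemma eq_of_comp {P Q R S P' Q' S' S'' : C} {m : P ⟶ Q} {n : Q ⟶ R} (hn : Mono n) {n' : P ⟶ S} {t : R ⟶ S}
    {m₁ : P ⟶ P'} {m₂ : P' ⟶ Q'} {m₃ : Q' ⟶ Q} {n₁ : P' ⟶ S''} {n₂ : Q' ⟶ S'} {ta : S' ⟶ S''} {tb : R ⟶ S'} {v : S ⟶ S''}
    (hta : Mono ta) (htb : Mono tb) (h : m ≫ n ≫ t = n') (h₁ : m₁ ≫ n₁ = n' ≫ v) (h₂ : m₂ ≫ n₂ ≫ ta = n₁)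
    (h₃ : m₃ ≫ n ≫ tb = n₂) (h₄ : t ≫ v = tb ≫ ta) : m = m₁ ≫ m₂ ≫ m₃ := by
  rw [← cancel_mono n, ← cancel_mono tb, ← cancel_mono ta]
  simp only [Category.assoc]
  rw [← h₄, reassoc_of% h, ← h₁, ← h₂, ← h₃]
  simp only [Category.assoc]
  rw [h₄]

lemma comp_square_of_inv {P P' Q R S S' : C} {m : P ⟶ P'} {i : P' ⟶ P} (hi : i ≫ m = 𝟙 P') {m₂ : P ⟶ Q}
    {n : P' ⟶ R} {n₁ : P ⟶ S} {n₂ : Q ⟶ S'} {t : R ⟶ S} {v : S ⟶ S'} (h₁ : m ≫ n ≫ t = n₁)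
    (h₂ : m₂ ≫ n₂ = n₁ ≫ v) : (i ≫ m₂) ≫ n₂ = n ≫ t ≫ v := by
  rw [Category.assoc, h₂, ← h₁, Category.assoc, Category.assoc, reassoc_of% hi]

end CategoryTheory

namespace ProfiniteGroupoid

open Fun

variable {X Y : ProfiniteGroupoid.{u}}

lemma Fun.map_ext (j : Y.Idx) {p q : Fun X (Y.cat j)} {m m' : p ⟶ q}
    (h : ∀ A : Y.cat j ⥤ FintypeCat.Skeleton.{u}, (Fun.map A).map m = (Fun.map A).map m') : m = m' :=
  have := preFunctor_faithful (X := X) (Y.finite ⟨j⟩)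
  (preFunctor X FintypeCat.Skeleton.{u} (Y.cat j)).map_injective (NatTrans.ext (funext h))

lemma ev_injective {f g : Hom X Y} {θ η : f ⟶ g}
    (h : Hom₂.ev θ FintypeCat.Skeleton.{u} = Hom₂.ev η FintypeCat.Skeleton.{u}) : θ = η :=
  hom₂_ext fun j => Fun.map_ext j fun A => NatTrans.congr_app h ⟨j, A⟩

/-- Restricting `τ` to each level gives the components, by fullness. Their compatibility with the
transition functors is the naturality of `τ` at the morphisms `El.trans`, read through faithfulness.
-/
theorem exists_ev_eq {f g : Hom X Y} (τ : f.ev FintypeCat.Skeleton.{u} ⟶ g.ev FintypeCat.Skeleton.{u}) :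
    ∃ θ : f ⟶ g, Hom₂.ev θ FintypeCat.Skeleton.{u} = τ := by
  have key (j : Y.Idx) : ∃ θ : f.obj j ⟶ g.obj j, ∀ A, (Fun.map A).map θ = τ.app ⟨j, A⟩ := by
    have := preFunctor_full (X := X) (Y.finite ⟨j⟩)
    obtain ⟨θ, hθ⟩ := (preFunctor X FintypeCat.Skeleton.{u} (Y.cat j)).map_surjective
      (X := f.obj j) (Y := g.obj j)
      { app := fun A => τ.app ⟨j, A⟩
        naturality := fun A B α => by
          have h₁ := f.ev_ι_vert α
          have h₂ := g.ev_ι_vert α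
          have h₃ := τ.naturality ((ι Y _).map (El.vert α))
          exact (congrArg (· ≫ _) h₁.symm).trans (h₃.trans (congrArg (_ ≫ ·) h₂)) }
    exact ⟨θ, fun A => NatTrans.congr_app hθ A⟩
  choose θ hθ using key
  refine ⟨⟨θ, fun {i j} a => ?_⟩, NatTrans.ext (funext fun p => hθ p.idx p.fib)⟩
  refine inv_square _ _ (Fun.map_ext j fun A => ?_)
  have h₁ := τ.naturality ((ι Y _).map (El.trans a A))
  have h₂ := f.ev_ι_trans a A
  have h₃ := g.ev_ι_trans a A
  have h₄ := (hθ i (Y.tr a ⋙ A)).symm.trans (map_map_comp (Y.tr a) A (θ i))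
  have h₅ := (congrArg₂ (· ≫ ·) h₂.symm h₄.symm).trans (h₁.trans (congrArg₂ (· ≫ ·) (hθ j A).symm h₃))
  exact ((Fun.map A).map_comp _ _).trans (h₅.trans ((Fun.map A).map_comp _ _).symm)

section EssSurj

variable (Ψ : Fun Y FintypeCat.Skeleton.{u} ⥤ Fun X FintypeCat.Skeleton.{u})

lemma exists_pre_iso_level (hΨ : IsGaloisFunctor Ψ) (j : Y.Idx) : ∃ p : Fun X (Y.cat j),
    Nonempty (p.pre FintypeCat.Skeleton.{u} ≅ level Y FintypeCat.Skeleton.{u} j ⋙ Ψ) := by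
  have := hΨ.preservesFiniteLimits
  have := hΨ.preservesFiniteCoproducts
  have : PreservesFiniteLimits (level Y FintypeCat.Skeleton.{u} j ⋙ Ψ) := comp_preservesFiniteLimits _ _
  have : PreservesFiniteCoproducts (level Y FintypeCat.Skeleton.{u} j ⋙ Ψ) := ⟨fun n => inferInstance⟩
  refine exists_pre_iso (Y.finite ⟨j⟩) _ fun f hf => ?_
  have : IsRegularEpi ((level Y FintypeCat.Skeleton.{u} j).map f) := isRegularEpi_of_isColimit
    (isColimitOfPreserves (level Y FintypeCat.Skeleton.{u} j) (IsRegularEpi.isColimit f))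
  exact (isEffectiveDescent_iff_isRegularEpi _).1
    (hΨ.map_isEffectiveDescent _ ((isEffectiveDescent_iff_isRegularEpi _).2 this))

variable {Ψ} {p : ∀ j, Fun X (Y.cat j)}
  (η : ∀ j, (p j).pre FintypeCat.Skeleton.{u} ≅ level Y FintypeCat.Skeleton.{u} j ⋙ Ψ)

/-- The comparison of two members of a family of objects representing the restrictions of `Ψ`. -/
noncomputable def compareIso {i j : Y.Idx} (a : i ⟶ j) :
    pre FintypeCat.Skeleton.{u} ((Fun.map (Y.tr a)).obj (p i)) ≅ (p j).pre FintypeCat.Skeleton.{u} :=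
  (Functor.isoWhiskerLeft ((Functor.whiskeringLeft _ _ FintypeCat.Skeleton.{u}).obj (Y.tr a)) (η i) :) ≪≫
    (Functor.isoWhiskerRight (Ref.ofHom a).natIso.symm Ψ :) ≪≫ (η j).symm

/-- The equation pins down `e` in terms of the chosen `η`. Because of this rigidity, the coherence
of the isomorphisms needs no further choices. -/
lemma exists_iso {i j : Y.Idx} (a : i ⟶ j) : ∃ e : (Fun.map (Y.tr a)).obj (p i) ≅ p j,
    ∀ A : Y.cat j ⥤ FintypeCat.Skeleton.{u}, (Fun.map A).map e.hom ≫ (η j).hom.app A ≫ Ψ.map ((ι Y _).map (El.trans a A)) =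
      (η i).hom.app (Y.tr a ⋙ A) := by
  have := preFunctor_full (X := X) (Y.finite ⟨j⟩)
  have := preFunctor_faithful (X := X) (Y.finite ⟨j⟩)
  let e := (preFunctor X FintypeCat.Skeleton.{u} (Y.cat j)).preimageIso (compareIso η a)
  refine ⟨e, fun A => ?_⟩
  have h₁ := NatTrans.congr_app ((preFunctor X FintypeCat.Skeleton.{u} (Y.cat j)).map_preimage (compareIso η a).hom) A
  have h₂ : (Ref.ofHom a).toIso A = @asIso _ _ _ _ ((ι Y FintypeCat.Skeleton.{u}).map (El.trans a A)) inferInstance :=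
    Iso.ext (congrArg (ι Y _).map (Ref.el_ofHom a A))
  have h₃ : (compareIso η a).hom.app A = (η i).hom.app (Y.tr a ⋙ A) ≫ Ψ.map ((Ref.ofHom a).toIso A).inv ≫ (η j).inv.app A := rfl
  rw [h₂] at h₃
  exact comp_iso_comp_map Ψ (@asIso _ _ _ _ ((ι Y FintypeCat.Skeleton.{u}).map (El.trans a A)) inferInstance)
    ((η j).app A) _ (h₁.trans h₃)

theorem exists_ev_iso (hΨ : IsGaloisFunctor Ψ) : ∃ f : Hom X Y, Nonempty (f.ev FintypeCat.Skeleton.{u} ≅ Ψ) := by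
  choose p η using exists_pre_iso_level Ψ hΨ
  have η (j) := (η j).some
  choose e he using fun {i j : Y.Idx} (a : i ⟶ j) => exists_iso η a
  have hη {j : Y.Idx} {A B : Y.cat j ⥤ FintypeCat.Skeleton.{u}} (α : A ⟶ B) :
      (map₂ α).app (p j) ≫ (η j).hom.app B = (η j).hom.app A ≫ Ψ.map ((ι Y _).map (El.vert α)) :=
    (η j).hom.naturality α
  have hmono {j : Y.Idx} (A : Y.cat j ⥤ FintypeCat.Skeleton.{u}) : Mono ((η j).hom.app A) := inferInstance
  have hmono' {i j : Y.Idx} (a : i ⟶ j) (A : Y.cat j ⥤ FintypeCat.Skeleton.{u}) :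
      Mono (Ψ.map ((ι Y _).map (El.trans a A))) := inferInstance
  -- Both coherence laws are tested against all `A`. There each side is determined by its composite
  -- with the monomorphisms `η` and `Ψ.map` of `El.trans`, and the laws reduce to `El.trans_id` and
  -- `El.trans_comp`.
  let f : Hom X Y :=
    { obj := p
      iso := e
      iso_id := fun j => Fun.map_ext j fun A => by
        have h₁ := (map_map₂ (Y.trId j).hom A (p j))
        have h₂ := hη (Functor.whiskerRight (Y.trId j).hom A)
        have h₃ : Ψ.map ((ι Y _).map (El.trans (𝟙 j) A)) ≫ Ψ.map ((ι Y _).map (El.vert (Functor.whiskerRight (Y.trId j).hom A))) = 𝟙 _ :=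
          (Ψ.map_comp _ _).symm.trans ((Ψ.congr_map (((ι Y _).map_comp _ _).symm.trans
            (((ι Y _).congr_map (El.trans_id A)).trans ((ι Y _).map_id _)))).trans (Ψ.map_id _))
        exact (eq_of_unit (hmono A) (he (𝟙 j) A) h₂ h₃).trans h₁.symm
      iso_comp := fun {i j k} a b => Fun.map_ext k fun A => by
        have h₁ := (map_map₂ (Y.trComp a b).hom A (p i))
        have h₂ := hη (Functor.whiskerRight (Y.trComp a b).hom A)
        have h₃ := (Ψ.congr_map (((ι Y _).map_comp _ _).symm.trans
          (((ι Y _).congr_map (El.trans_comp a b A)).trans ((ι Y _).map_comp _ _))))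
        have h₄ := (Ψ.map_comp _ _).symm.trans (h₃.trans (Ψ.map_comp _ _))
        have h₅ := map_map_comp (Y.tr b) A (e a).hom
        have h₆ := eq_of_comp (hmono A) (hmono' a (Y.tr b ⋙ A)) (hmono' b A) (he (a ≫ b) A) h₂ (he a (Y.tr b ⋙ A)) (he b A) h₄
        refine h₆.trans ?_
        exact (congrArg₂ (· ≫ ·) h₁.symm (congrArg (· ≫ _) h₅)).trans ((congrArg (_ ≫ ·) ((Fun.map A).map_comp _ _).symm).trans
          ((Fun.map A).map_comp _ _).symm) }
  refine ⟨f, ⟨NatIso.ofComponents (fun q => (η q.idx).app q.fib) fun {q q'} m => ?_⟩⟩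
  refine naturality_of_ι (F := f.ev FintypeCat.Skeleton.{u}) (G := Ψ) (fun q => (η q.idx).hom.app q.fib) (fun {q q'} t => ?_) m
  have h₁ := f.ev_ι t
  have h₂ := Ψ.congr_map (((ι Y _).congr_map (El.trans_vert t.base t.fiber).symm).trans ((ι Y _).map_comp _ _))
  have h₃ := h₂.trans (Ψ.map_comp _ _)
  have h₄ := (Fun.map q.fib).congr_map (e t.base).inv_hom_id
  have h₅ := ((Fun.map q.fib).map_comp _ _).symm.trans (h₄.trans ((Fun.map q.fib).map_id _))
  exact (congrArg (· ≫ _) h₁).trans ((comp_square_of_inv h₅ (he t.base q.fib) (hη t.fiber)).trans (congrArg (_ ≫ ·) h₃.symm))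

end EssSurj

theorem isEquivalence_mapFunctor (h : SendsToGalois.{u}) (a b : ProfiniteGroupoid.{u}ᵒᵖ) :
    ((toGalCat h).mapFunctor a b).IsEquivalence where
  faithful := ⟨fun {f g θ η} hθ => by
    have h₁ : evIso θ.unop2 FintypeCat.Skeleton.{u} = evIso η.unop2 FintypeCat.Skeleton.{u} := hθ
    have h₂ : θ.unop2 = η.unop2 := ev_injective (congrArg Iso.hom h₁)
    exact congrArg Bicategory.Opposite.op2 h₂⟩
  full := ⟨fun {f g} τ => by
    obtain ⟨θ, hθ⟩ := exists_ev_eq (X := b.unop) (Y := a.unop) (f := f.unop) (g := g.unop) (Iso.hom τ)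
    exact ⟨Bicategory.Opposite.op2 θ, Iso.ext hθ⟩⟩
  essSurj := ⟨fun F => by
    obtain ⟨f, ⟨e⟩⟩ := exists_ev_iso (X := b.unop) (Y := a.unop) (Ψ := F.functor) F.isGalois
    exact ⟨Quiver.Hom.op f, ⟨GalCat.isoMk e⟩⟩⟩

end ProfiniteGroupoid

/-! ### The fundamental groupoid of a Galois category. -/

/-- A finite subgraph of a category. -/
structure FiniteSubgraph (C : Type u) [Category.{u} C] : Type u where
  objs : Finset C
  arrows : Finset (Arr C)

namespace FiniteSubgraph

variable {C : Type u} [Category.{u} C]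

/-- Finite subgraphs, ordered by reverse inclusion. -/
instance : Preorder (FiniteSubgraph C) where
  le K L := L.objs ⊆ K.objs ∧ L.arrows ⊆ K.arrows
  le_refl _ := ⟨subset_rfl, subset_rfl⟩
  le_trans _ _ _ h h' := ⟨h'.1.trans h.1, h'.2.trans h.2⟩

open Classical in
/-- The union of two finite subgraphs. -/
noncomputable def union (K L : FiniteSubgraph C) : FiniteSubgraph C :=
  ⟨K.objs ∪ L.objs, K.arrows ∪ L.arrows⟩

open Classical in
lemma union_le_left (K L : FiniteSubgraph C) : K.union L ≤ K :=
  ⟨Finset.subset_union_left, Finset.subset_union_left⟩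

open Classical in
lemma union_le_right (K L : FiniteSubgraph C) : K.union L ≤ L :=
  ⟨Finset.subset_union_right, Finset.subset_union_right⟩

instance : Nonempty (FiniteSubgraph C) := ⟨⟨∅, ∅⟩⟩

instance : IsCodirectedOrder (FiniteSubgraph C) :=
  ⟨fun K L => ⟨K.union L, K.union_le_left L, K.union_le_right L⟩⟩

end FiniteSubgraph

/-- A fiber functor, considered as an object of the groupoid attached to a finite subgraph. -/
structure FiberFunctor {C : Type u} [Category.{u} C] (K : FiniteSubgraph C) : Type u where
  functor : C ⥤ FintypeCat.Skeleton.{u}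
  isFiber : IsFiber functor

namespace FiberFunctor

variable {C : Type u} [Category.{u} C] {K L : FiniteSubgraph C}

/-- Isomorphisms of the restrictions of fiber functors to a finite subgraph. -/
@[ext]
structure Hom (F F' : FiberFunctor K) : Type u where
  equiv (x : C) (hx : x ∈ K.objs) : Elem (F.functor.obj x) ≃ Elem (F'.functor.obj x)
  comm (m : Arr C) (_ : m ∈ K.arrows) (hx : m.1 ∈ K.objs) (hy : m.2.1 ∈ K.objs) (a : Elem (F.functor.obj m.1)) :
    equiv m.2.1 hy (ap (F.functor.map m.2.2) a) = ap (F'.functor.map m.2.2) (equiv m.1 hx a)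

instance : Category (FiberFunctor K) where
  Hom := Hom
  id F := ⟨fun _ _ => Equiv.refl _, fun _ _ _ _ _ => rfl⟩
  comp φ ψ := ⟨fun x hx => (φ.equiv x hx).trans (ψ.equiv x hx), fun m hm hx hy a => by
    simp only [Equiv.trans_apply, φ.comm m hm hx hy, ψ.comm m hm hx hy]⟩

@[ext]
lemma hom_ext {F F' : FiberFunctor K} {φ ψ : F ⟶ F'} (h : ∀ x hx, Hom.equiv φ x hx = Hom.equiv ψ x hx) : φ = ψ :=
  Hom.ext (funext fun x => funext fun hx => h x hx)

@[simp]
lemma comp_equiv {F F' F'' : FiberFunctor K} (φ : F ⟶ F') (ψ : F' ⟶ F'') (x : C) (hx) (a) :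
    Hom.equiv (φ ≫ ψ) x hx a = Hom.equiv ψ x hx (Hom.equiv φ x hx a) := rfl

/-- The inverse of an isomorphism. -/
def Hom.symm {F F' : FiberFunctor K} (φ : Hom F F') : Hom F' F where
  equiv x hx := (φ.equiv x hx).symm
  comm m hm hx hy a := by
    rw [Equiv.symm_apply_eq, φ.comm m hm hx hy, Equiv.apply_symm_apply]

instance : IsGroupoid (FiberFunctor K) := ⟨fun φ => ⟨Hom.symm φ,
  hom_ext fun x hx => Equiv.ext fun a => (Hom.equiv φ x hx).symm_apply_apply a,
  hom_ext fun x hx => Equiv.ext fun a => (Hom.equiv φ x hx).apply_symm_apply a⟩⟩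

/-- Restriction to a smaller subgraph. -/
def restrict (h : K ≤ L) : FiberFunctor K ⥤ FiberFunctor L where
  obj F := ⟨F.functor, F.isFiber⟩
  map φ := ⟨fun x hx => Hom.equiv φ x (h.1 hx), fun m hm _ _ => Hom.comm φ m (h.2 hm) _ _⟩

/-- The values at an object, as a functor of the fiber functor. -/
def eval (x : C) (hx : x ∈ K.objs) : FiberFunctor K ⥤ FintypeCat.Skeleton.{u} where
  obj F := F.functor.obj x
  map φ := ofFun (Hom.equiv φ x hx)

/-- Splitting data for a finite subgraph. -/
structure Splitting (K : FiniteSubgraph C) where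
  κ : Type
  finite : Finite κ
  obj : κ → C
  sec : κ → C → Type
  finite_sec : ∀ k x, Finite (sec k x)
  map : ∀ k, ∀ x ∈ K.objs, sec k x → (obj k ⟶ x)
  exists_elem (F : C ⥤ FintypeCat.Skeleton.{u}) : IsFiber F → ∃ k, Nonempty (Elem (F.obj (obj k)))
  bijective (F : C ⥤ FintypeCat.Skeleton.{u}) : IsFiber F → ∀ (k : κ) (a : Elem (F.obj (obj k))) x hx,
    Function.Bijective fun s => ap (F.map (map k x hx s)) a
  comm (k : κ) : ∀ m ∈ K.arrows, ∀ hx hy s, ∃ s', map k m.1 hx s ≫ m.2.2 = map k m.2.1 hy s'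

lemma nonempty_splitting [IsGaloisCategory C] (K : FiniteSubgraph C) : Nonempty (Splitting K) := by
  obtain ⟨κ, _, p, q, i, hi, hq, hp⟩ := exists_splitting_cover K.objs K.arrows
  choose n hn e he H using hp
  refine ⟨⟨κ, inferInstance, p, n, hn, e, fun F hF => ?_, fun F hF k a x hx => (he k x hx).bijective hF a, H⟩⟩
  obtain ⟨b, -⟩ := hF.terminal terminalIsTerminal
  obtain ⟨a, -⟩ := hF.descent hq b
  obtain ⟨k, a, -⟩ := hF.coprod hi a
  exact ⟨k, ⟨a⟩⟩

namespace Splitting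

variable (σ : Splitting K)

/-- The trivialization of a fiber functor given by an element. -/
noncomputable def triv (F : FiberFunctor K) {k : σ.κ} (a : Elem (F.functor.obj (σ.obj k))) (x : C) (hx : x ∈ K.objs) :
    σ.sec k x ≃ Elem (F.functor.obj x) :=
  Equiv.ofBijective _ (σ.bijective F.functor F.isFiber k a x hx)

lemma triv_apply (F : FiberFunctor K) {k : σ.κ} (a : Elem (F.functor.obj (σ.obj k))) (x : C) (hx : x ∈ K.objs)
    (s : σ.sec k x) : σ.triv F a x hx s = ap (F.functor.map (σ.map k x hx s)) a := rfl

/-- The isomorphism of fiber functors given by elements of their values at a splitting object. -/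
noncomputable def iso {F F' : FiberFunctor K} {k : σ.κ} (a : Elem (F.functor.obj (σ.obj k)))
    (a' : Elem (F'.functor.obj (σ.obj k))) : F ⟶ F' where
  equiv x hx := (σ.triv F a x hx).symm.trans (σ.triv F' a' x hx)
  comm m hm hx hy b := by
    obtain ⟨s, rfl⟩ := (σ.triv F a _ hx).surjective b
    obtain ⟨s', hs'⟩ := σ.comm k m hm hx hy s
    have h₁ : ap (F.functor.map m.2.2) (σ.triv F a _ hx s) = σ.triv F a _ hy s' := ap_map_eq F.functor hs' a
    have h₂ : ap (F'.functor.map m.2.2) (σ.triv F' a' _ hx s) = σ.triv F' a' _ hy s' := ap_map_eq F'.functor hs' a'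
    rw [h₁, Equiv.trans_apply, Equiv.trans_apply, Equiv.symm_apply_apply, Equiv.symm_apply_apply, h₂]

lemma iso_equiv {F F' : FiberFunctor K} {k : σ.κ} (a : Elem (F.functor.obj (σ.obj k)))
    (a' : Elem (F'.functor.obj (σ.obj k))) (x : C) (hx : x ∈ K.objs) (s : σ.sec k x) :
    Hom.equiv (σ.iso a a') x hx (ap (F.functor.map (σ.map k x hx s)) a) = ap (F'.functor.map (σ.map k x hx s)) a' := by
  rw [← triv_apply, ← triv_apply]
  exact congrArg (σ.triv F' a' x hx) (Equiv.symm_apply_apply _ _)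

lemma iso_comp_iso {F F' F'' : FiberFunctor K} {k : σ.κ} (a : Elem (F.functor.obj (σ.obj k)))
    (a' : Elem (F'.functor.obj (σ.obj k))) (a'' : Elem (F''.functor.obj (σ.obj k))) :
    σ.iso a a' ≫ σ.iso a' a'' = σ.iso a a'' := by
  ext x hx b
  obtain ⟨s, rfl⟩ := (σ.triv F a _ hx).surjective b
  rw [comp_equiv, triv_apply, iso_equiv, iso_equiv, iso_equiv]

end Splitting

/-- Two fiber functors with nonempty fiber at the same piece of a splitting are isomorphic over `K`,
so there are at most as many classes as pieces. An automorphism is a finite family of permutations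
of finite sets. -/
lemma isFiniteGroupoid [IsGaloisCategory C] (K : FiniteSubgraph C) : IsFiniteGroupoid (FiberFunctor K) where
  isGroupoid := inferInstance
  finite_isoClasses := by
    obtain ⟨σ⟩ := nonempty_splitting K
    have := σ.finite
    choose k a using fun q : Quotient (isIsomorphicSetoid (FiberFunctor K)) =>
      σ.exists_elem q.out.functor q.out.isFiber
    refine Finite.of_injective k fun q q' h => ?_
    rw [← q.out_eq, ← q'.out_eq]
    have ha := (a q).some
    rw [h] at ha
    exact Quotient.sound ⟨asIso (σ.iso ha (a q').some)⟩
  finite_aut F := by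
    refine Finite.of_injective (β := ∀ x : K.objs, Equiv.Perm (Elem (F.functor.obj x.1)))
      (fun φ x => Hom.equiv φ.hom x.1 x.2) fun φ ψ h => ?_
    exact Iso.ext (hom_ext fun x hx => congrFun h ⟨x, hx⟩)

end FiberFunctor

lemma CategoryTheory.Cat.toNatIso_app_eq_eqToHom {A B : Cat.{u, u}} {f g : A ⟶ B} (e : f ≅ g) (h : f = g)
    (he : e = eqToIso h) (x : A) : (Cat.Hom.toNatIso e).hom.app x = eqToHom (by rw [h]) := by
  subst h he
  rfl

section

variable (C : Type u) [Category.{u} C] [IsGaloisCategory C]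

/-- The fundamental groupoid of a Galois category. -/
noncomputable def fundamentalGroupoid : ProfiniteGroupoid.{u} where
  Idx := FiniteSubgraph C
  diagram := Functor.toPseudofunctor'
    { obj := fun K => Cat.of (FiberFunctor K)
      map := fun a => (FiberFunctor.restrict a.le).toCatHom }
  finite j := FiberFunctor.isFiniteGroupoid j.as

variable {C}

/-- Restriction is strictly functorial, so the constraints of the pseudofunctor are identities. This
is what lets stalks be defined by plain evaluation. -/
lemma trId_app (K : FiniteSubgraph C) (F : FiberFunctor K) :
    ((fundamentalGroupoid C).trId K).hom.app F = 𝟙 F := by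
  have he : (fundamentalGroupoid C).diagram.mapId ⟨K⟩ = eqToIso rfl := rfl
  exact Cat.toNatIso_app_eq_eqToHom _ rfl he F

lemma trComp_app {K L M : FiniteSubgraph C} (a : K ⟶ L) (b : L ⟶ M) (F : FiberFunctor K) :
    ((fundamentalGroupoid C).trComp a b).hom.app F = 𝟙 ((FiberFunctor.restrict (a ≫ b).le).obj F) := by
  have he : (fundamentalGroupoid C).diagram.mapComp a.toLoc b.toLoc = eqToIso rfl := rfl
  exact Cat.toNatIso_app_eq_eqToHom _ rfl he F

end

/-! ### Stalks, and morphisms as natural families of maps of stalks. -/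

namespace fundamentalGroupoid

open ProfiniteGroupoid

variable {C : Type u} [Category.{u} C] [IsGaloisCategory C] {E : Type u} [Category.{u} E]

/-- A fiber functor, as an object of each of the groupoids attached to finite subgraphs. -/
def pt {F : C ⥤ FintypeCat.Skeleton.{u}} (hF : IsFiber F) (K : (fundamentalGroupoid C).Idx) :
    (fundamentalGroupoid C).cat K :=
  (⟨F, hF⟩ : FiberFunctor (C := C) K)

/-- Evaluation at a fiber functor. -/
def elStalk {F : C ⥤ FintypeCat.Skeleton.{u}} (hF : IsFiber F) : El (fundamentalGroupoid C) E ⥤ E where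
  obj p := p.fib.obj (pt hF p.idx)
  map t := t.fiber.app (pt hF _)
  map_id p := (congrArg p.fib.map (trId_app p.idx (pt hF p.idx))).trans (p.fib.map_id _)
  map_comp {p _ _} f g := (congrArg (· ≫ _) ((congrArg p.fib.map (trComp_app g.base f.base (pt hF _))).trans
    (p.fib.map_id _))).trans (Category.id_comp _)

/-- The stalk at a fiber functor. -/
noncomputable def stalk {F : C ⥤ FintypeCat.Skeleton.{u}} (hF : IsFiber F) :
    Fun (fundamentalGroupoid C) E ⥤ E :=
  Fun.lift (elStalk hF) fun _ _ f (_ : IsIso f.fiber) => inferInstanceAs (IsIso (f.fiber.app (pt hF _)))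

variable {F : C ⥤ FintypeCat.Skeleton.{u}} (hF : IsFiber F)

lemma stalk_ι {p q : El (fundamentalGroupoid C) E} (t : p ⟶ q) :
    (stalk hF).map ((Fun.ι _ E).map t) = t.fiber.app (pt hF q.idx) :=
  Fun.lift_map _ _ t

lemma stalk_level {K : (fundamentalGroupoid C).Idx} {P Q : (fundamentalGroupoid C).cat K ⥤ E} (α : P ⟶ Q) :
    (stalk hF).map ((Fun.level _ E K).map α) = α.app (pt hF K) :=
  (stalk_ι hF (El.vert α)).trans ((congrArg (· ≫ _) ((congrArg P.map (trId_app K (pt hF K))).trans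
    (P.map_id _))).trans (Category.id_comp _))

lemma _root_.CategoryTheory.Functor.eq_of_comp_eq {A B : Type*} [Category* A] [Category* B] (G : A ⥤ B) {a b c d : A}
    {m n : a ⟶ b} {j : b ⟶ c} {i : a ⟶ d} {h h' : d ⟶ c} (e : m ≫ j = i ≫ h) (e' : n ≫ j = i ≫ h')
    [IsIso i] (hmn : G.map m = G.map n) : G.map h = G.map h' := by
  rw [← cancel_epi (G.map i), ← G.map_comp, ← G.map_comp, ← e, ← e', G.map_comp, G.map_comp, hmn]

/-- The groupoids attached to all finite subgraphs have the fiber functors as objects, so the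
components of a natural transformation at any level are its stalks. -/
lemma eq_of_stalk_level {K : (fundamentalGroupoid C).Idx} {P Q : (fundamentalGroupoid C).cat K ⥤ E}
    {m n : (Fun.level _ E K).obj P ⟶ (Fun.level _ E K).obj Q}
    (h : ∀ {F : C ⥤ FintypeCat.Skeleton.{u}} (hF : IsFiber F), (stalk hF).map m = (stalk hF).map n) : m = n := by
  obtain ⟨r, g, hg⟩ := Fun.exists_lifts_family fun b : Bool => bif b then m else n
  have h₁ := hg true
  have h₂ := hg false
  have : g true = g false := by
    ext ⟨F, hF⟩
    have := (stalk hF).eq_of_comp_eq h₁ h₂ (h hF)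
    exact (stalk_level hF (g true)).symm.trans (this.trans (stalk_level hF (g false)))
  refine (cancel_mono (r.toIso Q).hom).1 (h₁.trans (Eq.trans ?_ h₂.symm))
  exact congrArg (fun z => (r.toIso P).hom ≫ (Fun.level _ E r.idx).map z) this

lemma eq_of_stalk {p q : Fun (fundamentalGroupoid C) E} {m n : p ⟶ q}
    (h : ∀ {F : C ⥤ FintypeCat.Skeleton.{u}} (hF : IsFiber F), (stalk hF).map m = (stalk hF).map n) : m = n := by
  obtain ⟨r, P, ⟨e⟩⟩ := Fun.exists_level p.idx fun b : Bool => bif b then p else q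
  have : (e true).inv ≫ m ≫ (e false).hom = (e true).inv ≫ n ≫ (e false).hom :=
    eq_of_stalk_level fun hF => by
      rw [CategoryTheory.Functor.map_comp, CategoryTheory.Functor.map_comp, CategoryTheory.Functor.map_comp,
        CategoryTheory.Functor.map_comp, h hF]
  exact (cancel_mono (e false).hom).1 ((cancel_epi (e true).inv).1 this)

/-- The finite subgraph over which an object is defined. -/
def support (p : Fun (fundamentalGroupoid C) E) : FiniteSubgraph C := p.idx

/-- The action of isomorphisms of fiber functors on the stalks. -/
def transport {M : FiniteSubgraph C} (p : Fun (fundamentalGroupoid C) E) (hp : M ≤ support p)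
    {F F' : C ⥤ FintypeCat.Skeleton.{u}} {hF : IsFiber F} {hF' : IsFiber F'}
    (φ : (⟨F, hF⟩ : FiberFunctor M) ⟶ ⟨F', hF'⟩) : (stalk hF).obj p ⟶ (stalk hF').obj p :=
  p.fib.map (X := pt hF p.idx) (Y := pt hF' p.idx) ((FiberFunctor.restrict hp).map φ)

/-- A family of morphisms between the stalks of `p` and `q` is natural with respect to isomorphisms over
the finite subgraph `M`. -/
def IsNatural (M : FiniteSubgraph C) (p q : Fun (fundamentalGroupoid C) E) (hp : M ≤ support p) (hq : M ≤ support q)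
    (θ : ∀ {F : C ⥤ FintypeCat.Skeleton.{u}} (hF : IsFiber F), (stalk hF).obj p ⟶ (stalk hF).obj q) : Prop :=
  ∀ {F F' : C ⥤ FintypeCat.Skeleton.{u}} (hF : IsFiber F) (hF' : IsFiber F')
    (φ : (⟨F, hF⟩ : FiberFunctor M) ⟶ ⟨F', hF'⟩),
    transport p hp φ ≫ θ hF' = θ hF ≫ transport q hq φ

/-- A morphism of the Grothendieck construction is natural over the subgraph of its target; inverses
keep the subgraph, and a composite is natural over the union of two. -/
lemma exists_isNatural {p q : Fun (fundamentalGroupoid C) E} (m : p ⟶ q) :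
    ∃ M hp hq, IsNatural M p q hp hq fun hF => (stalk hF).map m := by
  refine Fun.hom_induction (P := fun {p q} m => ∃ M hp hq, IsNatural M p q hp hq fun hF => (stalk hF).map m)
    ?_ ?_ ?_ m
  · intro p q t
    let b : support ((Fun.ι _ E).obj q) ⟶ support ((Fun.ι _ E).obj p) := t.base
    refine ⟨support ((Fun.ι _ E).obj q), b.le, le_refl (α := FiniteSubgraph C) _, fun {F F'} hF hF' φ => ?_⟩
    have h := t.fiber.naturality (X := pt hF q.idx) (Y := pt hF' q.idx) φ
    exact (congrArg (_ ≫ ·) (stalk_ι hF' t)).trans (h.trans (congrArg (· ≫ _) (stalk_ι hF t).symm))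
  · rintro p q e ⟨M, hp, hq, H⟩
    refine ⟨M, hq, hp, fun {F F'} hF hF' φ => ?_⟩
    have := H hF hF' φ
    change _ ≫ ((stalk hF').mapIso e).inv = ((stalk hF).mapIso e).inv ≫ _
    rw [Iso.comp_inv_eq, Category.assoc, Iso.eq_inv_comp]
    exact this.symm
  · rintro p q r f g ⟨M, hp, hq, H⟩ ⟨M', hq', hr', H'⟩
    let N := M.union M'
    have h₁ := M.union_le_left M'
    have h₂ := M.union_le_right M'
    refine ⟨N, h₁.trans hp, h₂.trans hr', fun {F F'} hF hF' φ => ?_⟩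
    have e₁ := H hF hF' ((FiberFunctor.restrict h₁).map φ)
    have e₂ := H' hF hF' ((FiberFunctor.restrict h₂).map φ)
    have e₃ := (stalk hF).map_comp f g
    have e₄ := (stalk hF').map_comp f g
    exact (congrArg (_ ≫ ·) e₄).trans ((comp_square e₁ e₂).trans (congrArg (· ≫ _) e₃.symm))

/-- The family is a natural transformation between the restrictions of `p` and `q` to `M`, and the
restriction morphisms `El.trans` are identities on stalks. -/
lemma exists_hom_of_isNatural (M : FiniteSubgraph C) (p q : Fun (fundamentalGroupoid C) E) (hp : M ≤ support p)
    (hq : M ≤ support q) (θ : ∀ {F : C ⥤ FintypeCat.Skeleton.{u}} (hF : IsFiber F), (stalk hF).obj p ⟶ (stalk hF).obj q)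
    (h : IsNatural M p q hp hq θ) :
    ∃ m : p ⟶ q, ∀ {F : C ⥤ FintypeCat.Skeleton.{u}} (hF : IsFiber F), (stalk hF).map m = θ hF := by
  let K : (fundamentalGroupoid C).Idx := M
  let a : K ⟶ p.idx := (homOfLE hp : M ⟶ support p)
  let b : K ⟶ q.idx := (homOfLE hq : M ⟶ support q)
  let α : (fundamentalGroupoid C).tr a ⋙ p.fib ⟶ (fundamentalGroupoid C).tr b ⋙ q.fib :=
    { app := fun x => θ x.isFiber
      naturality := fun x y φ => h x.isFiber y.isFiber φ }
  have : IsIso ((Fun.ι _ E).map (El.trans b q.fib)) := inferInstance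
  let t : q ⟶ (Fun.level _ E K).obj ((fundamentalGroupoid C).tr b ⋙ q.fib) := (Fun.ι _ E).map (El.trans b q.fib)
  have : IsIso t := this
  let s : p ⟶ (Fun.level _ E K).obj ((fundamentalGroupoid C).tr a ⋙ p.fib) := (Fun.ι _ E).map (El.trans a p.fib)
  refine ⟨s ≫ (Fun.level _ E K).map α ≫
    inv t, fun hF => ?_⟩
  have h₁ : (stalk hF).map s = 𝟙 _ := stalk_ι hF _
  have h₂ : (stalk hF).map t = 𝟙 _ := stalk_ι hF _
  have h₃ : (stalk hF).map ((Fun.level _ E K).map α) = θ hF := stalk_level hF α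
  have h₄ : (stalk hF).map (inv t) = 𝟙 _ :=
    ((stalk hF).map_inv _).trans (IsIso.inv_eq_of_hom_inv_id ((congrArg (· ≫ 𝟙 _) h₂).trans (Category.id_comp _)))
  rw [CategoryTheory.Functor.map_comp, CategoryTheory.Functor.map_comp]
  exact (congrArg₂ (· ≫ ·) h₁ (congrArg₂ (· ≫ ·) h₃ h₄)).trans ((Category.id_comp _).trans (Category.comp_id _))

end fundamentalGroupoid

lemma FiniteSubgraph.exists_le {C : Type u} [Category.{u} C] (K : FiniteSubgraph C) {α β : Type*} [Finite α] [Finite β]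
    (x : α → C) (m : β → Arr C) : ∃ L ≤ K, (∀ a, x a ∈ L.objs) ∧
      ∀ b, m b ∈ L.arrows ∧ (m b).1 ∈ L.objs ∧ (m b).2.1 ∈ L.objs := by
  classical
  have := Fintype.ofFinite α
  have := Fintype.ofFinite β
  refine ⟨⟨K.objs ∪ (Finset.univ.image x ∪ (Finset.univ.image (fun b => (m b).1) ∪
    Finset.univ.image fun b => (m b).2.1)), K.arrows ∪ Finset.univ.image m⟩,
    ⟨Finset.subset_union_left, Finset.subset_union_left⟩, fun a => ?_, fun b => ⟨?_, ?_, ?_⟩⟩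
  · simp
  · simp
  · simp only [Finset.mem_union, Finset.mem_image, Finset.mem_univ, true_and]
    exact Or.inr (Or.inr (Or.inl ⟨b, rfl⟩))
  · simp only [Finset.mem_union, Finset.mem_image, Finset.mem_univ, true_and]
    exact Or.inr (Or.inr (Or.inr ⟨b, rfl⟩))

/-- Functions out of the value of a fiber functor at a coproduct. -/
lemma IsFiber.exists_desc {C : Type u} [Category.{u} C] {F : C ⥤ FintypeCat.Skeleton.{u}} (hF : IsFiber F) {ι : Type}
    [Finite ι] {x : ι → C} {p : C} {i : ∀ k, x k ⟶ p} (h : IsCoprod i) {T : Type*}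
    (g : ∀ k, Elem (F.obj (x k)) → T) : ∃ q : Elem (F.obj p) → T, ∀ k a, q (ap (F.map (i k)) a) = g k a := by
  choose k b hb using hF.coprod h
  refine ⟨fun a => g (k a) (b a), fun l a => ?_⟩
  have h' := hF.coprod_ext h (hb (ap (F.map (i l)) a))
  exact congrArg (fun z : Σ k, Elem (F.obj (x k)) => g z.1 z.2) h'

lemma IsFiber.ap_map_comm {C : Type u} [Category.{u} C] {F : C ⥤ FintypeCat.Skeleton.{u}} {x y y' z : C} {f : x ⟶ y}
    {g : y ⟶ z} {f' : x ⟶ y'} {g' : y' ⟶ z} (h : f ≫ g = f' ≫ g') (a : Elem (F.obj x)) :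
    ap (F.map g) (ap (F.map f) a) = ap (F.map g') (ap (F.map f') a) := by
  rw [← IsFiber.ap_map_comp, h, IsFiber.ap_map_comp]

lemma exists_equiv_of_surjective {A B Z : Type*} {c : A → Z} {q : A → B} (hc : Function.Surjective c)
    (hq : Function.Surjective q) (h : ∀ u v, c u = c v ↔ q u = q v) : ∃ e : Z ≃ B, ∀ a, e (c a) = q a := by
  have e (a : A) : q (Function.surjInv hc (c a)) = q a := (h _ _).1 (Function.surjInv_eq hc _)
  refine ⟨Equiv.ofBijective (fun z => q (Function.surjInv hc z)) ⟨fun z z' hz => ?_, fun b => ?_⟩, e⟩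
  · obtain ⟨a, rfl⟩ := hc z
    obtain ⟨a', rfl⟩ := hc z'
    exact (h _ _).2 ((e a).symm.trans (hz.trans (e a')))
  · obtain ⟨a, rfl⟩ := hq b
    exact ⟨c a, e a⟩

/-! ### Realizing invariant subsets, maps and functors by objects and morphisms. -/

namespace FiberFunctor

variable {C : Type u} [Category.{u} C] {K L : FiniteSubgraph C}

lemma Splitting.iso_self (σ : Splitting K) {F : FiberFunctor K} {k : σ.κ} (a : Elem (F.functor.obj (σ.obj k))) :
    σ.iso a a = 𝟙 F := by
  ext x hx b
  obtain ⟨s, rfl⟩ := (σ.triv F a _ hx).surjective b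
  rw [triv_apply, iso_equiv]
  rfl

lemma Splitting.iso_comp (σ : Splitting K) {F F' F'' : FiberFunctor K} {k : σ.κ}
    (a : Elem (F.functor.obj (σ.obj k))) (a' : Elem (F'.functor.obj (σ.obj k)))
    (a'' : Elem (F''.functor.obj (σ.obj k))) (ψ : F' ⟶ F'') (h : ∀ x hx s,
      Hom.equiv ψ x hx (ap (F'.functor.map (σ.map k x hx s)) a') = ap (F''.functor.map (σ.map k x hx s)) a'') :
    σ.iso a a' ≫ ψ = σ.iso a a'' := by
  ext x hx b
  obtain ⟨s, rfl⟩ := (σ.triv F a _ hx).surjective b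
  rw [comp_equiv, triv_apply, iso_equiv, iso_equiv, h]

variable [IsGaloisCategory C]

/-- A family of subsets of the values of the fiber functors at `z` which is invariant under the isomorphisms
over a finite subgraph is the family of images of a morphism to `z`. -/
lemma exists_range_eq {z : C} (hz : z ∈ K.objs) (U : ∀ F : FiberFunctor K, Set (Elem (F.functor.obj z)))
    (hU : ∀ {F F' : FiberFunctor K} (φ : F ⟶ F'), ∀ a ∈ U F, Hom.equiv φ z hz a ∈ U F') :
    ∃ (w : C) (h : w ⟶ z), ∀ F : FiberFunctor K, Set.range (ap (F.functor.map h)) = U F := by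
  obtain ⟨σ⟩ := nonempty_splitting K
  have := σ.finite
  have := σ.finite_sec
  -- Keep the sections that meet `U` at some point of their piece. Any two points of a piece, even
  -- for different fiber functors, are related by `σ.iso`, so by invariance such a section then lies
  -- in `U` at every point.
  let J := {j : Σ k, σ.sec k z // ∃ (F : FiberFunctor K) (a : Elem (F.functor.obj (σ.obj j.1))),
    ap (F.functor.map (σ.map j.1 z hz j.2)) a ∈ U F}
  have h := IsCoprod.sigma fun j : J => σ.obj j.1.1
  refine ⟨_, h.desc fun j => σ.map j.1.1 z hz j.1.2, fun F => Set.ext fun b => ⟨?_, fun hb => ?_⟩⟩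
  · rintro ⟨a, rfl⟩
    obtain ⟨⟨⟨k, s⟩, F₀, a₀, h₀⟩, a, rfl⟩ := F.isFiber.coprod h a
    rw [IsFiber.ap_map_eq (h.fac _ _)]
    have := hU (σ.iso a₀ a) _ h₀
    rwa [σ.iso_equiv] at this
  · obtain ⟨k, ⟨a⟩⟩ := σ.exists_elem F.functor F.isFiber
    obtain ⟨s, rfl⟩ := (σ.bijective F.functor F.isFiber k a z hz).surjective b
    let j : J := ⟨⟨k, s⟩, F, a, hb⟩
    exact ⟨ap (F.functor.map (Sigma.ι (fun j : J => σ.obj j.1.1) j)) a,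
      IsFiber.ap_map_eq (h.fac (fun j : J => σ.map j.1.1 z hz j.1.2) j) a⟩

/-- A family of maps which is natural with respect to the isomorphisms over a finite subgraph is induced by a
morphism. -/
lemma exists_hom_of_natural {x y : C} (hx : x ∈ K.objs) (hy : y ∈ K.objs)
    (θ : ∀ F : FiberFunctor K, Elem (F.functor.obj x) → Elem (F.functor.obj y))
    (hθ : ∀ {F F' : FiberFunctor K} (φ : F ⟶ F') a, θ F' (Hom.equiv φ x hx a) = Hom.equiv φ y hy (θ F a)) :
    ∃ f : x ⟶ y, ∀ (F : FiberFunctor K) a, ap (F.functor.map f) a = θ F a := by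
  -- Adding `x ⨯ y` and its projections to the subgraph makes the graph of `θ` an invariant family
  -- of subsets, hence the image of some `h : w ⟶ x ⨯ y`.
  obtain ⟨L, hL, -, hm⟩ := K.exists_le (fun z : Empty => z.elim) fun b : Bool =>
    bif b then (⟨x ⨯ y, x, prod.fst⟩ : Arr C) else ⟨x ⨯ y, y, prod.snd⟩
  obtain ⟨h₁, hz, h₁'⟩ := hm true
  obtain ⟨h₂, -, h₂'⟩ := hm false
  obtain ⟨w, h, hw⟩ := exists_range_eq (K := L) (z := x ⨯ y) hz
    (fun F => {b | θ ⟨F.functor, F.isFiber⟩ (ap (F.functor.map (prod.fst : x ⨯ y ⟶ x)) b) =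
      ap (F.functor.map (prod.snd : x ⨯ y ⟶ y)) b}) fun {F F'} φ a ha => by
    have e₁ := Hom.comm φ _ h₁ hz h₁' a
    have e₂ := Hom.comm φ _ h₂ hz h₂' a
    exact (congrArg (θ _) e₁.symm).trans ((hθ ((restrict hL).map φ) _).trans ((congrArg _ ha).trans e₂))
  have hq {F : C ⥤ FintypeCat.Skeleton.{u}} (hF : IsFiber F) (a : Elem (F.obj w)) :
      ap (F.map (h ≫ (prod.snd : x ⨯ y ⟶ y))) a =
        θ ⟨F, hF⟩ (ap (F.map (h ≫ (prod.fst : x ⨯ y ⟶ x))) a) := by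
    have := (hw ⟨F, hF⟩).subset ⟨a, rfl⟩
    rw [IsFiber.ap_map_comp, IsFiber.ap_map_comp]
    exact this.symm
  have hp {F : C ⥤ FintypeCat.Skeleton.{u}} (hF : IsFiber F) :
      Function.Surjective (ap (F.map (h ≫ (prod.fst : x ⨯ y ⟶ x)))) := fun c => by
    obtain ⟨b, hb, hb'⟩ := hF.exists_prod c (θ ⟨F, hF⟩ c)
    obtain ⟨a, ha⟩ : b ∈ Set.range (ap (F.map h)) := by
      rw [hw ⟨F, hF⟩]
      exact (congrArg _ hb).trans hb'.symm
    exact ⟨a, by rw [IsFiber.ap_map_comp, ha, hb]⟩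
  -- The first projection of the graph is surjective on fibers, hence a coequalizer, and the second
  -- projection factors through it since it depends only on the first.
  obtain ⟨⟨r⟩⟩ := isRegularEpi_of_isFiber (h ≫ (prod.fst : x ⨯ y ⟶ x)) fun F hF => hp hF
  obtain ⟨f, hf⟩ := Cofork.IsColimit.desc' r.isColimit (h ≫ (prod.snd : x ⨯ y ⟶ y)) <|
    hom_ext_of_isFiber fun F hF a => by
      rw [IsFiber.ap_map_comp r.left, IsFiber.ap_map_comp r.right, hq hF, hq hF, IsFiber.ap_map_comm r.w]
  refine ⟨f, fun F a => ?_⟩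
  obtain ⟨b, rfl⟩ := hp F.isFiber a
  exact (IsFiber.ap_map_eq hf b).trans (hq F.isFiber b)

/-- A functor on the groupoid attached to a finite subgraph is covered by an object. -/
lemma exists_surjective_natural (P : FiberFunctor K ⥤ FintypeCat.Skeleton.{u}) :
    ∃ (w : C) (L : FiniteSubgraph C) (hL : L ≤ K) (hw : w ∈ L.objs)
      (q : ∀ F : FiberFunctor K, Elem (F.functor.obj w) → Elem (P.obj F)),
      (∀ F, Function.Surjective (q F)) ∧ ∀ {F F' : FiberFunctor L} (φ : F ⟶ F') a,
        q ((restrict hL).obj F') (Hom.equiv φ w hw a) = ap (P.map ((restrict hL).map φ)) (q ((restrict hL).obj F) a) := by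
  obtain ⟨σ⟩ := nonempty_splitting K
  have := σ.finite
  have := σ.finite_sec
  let J := {k : σ.κ // ∃ F : FiberFunctor K, Nonempty (Elem (F.functor.obj (σ.obj k)))}
  choose F₀ a₀ using fun k : J => k.2
  replace a₀ := fun k : J => (a₀ k).some
  -- One copy of the piece is taken for each element of `P` at a chosen base fiber functor; the map
  -- `q` transports this element along the isomorphism from the base point to the given point.
  let I := Σ k : J, Fin (P.obj (F₀ k)).len
  have h := IsCoprod.sigma fun j : I => σ.obj j.1.1
  let i := Sigma.ι fun j : I => σ.obj j.1.1
  choose q hq using fun F : FiberFunctor K => F.isFiber.exists_desc h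
    fun j a => ap (P.map (σ.iso (a₀ j.1) a)) ⟨j.2⟩
  -- The subgraph must contain the inclusions of the copies and all sections of the splitting: an
  -- isomorphism that respects these carries `σ.iso` to `σ.iso`.
  obtain ⟨L, hL, hw, hm⟩ := K.exists_le (fun _ : Unit => ∐ fun j : I => σ.obj j.1.1)
    (Sum.elim (fun j : I => (⟨_, _, i j⟩ : Arr C))
      fun m : Σ k : σ.κ, Σ x : K.objs, σ.sec k x => ⟨_, _, σ.map m.1 m.2.1.1 m.2.1.2 m.2.2⟩)
  refine ⟨_, L, hL, hw (), q, fun F b => ?_, fun {F F'} φ a => ?_⟩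
  · obtain ⟨k, ⟨a⟩⟩ := σ.exists_elem F.functor F.isFiber
    let k' : J := ⟨k, F, ⟨a⟩⟩
    let b' := ap (P.map (σ.iso a (a₀ k'))) b
    refine ⟨ap (F.functor.map (i ⟨k', b'.down⟩)) a, (hq F ⟨k', b'.down⟩ a).trans ?_⟩
    change ap (P.map (σ.iso (a₀ k') a)) (ap (P.map (σ.iso a (a₀ k'))) b) = b
    rw [← IsFiber.ap_map_comp, σ.iso_comp_iso, σ.iso_self, CategoryTheory.Functor.map_id, ap_id]
  · obtain ⟨j, a, rfl⟩ := F.isFiber.coprod h a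
    obtain ⟨h₁, h₂, h₃⟩ := hm (Sum.inl j)
    have e₁ := Hom.comm φ _ h₁ h₂ h₃ a
    have e₂ := σ.iso_comp (a₀ j.1) (F' := (restrict hL).obj F) (F'' := (restrict hL).obj F') a
      (Hom.equiv φ _ h₂ a) ((restrict hL).map φ) fun x hx s => by
        obtain ⟨h₄, h₅, h₆⟩ := hm (Sum.inr ⟨j.1.1, ⟨x, hx⟩, s⟩)
        exact Hom.comm φ _ h₄ h₅ h₆ a
    refine (congrArg (q _) e₁).trans ((hq _ j _).trans ?_)
    rw [← e₂, CategoryTheory.Functor.map_comp, ap_comp]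
    exact congrArg (ap (P.map ((restrict hL).map φ))) (hq ((restrict hL).obj F) j a).symm

/-- Every functor on the groupoid attached to a finite subgraph is represented, over a larger finite subgraph, by
an object. -/
lemma exists_bijective_natural (P : FiberFunctor K ⥤ FintypeCat.Skeleton.{u}) :
    ∃ (z : C) (L : FiniteSubgraph C) (hL : L ≤ K) (hz : z ∈ L.objs)
      (θ : ∀ F : FiberFunctor K, Elem (F.functor.obj z) ≃ Elem (P.obj F)),
      ∀ {F F' : FiberFunctor L} (φ : F ⟶ F') a, θ ((restrict hL).obj F') (Hom.equiv φ z hz a) =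
        ap (P.map ((restrict hL).map φ)) (θ ((restrict hL).obj F) a) := by
  obtain ⟨w, L, hL, hw, q, hq, hq'⟩ := exists_surjective_natural P
  obtain ⟨M, hM, -, hm⟩ := L.exists_le (fun z : Empty => z.elim) fun b : Bool =>
    (⟨w ⨯ w, w, bif b then prod.fst else prod.snd⟩ : Arr C)
  obtain ⟨h₁, hz, h₁'⟩ := hm true
  obtain ⟨h₂, -, h₂'⟩ := hm false
  -- The kernel relation of `q` is invariant, hence the image of a morphism `h` to `w ⨯ w`.
  obtain ⟨r, h, hr⟩ := exists_range_eq (K := M) (z := w ⨯ w) hz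
    (fun F => {b | q ⟨F.functor, F.isFiber⟩ (ap (F.functor.map (prod.fst : w ⨯ w ⟶ w)) b) =
      q ⟨F.functor, F.isFiber⟩ (ap (F.functor.map (prod.snd : w ⨯ w ⟶ w)) b)}) fun {F F'} φ a ha => by
    have e₁ := Hom.comm φ _ h₁ hz h₁' a
    have e₂ := Hom.comm φ _ h₂ hz h₂' a
    exact (congrArg (q _) e₁.symm).trans ((hq' ((restrict hM).map φ) _).trans ((congrArg _ ha).trans
      ((hq' ((restrict hM).map φ) _).symm.trans (congrArg (q _) e₂))))
  -- On fibers the coequalizer divides by the equivalence relation generated by the kernel relation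
  -- of `q`. That relation is already an equivalence, so the fibers of `z` are the values of `P`.
  obtain ⟨z, c, hc, -, H⟩ := exists_coequalizer (h ≫ (prod.fst : w ⨯ w ⟶ w)) (h ≫ (prod.snd : w ⨯ w ⟶ w))
  have key (F : FiberFunctor K) (u v : Elem (F.functor.obj w)) :
      ap (F.functor.map c) u = ap (F.functor.map c) v ↔ q F u = q F v := by
    constructor
    · intro huv
      replace huv := (H F.functor F.isFiber).2 u v huv
      induction huv with
      | rel u v e =>
        obtain ⟨a, rfl, rfl⟩ := e
        have := (hr ⟨F.functor, F.isFiber⟩).subset ⟨a, rfl⟩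
        rw [IsFiber.ap_map_comp, IsFiber.ap_map_comp]
        exact this
      | refl => rfl
      | symm _ _ _ ih => exact ih.symm
      | trans _ _ _ _ _ ih ih' => exact ih.trans ih'
    · intro huv
      obtain ⟨b, rfl, rfl⟩ := F.isFiber.exists_prod u v
      obtain ⟨a, rfl⟩ := (hr ⟨F.functor, F.isFiber⟩).superset huv
      have := IsFiber.ap_map_comm (F := F.functor) hc a
      rw [IsFiber.ap_map_comp, IsFiber.ap_map_comp] at this
      exact this
  choose θ hθ using fun F : FiberFunctor K => exists_equiv_of_surjective (H F.functor F.isFiber).1 (hq F) (key F)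
  obtain ⟨N, hN, -, hm'⟩ := M.exists_le (fun z : Empty => z.elim) fun _ : Unit => (⟨w, z, c⟩ : Arr C)
  obtain ⟨h₃, hw', hz'⟩ := hm' ()
  refine ⟨z, N, hN.trans (hM.trans hL), hz', θ, fun {F F'} φ a => ?_⟩
  obtain ⟨a, rfl⟩ := (H F.functor F.isFiber).1 a
  have e₁ := Hom.comm φ _ h₃ hw' hz' a
  have e₂ := hθ ((restrict (hN.trans (hM.trans hL))).obj F) a
  have e₃ := hθ ((restrict (hN.trans (hM.trans hL))).obj F') (Hom.equiv φ w hw' a)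
  exact (congrArg (θ _) e₁).trans (e₃.trans ((hq' ((restrict (hN.trans hM)).map φ) a).trans
    (congrArg (ap (P.map _)) e₂.symm)))

end FiberFunctor

/-! ### Evaluation as an equivalence, and the conclusion. -/

namespace fundamentalGroupoid

open ProfiniteGroupoid FiberFunctor

variable {C : Type u} [Category.{u} C] [IsGaloisCategory C]

/-- The functor `F ↦ F x`. -/
def evalObj (x : C) : Fun (fundamentalGroupoid C) FintypeCat.Skeleton.{u} :=
  ⟨(⟨{x}, ∅⟩ : FiniteSubgraph C), FiberFunctor.eval x (Finset.mem_singleton_self x)⟩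

lemma le_support_evalObj {M : FiniteSubgraph C} {x : C} (h : x ∈ M.objs) : M ≤ support (evalObj x) :=
  ⟨Finset.singleton_subset_iff.2 h, Finset.empty_subset _⟩

lemma mem_of_le_support {M : FiniteSubgraph C} {x : C} (h : M ≤ support (evalObj x)) : x ∈ M.objs :=
  Finset.singleton_subset_iff.1 h.1

lemma exists_evalMap {x y : C} (f : x ⟶ y) : ∃ m : evalObj x ⟶ evalObj y,
    ∀ {F : C ⥤ FintypeCat.Skeleton.{u}} (hF : IsFiber F), (stalk hF).map m = F.map f := by
  obtain ⟨K⟩ := (inferInstance : Nonempty (FiniteSubgraph C))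
  obtain ⟨M, -, -, hM⟩ := K.exists_le (fun z : Empty => z.elim) fun _ : Unit => (⟨x, y, f⟩ : Arr C)
  obtain ⟨hf, hx, hy⟩ := hM ()
  refine exists_hom_of_isNatural M (evalObj x) (evalObj y) (le_support_evalObj hx) (le_support_evalObj hy)
    (fun {F} _ => F.map f) fun {F F'} hF hF' φ => FintypeCat.Skeleton.hom_ext fun a => ?_
  exact (φ.comm _ hf hx hy a).symm

/-- The functor sending an object `x` to `F ↦ F x`. -/
noncomputable def evalFunctor (C : Type u) [Category.{u} C] [IsGaloisCategory C] :
    C ⥤ Fun (fundamentalGroupoid C) FintypeCat.Skeleton.{u} where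
  obj := evalObj
  map f := (exists_evalMap f).choose
  map_id x := eq_of_stalk fun {F} hF => ((exists_evalMap (𝟙 x)).choose_spec hF).trans
    ((F.map_id x).trans ((stalk hF).map_id (evalObj x)).symm)
  map_comp f g := eq_of_stalk fun {F} hF => ((exists_evalMap (f ≫ g)).choose_spec hF).trans
    ((F.map_comp f g).trans ((congrArg₂ (· ≫ ·) ((exists_evalMap f).choose_spec hF)
      ((exists_evalMap g).choose_spec hF)).symm.trans ((stalk hF).map_comp _ _).symm))

lemma stalk_evalFunctor {x y : C} (f : x ⟶ y) {F : C ⥤ FintypeCat.Skeleton.{u}} (hF : IsFiber F) :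
    (stalk hF).map ((evalFunctor C).map f) = F.map f :=
  (exists_evalMap f).choose_spec hF

instance : (evalFunctor C).Faithful where
  map_injective {x y f g} h := hom_ext_of_isFiber fun F hF a => by
    rw [← stalk_evalFunctor f hF, ← stalk_evalFunctor g hF, h]

lemma exists_natural {x y : C} (m : evalObj x ⟶ evalObj y) :
    ∃ (M : FiniteSubgraph C) (hx : x ∈ M.objs) (hy : y ∈ M.objs), ∀ {F F' : FiberFunctor M} (φ : F ⟶ F') a,
      ap ((stalk F'.isFiber).map m) (Hom.equiv φ x hx a) = Hom.equiv φ y hy (ap ((stalk F.isFiber).map m) a) := by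
  obtain ⟨M, hx, hy, H⟩ := exists_isNatural m
  exact ⟨M, mem_of_le_support hx, mem_of_le_support hy, fun {F F'} φ a =>
    congrFun (H F.isFiber F'.isFiber φ) a⟩

instance : (evalFunctor C).Full where
  map_surjective {x y} m := by
    obtain ⟨M, hx, hy, H⟩ := exists_natural m
    obtain ⟨f, hf⟩ := exists_hom_of_natural hx hy (fun F => ap ((stalk F.isFiber).map m)) H
    exact ⟨f, eq_of_stalk fun {F} hF => (stalk_evalFunctor f hF).trans
      (FintypeCat.Skeleton.hom_ext fun a => hf ⟨F, hF⟩ a)⟩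

instance : (evalFunctor C).EssSurj where
  mem_essImage p := by
    obtain ⟨z, L, hL, hz, θ, hθ⟩ := exists_bijective_natural (K := support p) p.fib
    obtain ⟨m, hm⟩ := exists_hom_of_isNatural L (evalObj z) p (le_support_evalObj hz) hL
      (fun {F} hF => ofFun (θ ⟨F, hF⟩)) fun {F F'} hF hF' φ =>
        FintypeCat.Skeleton.hom_ext fun a => hθ φ a
    obtain ⟨n, hn⟩ := exists_hom_of_isNatural L p (evalObj z) hL (le_support_evalObj hz)
      (fun {F} hF => ofFun (θ ⟨F, hF⟩).symm) fun {F F'} hF hF' φ =>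
        FintypeCat.Skeleton.hom_ext fun a => by
          refine (Equiv.symm_apply_eq _).2 ?_
          refine Eq.trans ?_ (hθ φ _).symm
          exact congrArg (ap (p.fib.map _)) ((θ ⟨F, hF⟩).apply_symm_apply a).symm
    refine ⟨z, ⟨m, n, eq_of_stalk fun {F} hF => ?_, eq_of_stalk fun {F} hF => ?_⟩⟩
    · refine ((stalk hF).map_comp m n).trans (Eq.trans ?_ ((stalk hF).map_id _).symm)
      exact (congrArg₂ (· ≫ ·) (hm hF) (hn hF)).trans
        (FintypeCat.Skeleton.hom_ext fun a => (θ ⟨F, hF⟩).symm_apply_apply a)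
    · refine ((stalk hF).map_comp n m).trans (Eq.trans ?_ ((stalk hF).map_id _).symm)
      exact (congrArg₂ (· ≫ ·) (hn hF) (hm hF)).trans
        (FintypeCat.Skeleton.hom_ext fun a => (θ ⟨F, hF⟩).apply_symm_apply a)

instance : (evalFunctor C).IsEquivalence where

end fundamentalGroupoid

lemma IsGaloisFunctor.of_isEquivalence {C D : Type u} [Category.{u} C] [Category.{u} D] [IsGaloisCategory C]
    [IsGaloisCategory D] (G : C ⥤ D) [G.IsEquivalence] : IsGaloisFunctor G :=
  have : PreservesFiniteCoproducts G := ⟨fun _ => inferInstance⟩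
  IsGaloisFunctor.of_preserves G

/-- Equivalent Galois categories are equivalent in the 2-category of Galois categories. -/
noncomputable def GalCat.equivalenceMk {C D : GalCat.{u}} (e : C.carrier ≌ D.carrier) : C ≌ D :=
  have := C.isGalois
  have := D.isGalois
  let F : C ⟶ D := (⟨e.functor, IsGaloisFunctor.of_isEquivalence _⟩ : GalCat.Hom C D)
  let G : D ⟶ C := (⟨e.inverse, IsGaloisFunctor.of_isEquivalence _⟩ : GalCat.Hom D C)
  Equivalence.mkOfAdjointifyCounit (f := F) (g := G)
    (GalCat.isoMk (F := GalCat.Hom.mk _ (𝟙 C : GalCat.Hom C C).isGalois)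
      (G := GalCat.Hom.mk _ (F ≫ G : GalCat.Hom C C).isGalois) e.unitIso)
    (GalCat.isoMk (F := GalCat.Hom.mk _ (G ≫ F : GalCat.Hom D D).isGalois)
      (G := GalCat.Hom.mk _ (𝟙 D : GalCat.Hom D D).isGalois) e.counitIso)

theorem theorem5 : ∃ h : ProfiniteGroupoid.SendsToGalois.{u},
    (ProfiniteGroupoid.toGalCat h).IsBiequivalence := by
  refine ⟨ProfiniteGroupoid.sendsToGalois, fun a b => ProfiniteGroupoid.isEquivalence_mapFunctor _ a b, fun c => ?_⟩
  have := c.isGalois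
  exact ⟨⟨fundamentalGroupoid c.carrier⟩, ⟨GalCat.equivalenceMk
    (C := ProfiniteGroupoid.galCat ProfiniteGroupoid.sendsToGalois (fundamentalGroupoid c.carrier))
    (fundamentalGroupoid.evalFunctor c.carrier).asEquivalence.symm⟩⟩
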